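/- Conventions. Let $M$ be a Hausdorff $C^\infty$ manifold of dimension $2m+1$, $(H,J)$ a CR structure on $M$ (a rank $2m$ subbundle $H\subset TM$ with $J:H\to H$, $J^2=-1$, such that $H^{1,0}=\{X-iJX : X\in H\}$ is involutive), and $\theta$ a nowhere vanishing smooth one-form with $\ker\theta=H$ such that the Levi form $L_\theta(X,Y)=d\theta(X,JY)$ is positive definite on $H$, where $d\theta(X,Y)=\tfrac12\big(X\theta(Y)-Y\theta(X)-\theta([X,Y])\big)$. Let $\xi$ be the Reeb field ($\theta(\xi)=1$, $d\theta(\xi,\cdot)=0$), extend $J$ to $TM$ by $J\xi=0$, let $\pi_H:TM\to H$ be the projection along $\xi$, and let $\langle X,Y\rangle=\theta(X)\theta(Y)+d\theta(\pi_HX,J\pi_HY)$ be the Webster metric. Let $\nabla$ be the Tanaka–Webster connection: the unique smooth linear connection on $TM$ that preserves $H$, satisfies $\nabla\langle\cdot,\cdot\rangle=0$ and $\nabla J=0$, and whose torsion $T$ satisfies $T(X,Y)=2\,d\theta(X,Y)\,\xi$ and $T(\xi,JX)+J\,T(\xi,X)=0$ for horizontal $X,Y$. $M$ is Sasakian if $T(\xi,\cdot)=0$.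 With $R(X,Y)Z=\nabla_X\nabla_YZ-\nabla_Y\nabla_XZ-\nabla_{[X,Y]}Z$, the horizontal sectional curvature of a plane $\sigma\subset H_x$ spanned by $X,Y$ is $$K^H(\sigma)=\frac{\langle R(X,Y)Y,X\rangle}{\langle X,X\rangle\langle Y,Y\rangle-\langle X,Y\rangle^2}.$$ A $\nabla$-geodesic is a curve with $\nabla_{\gamma'}\gamma'=0$; $\exp_p(v)=\gamma_v(1)$, for those $v\in T_pM$ for which the $\nabla$-geodesic $\gamma_v$ with $\gamma_v(0)=p$, $\gamma_v'(0)=v$ is defined on $[0,1]$. The point $q=\exp_p(v)$ is conjugate to $p$ along $\gamma_v$ if the differential $(d\exp_p)_v$ is singular. Theorem 5.3. Let $M$ be a Sasakian manifold as above, let $k_0>0$, and assume that $K^H(\sigma)\ge k_0$ for every horizontal $2$-plane $\sigma\subset T_xM$ and every $x\in M$. Let $\gamma:[a,b]\to M$ be a $\nabla$-geodesic parametrized by arc length that is not vertical, i.e. the constant $\langle\gamma',\xi\rangle$ satisfies $\langle\gamma',\xi\rangle^2<1$. If $$b-a\ \ge\ \frac{\pi}{\sqrt{k_0\,(1-\langle\gamma',\xi\rangle^2)}},$$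 then $\gamma(a)$ has a conjugate point along $\gamma|_{(a,b]}$: there is $t\in(a,b]$ such that $\exp_{\gamma(a)}$ is defined and differentiable at $(t-a)\gamma'(a)$, takes the value $\gamma(t)$ there, and has singular differential there. -/

import Mathlib

open Set Bundle Manifold
open scoped ContDiff

noncomputable section

/-! ### Linear connections: curvature, geodesics, exponential map, conjugate points -/

section Connection

variable {n : ℕ} {M : Type*} [TopologicalSpace M] [ChartedSpace (EuclideanSpace ℝ (Fin n)) M]
  [IsManifold (𝓡 n) ∞ M]

/-- Linear connections (covariant derivatives) on the tangent bundle of an `n`-manifold `M`.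
`cov Y x v` is `(∇_v Y)(x)`. -/
abbrev LinearConnection (n : ℕ) (M : Type*) [TopologicalSpace M]
    [ChartedSpace (EuclideanSpace ℝ (Fin n)) M] [IsManifold (𝓡 n) ∞ M] :=
  CovariantDerivative (𝓡 n) (EuclideanSpace ℝ (Fin n)) (TangentSpace (𝓡 n) : M → Type _)

/-- The vector field `X` is differentiable at `x`. -/
abbrev FieldDiffAt (X : ∀ x : M, TangentSpace (𝓡 n) x) (x : M) : Prop :=
  MDifferentiableAt (𝓡 n) ((𝓡 n).prod 𝓘(ℝ, EuclideanSpace ℝ (Fin n)))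
    (fun y => TotalSpace.mk' (EuclideanSpace ℝ (Fin n)) (E := (TangentSpace (𝓡 n) : M → Type _))
      y (X y)) x

/-- A vector field near `x` with value `v` at `x`: it has constant coefficients in the preferred
chart at `x`. -/
abbrev extendVec {x : M} (v : TangentSpace (𝓡 n) x) (y : M) : TangentSpace (𝓡 n) y :=
  FiberBundle.extend (EuclideanSpace ℝ (Fin n)) v y

/-- The curvature `R(u,v)w = ∇_U ∇_V W - ∇_V ∇_U W - ∇_{[U,V]} W` at `x`, where `U, V, W` are
smooth vector fields near `x` with values `u, v, w` at `x` (for a smooth connection the result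
does not depend on the choice of these fields). -/
def curvature (cov : LinearConnection n M) (x : M) (u v w : TangentSpace (𝓡 n) x) :
    TangentSpace (𝓡 n) x :=
  cov (fun y => cov (extendVec w) y (extendVec v y)) x u
    - cov (fun y => cov (extendVec w) y (extendVec u y)) x v
    - cov (extendVec w) x (VectorField.mlieBracket (𝓡 n) (extendVec u) (extendVec v) x)

/-- The velocity `γ'(t)` of a curve defined on `s ⊆ ℝ` (one-sided at endpoints of `s`). -/
def velocity (n : ℕ) {M : Type*} [TopologicalSpace M]
    [ChartedSpace (EuclideanSpace ℝ (Fin n)) M] (γ : ℝ → M) (s : Set ℝ) (t : ℝ) :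
    TangentSpace (𝓡 n) (γ t) :=
  mfderivWithin 𝓘(ℝ, ℝ) (𝓡 n) γ s t (1 : ℝ)

/-- The covariant derivative `∇_{γ'} V` at time `t` of a vector field `V` along the curve `γ`
on `s`. In the chart at `γ t` it is the usual `V̇ + Γ(γ', V)`: the derivative of the components
of `V`, plus the covariant derivative in direction `γ'(t)` of the field that takes the value `V t`
at `γ t` and has constant coefficients in that chart. -/
def covDerivAlong (cov : LinearConnection n M) (γ : ℝ → M) (s : Set ℝ)
    (V : ∀ t, TangentSpace (𝓡 n) (γ t)) (t : ℝ) : TangentSpace (𝓡 n) (γ t) :=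
  let e := trivializationAt (EuclideanSpace ℝ (Fin n)) (TangentSpace (𝓡 n) : M → Type _) (γ t)
  e.symmL ℝ (γ t) (derivWithin (fun r => (e ⟨γ r, V r⟩).2) s t)
    + cov (extendVec (V t)) (γ t) (velocity n γ s t)

/-- `γ` is a geodesic of the connection on `s`: `∇_{γ'} γ' = 0`. (For a smooth connection a `C²`
solution is automatically smooth.) -/
def IsGeodesicOn (cov : LinearConnection n M) (γ : ℝ → M) (s : Set ℝ) : Prop :=
  ContMDiffOn 𝓘(ℝ, ℝ) (𝓡 n) 2 γ s ∧ ∀ t ∈ s, covDerivAlong cov γ s (velocity n γ s) t = 0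

/-- `γ` is a geodesic on `[0,1]` with `γ(0) = p` and `γ'(0) = v`. -/
def IsGeodesicFrom (cov : LinearConnection n M) (p : M) (v : TangentSpace (𝓡 n) p)
    (γ : ℝ → M) : Prop :=
  IsGeodesicOn cov γ (Icc 0 1) ∧
    (⟨γ 0, velocity n γ (Icc 0 1) 0⟩ : TangentBundle (𝓡 n) M) = ⟨p, v⟩

/-- The vectors `v ∈ T_pM` (identified with `ℝⁿ`) such that the geodesic with initial velocity `v`
is defined up to time `1`. -/
def expDomain (cov : LinearConnection n M) (p : M) : Set (EuclideanSpace ℝ (Fin n)) :=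
  {v | ∃ γ : ℝ → M, IsGeodesicFrom cov p v γ}

open Classical in
/-- The exponential map `exp_p v = γ_v(1)` (with the value `p` outside its domain), as a map on
`T_pM`, which is `ℝⁿ` as a vector space. -/
def expMap (cov : LinearConnection n M) (p : M) (v : EuclideanSpace ℝ (Fin n)) : M :=
  if h : v ∈ expDomain cov p then h.choose 1 else p

/-- `q` is conjugate to `p` along the geodesic `t ↦ exp_p (t v)`: one has `q = exp_p v`, and the
differential of `exp_p` at `v` is singular. -/
def IsConjugateAlong (cov : LinearConnection n M) (p : M) (v : TangentSpace (𝓡 n) p) (q : M) :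
    Prop :=
  v ∈ expDomain cov p ∧ expMap cov p v = q ∧
    MDifferentiableAt (𝓡 n) (𝓡 n) (expMap cov p) v ∧
    ¬ Function.Injective (mfderiv (𝓡 n) (𝓡 n) (expMap cov p) v)

/-! ### Exterior derivative of a one-form -/

/-- Smoothness of a one-form, as a section of the cotangent bundle. -/
def SmoothOneForm (θ : ∀ x : M, TangentSpace (𝓡 n) x →L[ℝ] ℝ) : Prop :=
  ContMDiff (𝓡 n) ((𝓡 n).prod 𝓘(ℝ, EuclideanSpace ℝ (Fin n) →L[ℝ] ℝ)) ∞
    (fun x => TotalSpace.mk' (EuclideanSpace ℝ (Fin n) →L[ℝ] ℝ)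
      (E := fun x : M => TangentSpace (𝓡 n) x →L[ℝ] Bundle.Trivial M ℝ x) x (θ x))

/-- Smoothness of a field of endomorphisms of the tangent bundle. -/
def SmoothEndField (J : ∀ x : M, TangentSpace (𝓡 n) x →L[ℝ] TangentSpace (𝓡 n) x) : Prop :=
  ContMDiff (𝓡 n)
    ((𝓡 n).prod 𝓘(ℝ, EuclideanSpace ℝ (Fin n) →L[ℝ] EuclideanSpace ℝ (Fin n))) ∞
    (fun x => TotalSpace.mk' (EuclideanSpace ℝ (Fin n) →L[ℝ] EuclideanSpace ℝ (Fin n))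
      (E := fun x : M => TangentSpace (𝓡 n) x →L[ℝ] TangentSpace (𝓡 n) x) x (J x))

/-- `½ (X θ(Y) - Y θ(X) - θ([X,Y]))` at `x`. -/
def extDerivAux (θ : ∀ x : M, TangentSpace (𝓡 n) x →L[ℝ] ℝ)
    (X Y : ∀ x : M, TangentSpace (𝓡 n) x) (x : M) : ℝ :=
  (1 / 2 : ℝ) * (mvfderiv (𝓡 n) (fun y => θ y (Y y)) x (X x)
    - mvfderiv (𝓡 n) (fun y => θ y (X y)) x (Y x)
    - θ x (VectorField.mlieBracket (𝓡 n) X Y x))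

theorem SmoothOneForm.mdifferentiableAt_apply {θ : ∀ x : M, TangentSpace (𝓡 n) x →L[ℝ] ℝ}
    (hθ : SmoothOneForm θ) {Y : ∀ x : M, TangentSpace (𝓡 n) x} {x : M}
    (hY : FieldDiffAt Y x) : MDifferentiableAt (𝓡 n) 𝓘(ℝ, ℝ) (fun y => θ y (Y y)) x := by
  have h1 := (hθ x).mdifferentiableAt (by simp)
  have h2 := MDifferentiableAt.clm_bundle_apply (F₁ := EuclideanSpace ℝ (Fin n)) (F₂ := ℝ)
    (E₁ := (TangentSpace (𝓡 n) : M → Type _)) (E₂ := Bundle.Trivial M ℝ) (b := fun y => y)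
    (ϕ := θ) (v := Y) h1 hY
  simpa [mdifferentiableAt_section] using h2

theorem extDerivAux_swap (θ : ∀ x : M, TangentSpace (𝓡 n) x →L[ℝ] ℝ)
    (X Y : ∀ x : M, TangentSpace (𝓡 n) x) (x : M) :
    extDerivAux θ X Y x = - extDerivAux θ Y X x := by
  simp only [extDerivAux]
  rw [VectorField.mlieBracket_swap_apply, map_neg]
  ring

theorem extDerivAux_tensorial {θ : ∀ x : M, TangentSpace (𝓡 n) x →L[ℝ] ℝ}
    (hθ : SmoothOneForm θ) (x : M) (X : ∀ x : M, TangentSpace (𝓡 n) x) :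
    TensorialAt (𝓡 n) (EuclideanSpace ℝ (Fin n)) (fun Y => extDerivAux θ X Y x) x where
  smul {f Y} hf hY := by
    have e : (fun y => θ y ((f • Y) y)) = fun y => f y * θ y (Y y) := by
      funext y; simp
    simp only [extDerivAux]
    rw [e, mvfderiv_fun_mul hf (hθ.mdifferentiableAt_apply hY),
      VectorField.mlieBracket_smul_right hf hY]
    simp
    ring
  add {Y Y'} hY hY' := by
    have e : (fun y => θ y ((Y + Y') y)) = fun y => θ y (Y y) + θ y (Y' y) := by
      funext y; simp
    simp only [extDerivAux]
    rw [e, mvfderiv_fun_add (hθ.mdifferentiableAt_apply hY) (hθ.mdifferentiableAt_apply hY'),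
      VectorField.mlieBracket_add_right hY hY']
    simp
    ring

theorem extDerivAux_tensorial' {θ : ∀ x : M, TangentSpace (𝓡 n) x →L[ℝ] ℝ}
    (hθ : SmoothOneForm θ) (x : M) (Y : ∀ x : M, TangentSpace (𝓡 n) x) :
    TensorialAt (𝓡 n) (EuclideanSpace ℝ (Fin n)) (fun X => extDerivAux θ X Y x) x where
  smul {f X} hf hX := by
    rw [extDerivAux_swap, (extDerivAux_tensorial hθ x Y).smul hf hX, extDerivAux_swap θ X Y]
    simp
  add {X X'} hX hX' := by
    rw [extDerivAux_swap, (extDerivAux_tensorial hθ x Y).add hX hX', extDerivAux_swap θ X Y,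
      extDerivAux_swap θ X' Y]
    ring

/-- The exterior derivative of a smooth one-form as a tensor, with the normalization
`dθ(X,Y) = ½ (X θ(Y) - Y θ(X) - θ([X,Y]))`. -/
def extDerivForm (θ : ∀ x : M, TangentSpace (𝓡 n) x →L[ℝ] ℝ) (hθ : SmoothOneForm θ) (x : M) :
    TangentSpace (𝓡 n) x →L[ℝ] TangentSpace (𝓡 n) x →L[ℝ] ℝ :=
  TensorialAt.mkHom₂ (fun X Y => extDerivAux θ X Y x) x
    (fun Y _ => extDerivAux_tensorial' hθ x Y) (fun X _ => extDerivAux_tensorial hθ x X)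

theorem extDerivForm_apply {θ : ∀ x : M, TangentSpace (𝓡 n) x →L[ℝ] ℝ} (hθ : SmoothOneForm θ)
    {x : M} {X Y : ∀ x : M, TangentSpace (𝓡 n) x} (hX : FieldDiffAt X x)
    (hY : FieldDiffAt Y x) :
    extDerivForm θ hθ x (X x) (Y x) = (1 / 2 : ℝ) * (mvfderiv (𝓡 n) (fun y => θ y (Y y)) x (X x)
      - mvfderiv (𝓡 n) (fun y => θ y (X y)) x (Y x)
      - θ x (VectorField.mlieBracket (𝓡 n) X Y x)) :=
  TensorialAt.mkHom₂_apply _ _ hX hY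

theorem extDerivForm_swap {θ : ∀ x : M, TangentSpace (𝓡 n) x →L[ℝ] ℝ} (hθ : SmoothOneForm θ)
    (x : M) (v w : TangentSpace (𝓡 n) x) :
    extDerivForm θ hθ x v w = - extDerivForm θ hθ x w v := by
  simp only [extDerivForm, TensorialAt.mkHom₂_apply_eq_extend]
  exact extDerivAux_swap _ _ _ _

end Connection

/-! ### Pseudo-Hermitian manifolds -/

/-- A strictly pseudoconvex CR structure `(H, J)` on a manifold `M` of dimension `2m+1` together
with a pseudo-Hermitian structure `θ` whose Levi form is positive definite. Here `H = ker θ` (a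
nowhere vanishing one-form that annihilates a rank `2m` subbundle `H` has kernel `H`), and `J` is
extended from `H` to `TM` by `0` on the Reeb direction, which is the kernel of `dθ`. -/
structure PseudoHermitian (m : ℕ) (M : Type*) [TopologicalSpace M]
    [ChartedSpace (EuclideanSpace ℝ (Fin (2 * m + 1))) M] [IsManifold (𝓡 (2 * m + 1)) ∞ M] where
  θ : ∀ x : M, TangentSpace (𝓡 (2 * m + 1)) x →L[ℝ] ℝ
  J : ∀ x : M, TangentSpace (𝓡 (2 * m + 1)) x →L[ℝ] TangentSpace (𝓡 (2 * m + 1)) x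
  smooth_θ : SmoothOneForm θ
  smooth_J : SmoothEndField J
  θ_ne_zero : ∀ x, θ x ≠ 0
  θ_J : ∀ x v, θ x v = 0 → θ x (J x v) = 0
  J_J : ∀ x v, θ x v = 0 → J x (J x v) = -v
  J_vertical : ∀ x v, (∀ w, extDerivForm θ smooth_θ x v w = 0) → J x v = 0
  /-- Integrability of the bundle `H^{1,0} = {X - i J X}`, first half:
  `[X,Y] - [JX,JY]` is horizontal for horizontal `X, Y`. -/
  integrable_horizontal : ∀ (X Y : ∀ x : M, TangentSpace (𝓡 (2 * m + 1)) x) (x : M),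
    (∀ y, θ y (X y) = 0) → (∀ y, θ y (Y y) = 0) → FieldDiffAt X x → FieldDiffAt Y x →
    θ x (VectorField.mlieBracket (𝓡 (2 * m + 1)) X Y x
      - VectorField.mlieBracket (𝓡 (2 * m + 1)) (fun y => J y (X y)) (fun y => J y (Y y)) x) = 0
  /-- Integrability of `H^{1,0}`, second half:
  `[JX,Y] + [X,JY] = J([X,Y] - [JX,JY])` for horizontal `X, Y`. -/
  integrable_J : ∀ (X Y : ∀ x : M, TangentSpace (𝓡 (2 * m + 1)) x) (x : M),
    (∀ y, θ y (X y) = 0) → (∀ y, θ y (Y y) = 0) → FieldDiffAt X x → FieldDiffAt Y x →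
    VectorField.mlieBracket (𝓡 (2 * m + 1)) (fun y => J y (X y)) Y x
      + VectorField.mlieBracket (𝓡 (2 * m + 1)) X (fun y => J y (Y y)) x
    = J x (VectorField.mlieBracket (𝓡 (2 * m + 1)) X Y x
      - VectorField.mlieBracket (𝓡 (2 * m + 1)) (fun y => J y (X y)) (fun y => J y (Y y)) x)
  levi_pos : ∀ x v, θ x v = 0 → v ≠ 0 → 0 < extDerivForm θ smooth_θ x v (J x v)

namespace PseudoHermitian

variable {m : ℕ} {M : Type*} [TopologicalSpace M]
  [ChartedSpace (EuclideanSpace ℝ (Fin (2 * m + 1))) M] [IsManifold (𝓡 (2 * m + 1)) ∞ M]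
  (S : PseudoHermitian m M)

/-- The two-form `dθ`. -/
def dθ (x : M) :
    TangentSpace (𝓡 (2 * m + 1)) x →L[ℝ] TangentSpace (𝓡 (2 * m + 1)) x →L[ℝ] ℝ :=
  extDerivForm S.θ S.smooth_θ x

/-- The horizontal space `H_x = ker θ_x`. -/
def H (x : M) : Submodule ℝ (TangentSpace (𝓡 (2 * m + 1)) x) :=
  LinearMap.ker (S.θ x).toLinearMap

theorem exists_reeb (x : M) :
    ∃ v : TangentSpace (𝓡 (2 * m + 1)) x, S.θ x v = 1 ∧ ∀ w, S.dθ x v w = 0 := by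
  have : FiniteDimensional ℝ (TangentSpace (𝓡 (2 * m + 1)) x) :=
    inferInstanceAs (FiniteDimensional ℝ (EuclideanSpace ℝ (Fin (2 * m + 1))))
  obtain ⟨u, hu⟩ : ∃ u, S.θ x u = 1 := by
    obtain ⟨u, hu⟩ : ∃ u, S.θ x u ≠ 0 := by
      by_contra! h
      exact S.θ_ne_zero x (ContinuousLinearMap.ext h)
    exact ⟨(S.θ x u)⁻¹ • u, by simp [hu]⟩
  have alt : ∀ v w, S.dθ x v w = - S.dθ x w v := extDerivForm_swap S.smooth_θ x
  let L : S.H x →ₗ[ℝ] Module.Dual ℝ (S.H x) :=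
    LinearMap.mk₂ ℝ (fun v w => S.dθ x v w) (by intros; simp) (by intros; simp)
      (by intros; simp) (by intros; simp)
  have hL : Function.Injective L := by
    rw [injective_iff_map_eq_zero]
    intro v hv
    by_contra hne
    have h0 : S.θ x v = 0 := v.2
    have hpos := S.levi_pos x v h0 (by simpa using hne)
    have : L v ⟨S.J x v, S.θ_J x v h0⟩ = 0 := by rw [hv]; rfl
    exact hpos.ne' this
  have hS : Function.Surjective L :=
    (LinearMap.injective_iff_surjective_of_finrank_eq_finrank
      (Subspace.dual_finrank_eq (K := ℝ) (V := S.H x)).symm).1 hL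
  obtain ⟨h, hh⟩ := hS (LinearMap.domRestrict (-(S.dθ x u).toLinearMap) (S.H x))
  have key : ∀ w : S.H x, S.dθ x (u + h) w = 0 := by
    intro w
    have : S.dθ x h w = - S.dθ x u w := DFunLike.congr_fun hh w
    simp [this]
  have hθ : S.θ x (u + h) = 1 := by
    have : S.θ x h = 0 := h.2
    simp [this, hu]
  refine ⟨u + h, hθ, fun w => ?_⟩
  have hw : w - S.θ x w • (u + (h : TangentSpace (𝓡 (2 * m + 1)) x)) ∈ S.H x := by
    change S.θ x _ = 0
    rw [map_sub, map_smul, hθ]; simp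
  have h1 := key ⟨_, hw⟩
  have h2 : S.dθ x (u + h) (u + h) = 0 := by
    have := alt (u + h) (u + h); linarith
  have h3 : S.dθ x (u + h) (w - S.θ x w • (u + (h : TangentSpace (𝓡 (2 * m + 1)) x))) = 0 := h1
  rw [map_sub, map_smul, h2] at h3
  simpa using h3

/-- The Reeb vector field `ξ`: the (unique) vector field with `θ(ξ) = 1` and `dθ(ξ, ·) = 0`. -/
def reeb (x : M) : TangentSpace (𝓡 (2 * m + 1)) x := (S.exists_reeb x).choose

theorem reeb_spec (x : M) : S.θ x (S.reeb x) = 1 ∧ ∀ w, S.dθ x (S.reeb x) w = 0 :=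
  (S.exists_reeb x).choose_spec

/-- The projection `π_H : TM → H` along `ξ`. -/
def projH (x : M) (v : TangentSpace (𝓡 (2 * m + 1)) x) : TangentSpace (𝓡 (2 * m + 1)) x :=
  v - S.θ x v • S.reeb x

/-- The Webster metric `g_θ(v,w) = θ(v) θ(w) + dθ(π_H v, J π_H w)`. -/
def metric (x : M) (v w : TangentSpace (𝓡 (2 * m + 1)) x) : ℝ :=
  S.θ x v * S.θ x w + S.dθ x (S.projH x v) (S.J x (S.projH x w))

/-- `cov` is the Tanaka–Webster connection of the pseudo-Hermitian manifold: the unique smooth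
linear connection that preserves `H`, `g_θ` and `J` and has pure torsion. (With the present
normalization of `dθ`, the torsion of horizontal vectors is `2 dθ(X,Y) ξ`, that is,
`-θ([X,Y]) ξ` for horizontal vector fields.) -/
structure IsTanakaWebster (cov : LinearConnection (2 * m + 1) M) : Prop where
  smooth : cov.ContMDiffCovariantDerivative ∞
  horizontal : ∀ (Y : ∀ x : M, TangentSpace (𝓡 (2 * m + 1)) x) (x : M)
    (v : TangentSpace (𝓡 (2 * m + 1)) x), FieldDiffAt Y x → (∀ y, Y y ∈ S.H y) →
    cov Y x v ∈ S.H x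
  metric_parallel : ∀ (Y Z : ∀ x : M, TangentSpace (𝓡 (2 * m + 1)) x) (x : M)
    (v : TangentSpace (𝓡 (2 * m + 1)) x), FieldDiffAt Y x → FieldDiffAt Z x →
    mvfderiv (𝓡 (2 * m + 1)) (fun y => S.metric y (Y y) (Z y)) x v
      = S.metric x (cov Y x v) (Z x) + S.metric x (Y x) (cov Z x v)
  J_parallel : ∀ (Y : ∀ x : M, TangentSpace (𝓡 (2 * m + 1)) x) (x : M)
    (v : TangentSpace (𝓡 (2 * m + 1)) x), FieldDiffAt Y x →
    cov (fun y => S.J y (Y y)) x v = S.J x (cov Y x v)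
  torsion_horizontal : ∀ x, ∀ v ∈ S.H x, ∀ w ∈ S.H x,
    cov.torsion x v w = (2 * S.dθ x v w) • S.reeb x
  torsion_reeb : ∀ x, ∀ v ∈ S.H x,
    cov.torsion x (S.reeb x) (S.J x v) + S.J x (cov.torsion x (S.reeb x) v) = 0

/-- The pseudo-Hermitian manifold with Tanaka–Webster connection `cov` is Sasakian: the
pseudo-Hermitian torsion `τ(v) = T(ξ, v)` vanishes. -/
def IsSasakian (cov : LinearConnection (2 * m + 1) M) : Prop :=
  ∀ (x : M) (v : TangentSpace (𝓡 (2 * m + 1)) x), cov.torsion x (S.reeb x) v = 0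

/-- The horizontal sectional curvature of the plane spanned by linearly independent horizontal
vectors `v, w`: `⟨R(v,w)w, v⟩ / (|v|²|w|² - ⟨v,w⟩²)`. -/
def horizontalSectionalCurvature (cov : LinearConnection (2 * m + 1) M) (x : M)
    (v w : TangentSpace (𝓡 (2 * m + 1)) x) : ℝ :=
  S.metric x (curvature cov x v w w) v
    / (S.metric x v v * S.metric x w w - S.metric x v w ^ 2)

end PseudoHermitian

end

open Filter Topology NNReal

noncomputable section

/-! ### Ordinary differential equations -/

/-! Let U = γ'. Since ξ, J and the metric are parallel, c = θ(U) is constant and JU is a parallel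
field of squared length 1 - c². In the Sasakian case T = 2 dθ ⊗ ξ holds on all of TM. As ξ is
parallel and d(dθ) = 0, the torsion terms drop out of the first Bianchi identity
(`curvature_bianchi`), so the curvature has the pair symmetry of a Riemannian curvature tensor
(`metric_curvature_pair`). Then R(·,·)ξ = 0 gives R(ξ,·) = 0, and the Jacobi operator R(·,U)U is
symmetric and sees only the horizontal part of U. The vectors JU and π_H U span a horizontal plane,
so in the parallel unit direction e = JU/√(1 - c²) the quadratic form of the Jacobi operator is at
least k₀(1 - c²) (`le_metric_curvature_J`).

In a parallel orthonormal frame this is a Sturm comparison problem for y'' + Ry = 0 with a lower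
bound in one constant direction only. It is solved by a Riccati argument that includes the
borderline length (`exists_jacobi_zero`): some nontrivial y vanishes at a and at a later time t.

For a connection with torsion the Jacobi equation is the system ∇V = W - T(V,U), ∇W = -R(V,U)U, so y
alone is not yet a Jacobi field. Adding fξ to y does not affect the curvature term, and the torsion
term is itself a multiple of ξ. Hence only f' = C - 2dθ(y,U) has to be solved, and the free constant
C makes f vanish at both a and t (`exists_isJacobiOn`). The Reeb component of y is affine in time
and has two zeros, so y'(a) is horizontal and W(a) = y'(a) + Cξ is not zero.

Finally, (t - a) times the differential of the exponential map at (t - a)U(a) sends W(a) to (t -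
a)·(t - a)⁻¹V(t) = 0, so that differential is singular (`isConjugateAlong_of_isJacobiOn`). This
rests on smooth dependence of geodesics on their initial velocity (`exists_geodesic_variation`),
obtained from differentiable dependence for ODEs in charts. Passing from one chart to the next along
the curve is always done by `Icc_induction`. -/

theorem Icc_induction {P : ℝ → Prop} {a b : ℝ} (hab : a ≤ b) (ha : P a)
    (h : ∀ t ∈ Icc a b, ∃ ε > 0, ∀ r ∈ Icc a b, ∀ s ∈ Icc a b, r ≤ s → |r - t| < ε →
      |s - t| < ε → P r → P s) : P b := by
  set S := {t | t ∈ Icc a b ∧ P t} with hS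
  have hne : S.Nonempty := ⟨a, ⟨le_rfl, hab⟩, ha⟩
  have hbdd : BddAbove S := ⟨b, fun t ht => ht.1.2⟩
  set c := sSup S
  have hac : a ≤ c := le_csSup hbdd ⟨⟨le_rfl, hab⟩, ha⟩
  have hcb : c ≤ b := csSup_le hne fun t ht => ht.1.2
  -- The local step is applied at the supremum c, from a good time r just before c to the time min b
  -- (c + ε/2). That time is then good, hence at most c, which forces it to be b.
  obtain ⟨ε, hε, hstep⟩ := h c ⟨hac, hcb⟩
  obtain ⟨r, hr, hrc⟩ := exists_lt_of_lt_csSup hne (sub_lt_self c hε)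
  have hrc' : r ≤ c := le_csSup hbdd hr
  have hs : min b (c + ε / 2) ∈ Icc a b := ⟨le_min hab (by linarith), min_le_left _ _⟩
  have h1 : c ≤ min b (c + ε / 2) := le_min hcb (by linarith)
  have h2 : min b (c + ε / 2) ≤ c + ε / 2 := min_le_right _ _
  have hP := hstep r hr.1 _ hs (hrc'.trans h1) (by rw [abs_lt]; constructor <;> linarith)
    (by rw [abs_lt]; constructor <;> linarith) hr.2
  have h3 : min b (c + ε / 2) ≤ c := le_csSup hbdd ⟨hs, hP⟩
  have h4 : min b (c + ε / 2) = b := by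
    rcases min_choice b (c + ε / 2) with h | h
    · exact h
    · rw [h] at h3; linarith
  rwa [h4] at hP

/-- Concatenation of two curves at time `r`. -/
def glueAt {X : ℝ → Type*} (r : ℝ) (α β : ∀ t, X t) (t : ℝ) : X t :=
  if t ≤ r then α t else β t

theorem glueAt_of_le {X : ℝ → Type*} {r t : ℝ} {α β : ∀ t, X t} (h : t ≤ r) :
    glueAt r α β t = α t := if_pos h

theorem glueAt_of_ge {X : ℝ → Type*} {r t : ℝ} {α β : ∀ t, X t} (h0 : α r = β r) (h : r ≤ t) :
    glueAt r α β t = β t := by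
  rcases h.eq_or_lt with rfl | h
  · rw [glueAt_of_le le_rfl, h0]
  · exact if_neg (not_le.2 h)

/-- Away from r only one of the two pieces matters; at r the two one-sided statements are united.
The family X may depend on time, so the same argument serves ODE solutions, vector fields along a
curve and lifts to the tangent bundle. -/
theorem glueAt_local {X : ℝ → Type*} (Q : (∀ t, X t) → Set ℝ → ℝ → Prop)
    (hcongr : ∀ f g S t, t ∈ S → (∀ u ∈ S, f u = g u) → Q f S t → Q g S t)
    (hmono : ∀ f S S' t, S ∈ 𝓝[S'] t → Q f S t → Q f S' t)
    (hunion : ∀ f S S' t, Q f S t → Q f S' t → Q f (S ∪ S') t)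
    {a r s : ℝ} (har : a ≤ r) (hrs : r ≤ s) {α β : ∀ t, X t}
    (hα : ∀ t ∈ Icc a r, Q α (Icc a r) t) (hβ : ∀ t ∈ Icc r s, Q β (Icc r s) t)
    (h0 : α r = β r) : ∀ t ∈ Icc a s, Q (glueAt r α β) (Icc a s) t := by
  intro t ht
  have hα' : ∀ t ∈ Icc a r, Q (glueAt r α β) (Icc a r) t := fun t ht =>
    hcongr _ _ _ _ ht (fun u hu => (glueAt_of_le hu.2).symm) (hα t ht)
  have hβ' : ∀ t ∈ Icc r s, Q (glueAt r α β) (Icc r s) t := fun t ht =>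
    hcongr _ _ _ _ ht (fun u hu => (glueAt_of_ge h0 hu.1).symm) (hβ t ht)
  rcases lt_trichotomy t r with h | h | h
  · refine hmono _ _ _ _ ?_ (hα' t ⟨ht.1, h.le⟩)
    filter_upwards [self_mem_nhdsWithin, mem_nhdsWithin_of_mem_nhds (Iio_mem_nhds h)] with u hu hu'
    exact ⟨hu.1, le_of_lt hu'⟩
  · subst h
    rw [← Icc_union_Icc_eq_Icc har hrs]
    exact hunion _ _ _ _ (hα' t ⟨har, le_rfl⟩) (hβ' t ⟨le_rfl, hrs⟩)
  · refine hmono _ _ _ _ ?_ (hβ' t ⟨h.le, ht.2⟩)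
    filter_upwards [self_mem_nhdsWithin, mem_nhdsWithin_of_mem_nhds (Ioi_mem_nhds h)] with u hu hu'
    exact ⟨le_of_lt hu', hu.2⟩

section ODE

variable {F : Type*} [NormedAddCommGroup F] [NormedSpace ℝ F]

theorem hasDerivWithinAt_glueAt {a r s : ℝ} (har : a ≤ r) (hrs : r ≤ s) {α β : ℝ → F}
    {f : ℝ → F → F}
    (hα : ∀ t ∈ Icc a r, HasDerivWithinAt α (f t (α t)) (Icc a r) t)
    (hβ : ∀ t ∈ Icc r s, HasDerivWithinAt β (f t (β t)) (Icc r s) t)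
    (h0 : α r = β r) : ∀ t ∈ Icc a s,
      HasDerivWithinAt (glueAt r α β) (f t (glueAt r α β t)) (Icc a s) t := by
  refine glueAt_local (fun g S t => HasDerivWithinAt g (f t (g t)) S t) ?_ ?_ ?_ har hrs hα hβ h0
  · intro g k S t ht hgk h
    rw [← hgk t ht]
    exact h.congr (fun u hu => (hgk u hu).symm) (hgk t ht).symm
  · intro g S S' t hS h
    exact h.mono_of_mem_nhdsWithin hS
  · intro g S S' t h h'
    exact h.union h'

/-- With a global Lipschitz constant, the Picard–Lindelöf step length depends on K alone and not on
the current value, so local solutions can be concatenated up to b. -/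
theorem exists_ode_solution [CompleteSpace F] {f : ℝ → F → F} {K : ℝ≥0} {a b : ℝ} (hab : a ≤ b)
    (hlip : ∀ t ∈ Icc a b, LipschitzWith K (f t))
    (hcont : ∀ x, ContinuousOn (fun t => f t x) (Icc a b)) (x₀ : F) :
    ∃ α : ℝ → F, α a = x₀ ∧ ∀ t ∈ Icc a b, HasDerivWithinAt α (f t (α t)) (Icc a b) t := by
  set δ : ℝ := 1 / (2 * (K + 1)) with hδ
  have hδ0 : 0 < δ := by positivity
  refine Icc_induction (P := fun τ => ∃ α : ℝ → F, α a = x₀ ∧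
    ∀ t ∈ Icc a τ, HasDerivWithinAt α (f t (α t)) (Icc a τ) t) hab ?_ ?_
  · refine ⟨fun _ => x₀, rfl, fun t _ => ?_⟩
    rw [Icc_self]
    by_cases h : t = a
    · subst h
      exact HasFDerivWithinAt.of_subsingleton (subsingleton_singleton)
    · exact HasFDerivWithinAt.of_subsingleton (subsingleton_singleton)
  · intro t ht
    refine ⟨δ / 2, by positivity, fun r hr s hs hrs h1 h2 ⟨α, hα0, hα⟩ => ?_⟩
    have hsr : s - r ≤ δ := by
      rw [abs_lt] at h1 h2; linarith
    have hsub : Icc r s ⊆ Icc a b := Icc_subset_Icc hr.1 hs.2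
    obtain ⟨C, hC⟩ : ∃ C : ℝ, ∀ t ∈ Icc r s, ‖f t (α r)‖ ≤ C :=
      isCompact_Icc.exists_bound_of_continuousOn ((hcont (α r)).mono hsub)
    have hC0 : 0 ≤ C := (norm_nonneg _).trans (hC r ⟨le_rfl, hrs⟩)
    set R : ℝ≥0 := ⟨C, hC0⟩
    -- On the ball of radius R about `α r` the field is bounded by R + KR. The choice of δ gives (K
    -- + 1)δ = 1/2, so in time at most δ the solution moves by at most R/2 and stays in the ball.
    have hPL : IsPicardLindelof f (tmin := r) (tmax := s) ⟨r, le_rfl, hrs⟩ (α r) R 0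
        (R + K * R) K := by
      refine ⟨fun t ht => (hlip t (hsub ht)).lipschitzOnWith, fun x _ => (hcont x).mono hsub,
        fun t ht x hx => ?_, ?_⟩
      · have := (hlip t (hsub ht)).dist_le_mul x (α r)
        have h3 : ‖f t x‖ ≤ ‖f t (α r)‖ + dist (f t x) (f t (α r)) := by
          rw [dist_eq_norm]; exact norm_le_insert' _ _
        have h4 : (K : ℝ) * dist x (α r) ≤ K * R := by gcongr; exact hx
        have h5 := hC t ht
        push_cast
        change _ ≤ C + K * R
        linarith
      · have h6 : max (s - r) (r - r) = s - r := by
          rw [sub_self]; exact max_eq_left (sub_nonneg.2 hrs)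
        change ((R + K * R : ℝ≥0) : ℝ) * max (s - r) (r - r) ≤ (R : ℝ) - (0 : ℝ≥0)
        rw [h6]
        push_cast
        have h7 : ((K : ℝ) + 1) * δ = 1 / 2 := by
          rw [hδ]; field_simp
        have h8 : (R : ℝ) * ((K + 1) * (s - r)) ≤ R * ((K + 1) * δ) := by gcongr
        rw [h7] at h8
        have h9 : (0 : ℝ) ≤ R := R.2
        nlinarith
    obtain ⟨β, hβ0, hβ⟩ := hPL.exists_eq_forall_mem_Icc_hasDerivWithinAt₀
    refine ⟨glueAt r α β, ?_, hasDerivWithinAt_glueAt hr.1 hrs hα hβ hβ0.symm⟩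
    rw [glueAt_of_le hr.1, hα0]

/-- Uniqueness of solutions of an ODE whose right-hand side is Lipschitz. -/
theorem ode_solution_eqOn {f : ℝ → F → F} {K : ℝ≥0} {a b : ℝ}
    (hlip : ∀ t ∈ Icc a b, LipschitzWith K (f t)) {α β : ℝ → F}
    (hα : ∀ t ∈ Icc a b, HasDerivWithinAt α (f t (α t)) (Icc a b) t)
    (hβ : ∀ t ∈ Icc a b, HasDerivWithinAt β (f t (β t)) (Icc a b) t) (h0 : α a = β a) :
    EqOn α β (Icc a b) := by
  refine ODE_solution_unique_of_mem_Icc_right (v := f) (s := fun _ => univ) (K := K)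
    (fun t ht => (hlip t (Ico_subset_Icc_self ht)).lipschitzOnWith)
    (fun t ht => (hα t ht).continuousWithinAt) ?_ (fun _ _ => mem_univ _)
    (fun t ht => (hβ t ht).continuousWithinAt) ?_ (fun _ _ => mem_univ _) h0
  · intro t ht
    exact (hα t (Ico_subset_Icc_self ht)).mono_of_mem_nhdsWithin
      (Icc_mem_nhdsGE_of_mem ht)
  · intro t ht
    exact (hβ t (Ico_subset_Icc_self ht)).mono_of_mem_nhdsWithin
      (Icc_mem_nhdsGE_of_mem ht)

theorem lipschitzWith_clm_of_continuousOn {A : ℝ → F →L[ℝ] F} {a b : ℝ}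
    (hA : ContinuousOn A (Icc a b)) :
    ∃ K : ℝ≥0, ∀ t ∈ Icc a b, LipschitzWith K (A t) := by
  obtain ⟨C, hC⟩ := isCompact_Icc.exists_bound_of_continuousOn hA
  refine ⟨C.toNNReal, fun t ht => (A t).lipschitz.weaken ?_⟩
  rw [← NNReal.coe_le_coe, coe_nnnorm]
  exact (hC t ht).trans (Real.le_coe_toNNReal C)

end ODE

/-! ### Sturm comparison through the matrix Riccati equation -/

section Sturm

variable {F : Type*} [NormedAddCommGroup F] [NormedSpace ℝ F] [FiniteDimensional ℝ F]

theorem ContinuousLinearMap.isUnit_of_forall_eq_zero {Y : F →L[ℝ] F}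
    (h : ∀ w, Y w = 0 → w = 0) : IsUnit Y := by
  have hinj : Function.Injective Y := (injective_iff_map_eq_zero Y).2 h
  let e := (LinearEquiv.ofInjectiveEndo Y.toLinearMap hinj).toContinuousLinearEquiv
  have he : (e : F →L[ℝ] F) = Y := by ext w; rfl
  rw [← he]
  exact (ContinuousLinearEquiv.unitsEquiv ℝ F).symm e |>.isUnit

theorem Ring.inverse_smul_of_isUnit {A : Type*} [NormedRing A] [NormedAlgebra ℝ A] {Y : A}
    (hY : IsUnit Y) {c : ℝ} (hc : c ≠ 0) : Ring.inverse (c • Y) = c⁻¹ • Ring.inverse Y := by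
  have h1 : (c • Y) * (c⁻¹ • Ring.inverse Y) = 1 := by
    rw [smul_mul_smul_comm, mul_inv_cancel₀ hc, Ring.mul_inverse_cancel _ hY, one_smul]
  have h2 : IsUnit (c • Y) := by
    have := hY.smul (Units.mk0 c hc); exact this
  calc Ring.inverse (c • Y) = Ring.inverse (c • Y) * ((c • Y) * (c⁻¹ • Ring.inverse Y)) := by
        rw [h1, mul_one]
    _ = _ := Ring.inverse_mul_cancel_left _ _ h2

theorem eq_of_hasDerivWithinAt_zero {G : Type*} [NormedAddCommGroup G] [NormedSpace ℝ G]
    {f : ℝ → G} {a b : ℝ}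
    (h : ∀ t ∈ Icc a b, HasDerivWithinAt f 0 (Icc a b) t) : ∀ t ∈ Icc a b, f t = f a :=
  constant_of_has_deriv_right_zero (fun t ht => (h t ht).continuousWithinAt) fun t ht =>
    (h t (Ico_subset_Icc_self ht)).mono_of_mem_nhdsWithin (Icc_mem_nhdsGE_of_mem ht)

/-- Fundamental solution of `y'' + R y = 0` with `y(a) = 0`. -/
theorem exists_jacobi_fundamental {G : Type*} [NormedRing G] [NormedAlgebra ℝ G] [CompleteSpace G]
    {R : ℝ → G} {a b : ℝ} (hab : a ≤ b) (hR : ContinuousOn R (Icc a b)) :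
    ∃ Y Z : ℝ → G, Y a = 0 ∧ Z a = 1 ∧ ∀ t ∈ Icc a b,
      HasDerivWithinAt Y (Z t) (Icc a b) t ∧ HasDerivWithinAt Z (-(R t * Y t)) (Icc a b) t := by
  obtain ⟨C, hC⟩ := isCompact_Icc.exists_bound_of_continuousOn hR
  have hlip : ∀ t ∈ Icc a b,
      LipschitzWith (max 1 (1 * C.toNNReal)) fun p : G × G => (p.2, -(R t * p.1)) := by
    refine fun t ht => LipschitzWith.prod_snd.prodMk (LipschitzWith.of_dist_le_mul fun p q => ?_)
    rw [dist_neg_neg, dist_eq_norm, ← mul_sub]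
    refine (norm_mul_le _ _).trans ?_
    have h1 : ‖p.1 - q.1‖ ≤ dist p q := by rw [← dist_eq_norm]; exact le_max_left _ _
    have h2 : ‖R t‖ ≤ C.toNNReal := (hC t ht).trans (Real.le_coe_toNNReal C)
    rw [one_mul]
    gcongr
  obtain ⟨α, hα0, hα⟩ := exists_ode_solution hab hlip
    (fun x => continuousOn_const.prodMk (hR.mul continuousOn_const).neg) (0, 1)
  refine ⟨fun t => (α t).1, fun t => (α t).2, by simp [hα0], by simp [hα0], fun t ht => ?_⟩
  exact ⟨(ContinuousLinearMap.fst ℝ G G).hasFDerivAt.comp_hasDerivWithinAt t (hα t ht),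
    (ContinuousLinearMap.snd ℝ G G).hasFDerivAt.comp_hasDerivWithinAt t (hα t ht)⟩

theorem Filter.Tendsto.clm_apply_vec {X : Type*} {l : Filter X} {E G : Type*}
    [NormedAddCommGroup E] [NormedSpace ℝ E] [NormedAddCommGroup G] [NormedSpace ℝ G]
    {f : X → E →L[ℝ] G} {g : X → E} {f₀ : E →L[ℝ] G} {g₀ : E}
    (hf : Tendsto f l (𝓝 f₀)) (hg : Tendsto g l (𝓝 g₀)) :
    Tendsto (fun x => f x (g x)) l (𝓝 (f₀ g₀)) :=
  (isBoundedBilinearMap_apply.continuous.tendsto (f₀, g₀)).comp (hf.prodMk_nhds hg)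

set_option synthInstance.maxHeartbeats 200000 in
theorem HasDerivWithinAt.ringInverse {G : Type*} [NormedRing G] [NormedAlgebra ℝ G]
    [CompleteSpace G] {Y : ℝ → G} {Y' : G} {s : Set ℝ} {t : ℝ} (h : HasDerivWithinAt Y Y' s t)
    (hu : IsUnit (Y t)) : HasDerivWithinAt (fun t => Ring.inverse (Y t))
      (-(Ring.inverse (Y t) * Y' * Ring.inverse (Y t))) s t := by
  obtain ⟨U, hU⟩ := hu
  have h1 := hasFDerivAt_ringInverse (𝕜 := ℝ) U
  rw [hU] at h1
  refine (h1.comp_hasDerivWithinAt t h).congr_deriv ?_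
  simp [← hU]

/-- Sturm comparison: if `R` is symmetric and `⟨R e, e⟩ ≥ k` for a fixed unit vector `e`, then
`y'' + R y = 0` has a nontrivial solution vanishing at `a` and at a point of `(a, b]` as soon as
`b - a ≥ π / √k`. -/
theorem exists_jacobi_zero {B : F →L[ℝ] F →L[ℝ] ℝ} (hsymm : ∀ u v, B u v = B v u)
    (hpos : ∀ u, 0 ≤ B u u) {R : ℝ → F →L[ℝ] F} {a b k : ℝ}
    (hR : ContinuousOn R (Icc a b))
    (hRs : ∀ t ∈ Icc a b, ∀ u v, B (R t u) v = B u (R t v)) {e : F} (he : B e e = 1)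
    (hk : 0 < k) (hRe : ∀ t ∈ Icc a b, k ≤ B (R t e) e) (hab : Real.pi / √k ≤ b - a) :
    ∃ t ∈ Ioc a b, ∃ y z : ℝ → F, (∀ s ∈ Icc a b, HasDerivWithinAt y (z s) (Icc a b) s ∧
      HasDerivWithinAt z (-(R s (y s))) (Icc a b) s) ∧ y a = 0 ∧ z a ≠ 0 ∧ y t = 0 := by
  set q := √k with hq
  have hq0 : 0 < q := Real.sqrt_pos.2 hk
  have hqk : q * q = k := Real.mul_self_sqrt hk.le
  set T := a + Real.pi / q with hT
  have haT : a < T := by rw [hT]; have := Real.pi_pos; have : 0 < Real.pi / q := by positivity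
                         linarith
  have hTb : T ≤ b := by rw [hT]; linarith
  have hle : a ≤ b := haT.le.trans hTb
  obtain ⟨Y, Z, hY0, hZ0, hYZ⟩ := exists_jacobi_fundamental hle hR
  by_contra hcon
  -- A kernel vector w of `Y t` would give the solution Yw, which vanishes at a and t and has
  -- initial derivative w. So, if the conclusion fails, the fundamental solution is invertible on
  -- all of (a, b].
  have hinj : ∀ t ∈ Ioc a b, IsUnit (Y t) := by
    intro t ht
    refine ContinuousLinearMap.isUnit_of_forall_eq_zero fun w hw => ?_
    by_contra hw0
    refine hcon ⟨t, ht, fun s => Y s w, fun s => Z s w, fun s hs => ⟨?_, ?_⟩, by simp [hY0],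
      by simpa [hZ0] using hw0, hw⟩
    · exact ((hYZ s hs).1.clm_apply (hasDerivWithinAt_const s _ w)).congr_deriv (by simp)
    · exact ((hYZ s hs).2.clm_apply (hasDerivWithinAt_const s _ w)).congr_deriv (by simp)
  -- The Wronskian is constant because R is symmetric, and it is zero at a because Y is. This says
  -- that ZY⁻¹ is symmetric for B.
  have hW : ∀ v w, ∀ t ∈ Icc a b, B (Z t v) (Y t w) = B (Y t v) (Z t w) := by
    intro v w
    have hd : ∀ t ∈ Icc a b, HasDerivWithinAt
        (fun t => B (Z t v) (Y t w) - B (Y t v) (Z t w)) 0 (Icc a b) t := by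
      intro t ht
      have hYv := (hYZ t ht).1.clm_apply (hasDerivWithinAt_const t _ v)
      have hYw := (hYZ t ht).1.clm_apply (hasDerivWithinAt_const t _ w)
      have hZv := (hYZ t ht).2.clm_apply (hasDerivWithinAt_const t _ v)
      have hZw := (hYZ t ht).2.clm_apply (hasDerivWithinAt_const t _ w)
      have h1 := ((B.hasFDerivAt.comp_hasDerivWithinAt t hZv).clm_apply hYw).sub
        ((B.hasFDerivAt.comp_hasDerivWithinAt t hYv).clm_apply hZw)
      refine h1.congr_deriv ?_
      simp [hRs t ht]
      ring
    intro t ht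
    have := eq_of_hasDerivWithinAt_zero hd t ht
    simp only [hY0] at this
    simpa [sub_eq_zero] using this
  set X : ℝ → F →L[ℝ] F := fun t => Ring.inverse (Y t) with hX
  -- The value at e of the quadratic form of the Riccati operator ZY⁻¹. Since e is constant, u
  -- satisfies a scalar Riccati inequality.
  set u : ℝ → ℝ := fun t => B (Z t (X t e)) e with hu
  have hXd : ∀ t ∈ Ioc a b, HasDerivWithinAt X (-(X t * Z t * X t)) (Icc a b) t := by
    intro t ht
    exact (hYZ t (Ioc_subset_Icc_self ht)).1.ringInverse (hinj t ht)
  have hYX : ∀ t ∈ Ioc a b, ∀ w, Y t (X t w) = w := fun t ht w => by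
    have := Ring.mul_inverse_cancel _ (hinj t ht)
    exact DFunLike.congr_fun this w
  have hud : ∀ t ∈ Ioc a b, ∃ u', HasDerivWithinAt u u' (Icc a b) t ∧ u' ≤ -k - u t ^ 2 := by
    intro t ht
    have ht' := Ioc_subset_Icc_self ht
    have h1 := (hXd t ht).clm_apply (hasDerivWithinAt_const t _ e)
    have h2 := (B.hasFDerivAt.comp_hasDerivWithinAt t ((hYZ t ht').2.clm_apply h1)).clm_apply
      (hasDerivWithinAt_const t _ e)
    refine ⟨_, h2, ?_⟩
    set α := X t e with hα
    have e1 : Y t α = e := hYX t ht e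
    have e2 : B (Z t (X t (Z t α))) e = B (Z t α) (Z t α) := by
      have := hW α (X t (Z t α)) t ht'
      rw [hYX t ht, e1, hsymm e] at this
      exact this.symm
    -- Cauchy–Schwarz against the unit vector e, read off from positivity at Zα - ue.
    have e3 : u t ^ 2 ≤ B (Z t α) (Z t α) := by
      have h3 := hpos (Z t α - u t • e)
      simp only [map_sub, map_smul, sub_apply, smul_apply,
        smul_eq_mul, he, hsymm e (Z t α)] at h3
      have : B (Z t α) e = u t := rfl
      rw [this] at h3
      nlinarith
    have e4 := hRe t ht'
    simp [← hα, e1, e2]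
    linarith
  set s : ℝ → ℝ := fun t => Real.sin (q * (t - a)) with hs
  set c : ℝ → ℝ := fun t => q * Real.cos (q * (t - a)) with hc
  have hsd : ∀ t, HasDerivAt s (c t) t := by
    intro t
    have h1 : HasDerivAt (fun t => q * (t - a)) q t := by
      simpa using ((hasDerivAt_id t).sub_const a).const_mul q
    exact h1.sin.congr_deriv (by simp only [hc]; ring)
  have hcd : ∀ t, HasDerivAt c (-(k * s t)) t := by
    intro t
    have h1 : HasDerivAt (fun t => q * (t - a)) q t := by
      simpa using ((hasDerivAt_id t).sub_const a).const_mul q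
    refine (h1.cos.const_mul q).congr_deriv ?_
    rw [← hqk]; simp only [hs]; ring
  -- Q = s²(u - c/s), where c/s = s'/s solves the model equation v' = -k - v². The factor s² removes
  -- the singularities of c/s at a and T and makes the Riccati inequality read Q' ≤ -(su - c)².
  set Q : ℝ → ℝ := fun t => s t ^ 2 * u t - s t * c t with hQ
  have hsub : Ioc a T ⊆ Ioc a b := Ioc_subset_Ioc_right hTb
  have hucont : ContinuousOn u (Ioc a T) := fun t ht => by
    obtain ⟨u', h, -⟩ := hud t (hsub ht)
    exact h.continuousWithinAt.mono ((hsub).trans Ioc_subset_Icc_self)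
  have hscont : Continuous s := continuous_iff_continuousAt.2 fun t => (hsd t).continuousAt
  have hccont : Continuous c := continuous_iff_continuousAt.2 fun t => (hcd t).continuousAt
  have hQcont : ContinuousOn Q (Ioc a T) :=
    ((hscont.continuousOn.pow 2).mul hucont).sub (hscont.mul hccont).continuousOn
  have hQd : ∀ t ∈ Ioo a T, ∃ Q', HasDerivAt Q Q' t ∧ Q' ≤ -(s t * u t - c t) ^ 2 := by
    intro t ht
    obtain ⟨u', h, hu'⟩ := hud t (hsub (Ioo_subset_Ioc_self ht))
    have h1 := h.hasDerivAt (Icc_mem_nhds ht.1 (ht.2.trans_le hTb))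
    refine ⟨_, (((hsd t).pow 2).mul h1).sub ((hsd t).mul (hcd t)), ?_⟩
    have := mul_le_mul_of_nonneg_left hu' (sq_nonneg (s t))
    simp only [Nat.cast_ofNat, Nat.add_one_sub_one, pow_one, Pi.pow_apply]
    nlinarith
  have hint : interior (Ioc a T) = Ioo a T := interior_Ioc
  have hanti : AntitoneOn Q (Ioc a T) := by
    refine antitoneOn_of_deriv_nonpos (convex_Ioc a T) hQcont ?_ ?_
    · rw [hint]; intro t ht
      obtain ⟨Q', h, -⟩ := hQd t ht
      exact h.differentiableAt.differentiableWithinAt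
    · rw [hint]; intro t ht
      obtain ⟨Q', h, h'⟩ := hQd t ht
      rw [h.deriv]; nlinarith [sq_nonneg (s t * u t - c t)]
  have hqT : q * (T - a) = Real.pi := by rw [hT]; field_simp; ring
  have hsT : s T = 0 := by simp only [hs, hqT, Real.sin_pi]
  have hcT : c T = -q := by simp only [hc, hqT, Real.cos_pi]; ring
  have hsa : s a = 0 := by simp [hs]
  have hca : c a = q := by simp [hc]
  -- Here u blows up like 1/(t - a): the quotient Y/(t - a) tends to `Z a = 1`, hence so does its
  -- inverse. Writing s²u as s · s/(t - a) · B(Z(Y/(t - a))⁻¹e, e) exhibits a product with bounded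
  -- factors and s → 0.
  have hlim : Tendsto Q (𝓝[>] a) (𝓝 0) := by
    have h1 : Tendsto (fun t => (t - a)⁻¹ • Y t) (𝓝[>] a) (𝓝 1) := by
      have := (hYZ a ⟨le_rfl, hle⟩).1
      rw [hasDerivWithinAt_iff_tendsto_slope, hZ0] at this
      refine (this.mono_left ?_).congr ?_
      · rw [Icc_sdiff_left, nhdsWithin_Ioc_eq_nhdsGT (haT.trans_le hTb)]
      · intro t; simp [slope, hY0]
    have h2 : Tendsto (fun t => Ring.inverse ((t - a)⁻¹ • Y t)) (𝓝[>] a) (𝓝 1) := by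
      have := (NormedRing.inverse_continuousAt (1 : (F →L[ℝ] F)ˣ)).tendsto
      simp only [Units.val_one, Ring.inverse_one] at this
      exact this.comp h1
    have h3 : Tendsto (fun t => s t * (t - a)⁻¹) (𝓝[>] a) (𝓝 q) := by
      have := (hsd a).hasDerivWithinAt (s := Ioi a)
      rw [hasDerivWithinAt_iff_tendsto_slope, hca] at this
      refine (this.mono_left (by simp)).congr ?_
      intro t; simp [slope, hsa, mul_comm]
    have h4 : Tendsto s (𝓝[>] a) (𝓝 0) := by
      have := hscont.continuousAt (x := a)
      rw [ContinuousAt, hsa] at this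
      exact this.mono_left nhdsWithin_le_nhds
    have h5 : Tendsto c (𝓝[>] a) (𝓝 q) := by
      have := hccont.continuousAt (x := a)
      rw [ContinuousAt, hca] at this
      exact this.mono_left nhdsWithin_le_nhds
    have h6 : Tendsto Z (𝓝[>] a) (𝓝 1) := by
      have := (hYZ a ⟨le_rfl, hle⟩).2.continuousWithinAt
      rw [ContinuousWithinAt, hZ0] at this
      rw [← nhdsWithin_Ioc_eq_nhdsGT (haT.trans_le hTb)]
      exact this.mono_left (nhdsWithin_mono _ Ioc_subset_Icc_self)
    have h7 : Tendsto (fun t => B (Z t (Ring.inverse ((t - a)⁻¹ • Y t) e)) e) (𝓝[>] a)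
        (𝓝 (B ((1 : F →L[ℝ] F) ((1 : F →L[ℝ] F) e)) e)) :=
      Filter.Tendsto.clm_apply_vec ((B.continuous.tendsto _).comp (Filter.Tendsto.clm_apply_vec h6
        (Filter.Tendsto.clm_apply_vec h2 tendsto_const_nhds))) tendsto_const_nhds
    have h8 := ((h4.mul h3).mul h7).sub (h4.mul h5)
    simp only [zero_mul, sub_zero] at h8
    refine h8.congr' ?_
    rw [← nhdsWithin_Ioc_eq_nhdsGT (haT.trans_le hTb)]
    filter_upwards [self_mem_nhdsWithin] with t ht
    have hne : t - a ≠ 0 := (sub_pos.2 ht.1).ne'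
    rw [Ring.inverse_smul_of_isUnit (hinj t ht) (inv_ne_zero hne), inv_inv]
    simp only [hQ, hu, hX, smul_apply, map_smul, smul_eq_mul]
    field_simp
  -- Q decreases from the limit 0 at a to the value 0 at T, so it vanishes identically. The bound on
  -- Q' then forces su = c.
  have hQ0 : ∀ t ∈ Ioc a T, Q t = 0 := by
    intro t ht
    refine le_antisymm ?_ ?_
    · refine ge_of_tendsto hlim ?_
      filter_upwards [Ioo_mem_nhdsGT ht.1] with r hr
      exact hanti ⟨hr.1, hr.2.le.trans ht.2⟩ ht hr.2.le
    · have := hanti ht ⟨haT, le_rfl⟩ ht.2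
      simpa [hQ, hsT] using this
  have hsu : ∀ t ∈ Ioo a T, s t * u t - c t = 0 := by
    intro t ht
    obtain ⟨Q', h, h'⟩ := hQd t ht
    have h1 : HasDerivAt Q 0 t := by
      refine (hasDerivAt_const t (0 : ℝ)).congr_of_eventuallyEq ?_
      filter_upwards [Ioo_mem_nhds ht.1 ht.2] with r hr
      exact hQ0 r (Ioo_subset_Ioc_self hr)
    rw [h.unique h1] at h'
    have : (s t * u t - c t) ^ 2 = 0 := le_antisymm (by linarith) (sq_nonneg _)
    exact pow_eq_zero_iff (two_ne_zero) |>.1 this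
  -- `Y T` is also invertible, so u is continuous up to T and su = c persists there. But s(T) = 0
  -- and c(T) = -q. Using the endpoint in this way covers the case b - a = π/√k.
  have hT0 : s T * u T - c T = 0 := by
    have h1 : ContinuousWithinAt (fun t => s t * u t - c t) (Ioo a T) T :=
      ((hscont.continuousOn.mul hucont).sub hccont.continuousOn T ⟨haT, le_rfl⟩).mono
        Ioo_subset_Ioc_self
    have h2 : Tendsto (fun t => s t * u t - c t) (𝓝[Ioo a T] T) (𝓝 0) :=
      tendsto_const_nhds.congr' (by filter_upwards [self_mem_nhdsWithin] with t ht
                                    exact (hsu t ht).symm)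
    have : (𝓝[Ioo a T] T).NeBot := by
      rw [nhdsWithin_Ioo_eq_nhdsLT haT]; infer_instance
    exact tendsto_nhds_unique h1 h2
  rw [hsT, hcT] at hT0
  linarith

end Sturm

/-! ### Differentiable dependence of solutions on initial values -/

section Flow

variable {F : Type*} [NormedAddCommGroup F] [NormedSpace ℝ F]

theorem HasDerivWithinAt.Icc_to_Ici {α : ℝ → F} {α' : F} {a b t : ℝ}
    (h : HasDerivWithinAt α α' (Icc a b) t) (ht : t ∈ Ico a b) : HasDerivWithinAt α α' (Ici t) t :=
  h.mono_of_mem_nhdsWithin (Icc_mem_nhdsGE_of_mem ht)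

/-- Mean value inequality on the ball of radius ‖h‖ about p, where the derivative differs from its
value at p by at most C‖h‖. -/
theorem norm_image_sub_sub_fderiv_le {f : F → F} (hf : Differentiable ℝ f) {C : ℝ≥0}
    (hC : LipschitzWith C (fderiv ℝ f)) (p h : F) :
    ‖f (p + h) - f p - fderiv ℝ f p h‖ ≤ C * ‖h‖ ^ 2 := by
  have := (convex_closedBall p ‖h‖).norm_image_sub_le_of_norm_hasFDerivWithin_le' (f := f)
    (f' := fderiv ℝ f) (φ := fderiv ℝ f p) (C := C * ‖h‖) (x := p) (y := p + h)
    (fun z _ => (hf z).hasFDerivAt.hasFDerivWithinAt) (fun z hz => ?_)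
    (Metric.mem_closedBall_self (norm_nonneg h)) (by simp)
  · rw [add_sub_cancel_left] at this
    rw [sq, ← mul_assoc]; exact this
  · rw [← dist_eq_norm]
    exact (hC.dist_le_mul z p).trans (by gcongr; exact hz)

variable [FiniteDimensional ℝ F]

/-- The propagator of a linear ODE. -/
theorem exists_linear_propagator {A : ℝ → F →L[ℝ] F} {a b : ℝ} (hab : a ≤ b)
    (hA : ContinuousOn A (Icc a b)) {K : ℝ≥0} (hK : ∀ t ∈ Icc a b, ‖A t‖ ≤ K) :
    ∃ L : ℝ → F →L[ℝ] F, (∀ h, L a h = h) ∧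
      (∀ h, ∀ t ∈ Icc a b, HasDerivWithinAt (fun t => L t h) (A t (L t h)) (Icc a b) t) ∧
      (∀ h, ∀ t ∈ Icc a b, ‖L t h‖ ≤ Real.exp (K * (b - a)) * ‖h‖) ∧
      ∀ J : ℝ → F, (∀ t ∈ Icc a b, HasDerivWithinAt J (A t (J t)) (Icc a b) t) →
        ∀ t ∈ Icc a b, L t (J a) = J t := by
  have hK' : ∀ t ∈ Icc a b, LipschitzWith K (A t) := fun t ht =>
    (A t).lipschitz.weaken (by rw [← NNReal.coe_le_coe, coe_nnnorm]; exact hK t ht)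
  have hex := fun h : F => exists_ode_solution (f := fun t => A t) hab hK'
    (fun x => hA.clm_apply continuousOn_const) h
  choose α hα0 hα using hex
  have huniq : ∀ J : ℝ → F, (∀ t ∈ Icc a b, HasDerivWithinAt J (A t (J t)) (Icc a b) t) →
      ∀ t ∈ Icc a b, α (J a) t = J t := fun J hJ =>
    ode_solution_eqOn (f := fun t => A t) hK' (hα (J a)) hJ (hα0 _)
  -- Linearity in the initial value is a consequence of uniqueness: sums and multiples of solutions
  -- are solutions. The value 0 outside the interval is never used.
  let L : ℝ → F →L[ℝ] F := fun t => if ht : t ∈ Icc a b then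
    LinearMap.toContinuousLinearMap
      { toFun := fun h => α h t
        map_add' := fun h k => by
          have := huniq (fun t => α h t + α k t) (fun t ht =>
            ((hα h t ht).add (hα k t ht)).congr_deriv (by simp)) t ht
          simpa only [hα0] using this
        map_smul' := fun c h => by
          have := huniq (fun t => c • α h t) (fun t ht =>
            ((hα h t ht).const_smul c).congr_deriv (by simp)) t ht
          simp only [hα0] at this
          exact this } else 0
  have hL : ∀ t ∈ Icc a b, ∀ h, L t h = α h t := fun t ht h => by
    simp only [L, dif_pos ht]; rfl
  refine ⟨L, fun h => by rw [hL a ⟨le_rfl, hab⟩, hα0], fun h t ht => ?_, fun h t ht => ?_,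
    fun J hJ t ht => ?_⟩
  · rw [hL t ht]
    exact (hα h t ht).congr (fun s hs => hL s hs h) (hL t ht h)
  · rw [hL t ht]
    have := norm_le_gronwallBound_of_norm_deriv_right_le (f := α h) (f' := fun t => A t (α h t))
      (δ := ‖h‖) (K := K) (ε := 0) (fun t ht => (hα h t ht).continuousWithinAt)
      (fun t ht => (hα h t (Ico_subset_Icc_self ht)).Icc_to_Ici ht) (by rw [hα0]) (fun t ht => by
        rw [add_zero]
        exact ((A t).le_opNorm _).trans (by gcongr; exact hK t (Ico_subset_Icc_self ht))) t ht
    rw [gronwallBound_ε0] at this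
    refine this.trans ?_
    rw [mul_comm]
    have h2 := ht.2
    gcongr
  · rw [hL t ht]; exact huniq J hJ t ht

/-- Differentiable dependence on the initial value, for a compactly supported vector field. -/
theorem exists_flow_of_hasCompactSupport {f : F → F} (hf : ContDiff ℝ 2 f)
    (hc : HasCompactSupport f) {x : ℝ → F} {a b : ℝ} (hab : a ≤ b)
    (hx : ∀ t ∈ Icc a b, HasDerivWithinAt x (f (x t)) (Icc a b) t) :
    ∃ Φ : F → ℝ → F, (∀ y, Φ y a = y ∧
        ∀ t ∈ Icc a b, HasDerivWithinAt (Φ y) (f (Φ y t)) (Icc a b) t) ∧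
      (∃ C : ℝ, ∀ y, ∀ t ∈ Icc a b, dist (Φ y t) (x t) ≤ dist y (x a) * C) ∧
      ∃ L : F →L[ℝ] F, HasFDerivAt (fun y => Φ y b) L (x a) ∧
        ∀ J : ℝ → F, (∀ t ∈ Icc a b, HasDerivWithinAt J (fderiv ℝ f (x t) (J t)) (Icc a b) t) →
          L (J a) = J b := by
  obtain ⟨K₀, hK₀⟩ := hf.lipschitzWith_of_hasCompactSupport hc (by norm_num)
  obtain ⟨C, hC⟩ := (hf.fderiv_right (m := 1) (by norm_num)).lipschitzWith_of_hasCompactSupport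
    (hc.fderiv ℝ) (by norm_num)
  -- Enlarged so that K ≠ 0, as the closed form of the Gronwall bound divides by K.
  set K : ℝ≥0 := K₀ + 1
  have hK : LipschitzWith K f := hK₀.weaken (by simp [K])
  have hK0 : (K : ℝ) ≠ 0 := by positivity
  have hex := fun y : F => exists_ode_solution (f := fun _ => f) hab (fun _ _ => hK)
    (fun x => continuousOn_const) y
  choose Φ hΦ0 hΦ using hex
  have hbb : b ∈ Icc a b := ⟨hab, le_rfl⟩
  refine ⟨Φ, fun y => ⟨hΦ0 y, hΦ y⟩, ⟨Real.exp (K * (b - a)), fun y t ht => ?_⟩, ?_⟩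
  · have := dist_le_of_trajectories_ODE (v := fun _ => f) (f := Φ y) (g := x) (fun _ => hK)
      (fun t ht => (hΦ y t ht).continuousWithinAt)
      (fun t ht => (hΦ y t (Ico_subset_Icc_self ht)).Icc_to_Ici ht)
      (fun t ht => (hx t ht).continuousWithinAt)
      (fun t ht => (hx t (Ico_subset_Icc_self ht)).Icc_to_Ici ht) (by rw [hΦ0]) t ht
    refine this.trans ?_
    have h2 := ht.2
    gcongr
  have hxc : ContinuousOn x (Icc a b) := fun t ht => (hx t ht).continuousWithinAt
  obtain ⟨L, hL0, hLd, hLb, hLu⟩ := exists_linear_propagator (A := fun t => fderiv ℝ f (x t)) hab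
    ((hf.continuous_fderiv (by norm_num)).comp_continuousOn hxc) (K := K) (fun t _ =>
      norm_fderiv_le_of_lipschitz ℝ hK)
  refine ⟨L b, ?_, fun J hJ => hLu J hJ b hbb⟩
  set M : ℝ := Real.exp (K * (b - a))
  set D : ℝ := C * M ^ 2 / K * (Real.exp (K * (b - a)) - 1)
  -- The curve x + Lh has the same initial value as the solution from x(a) + h and solves the
  -- equation up to an error C(M‖h‖)², so Gronwall bounds the difference quadratically in h.
  have key : ∀ h, ‖Φ (x a + h) b - x b - L b h‖ ≤ D * ‖h‖ ^ 2 := by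
    intro h
    have := dist_le_of_approx_trajectories_ODE (v := fun _ => f) (f := Φ (x a + h))
      (g := fun t => x t + L t h) (f' := fun t => f (Φ (x a + h) t))
      (g' := fun t => f (x t) + fderiv ℝ f (x t) (L t h)) (εf := 0)
      (εg := C * (M * ‖h‖) ^ 2) (δ := 0) (fun _ => hK)
      (fun t ht => (hΦ _ t ht).continuousWithinAt)
      (fun t ht => (hΦ _ t (Ico_subset_Icc_self ht)).Icc_to_Ici ht)
      (fun t _ => by rw [dist_self])
      (fun t ht => ((hx t ht).add (hLd h t ht)).continuousWithinAt)
      (fun t ht => ((hx t (Ico_subset_Icc_self ht)).add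
        (hLd h t (Ico_subset_Icc_self ht))).Icc_to_Ici ht)
      (fun t ht => by
        rw [dist_comm, dist_eq_norm, ← sub_sub]
        refine (norm_image_sub_sub_fderiv_le (hf.differentiable (by norm_num)) hC _ _).trans ?_
        have := hLb h t (Ico_subset_Icc_self ht)
        gcongr)
      (by rw [hΦ0, hL0, dist_self]) b hbb
    rw [dist_eq_norm, ← sub_sub, gronwallBound_of_K_ne_0 hK0] at this
    refine this.trans (le_of_eq ?_)
    simp only [D]
    ring
  have hbx : Φ (x a) b = x b := by
    have := key 0
    simpa [sub_eq_zero] using this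
  rw [hasFDerivAt_iff_isLittleO_nhds_zero]
  refine Asymptotics.IsBigO.trans_isLittleO (g := fun h : F => ‖h‖ ^ 2) ?_ ?_
  · refine Asymptotics.IsBigO.of_bound D (Eventually.of_forall fun h => ?_)
    simp only [hbx, norm_pow, norm_norm]
    exact key h
  · have := Asymptotics.isLittleO_norm_pow_id (E' := F) (n := 2) (by norm_num)
    exact this

/-- Differentiable dependence on the initial value near a given compact trajectory. -/
theorem exists_flow_near {f : F → F} {Ω : Set F} (hΩ : IsOpen Ω) (hf : ContDiffOn ℝ 2 f Ω)
    {x : ℝ → F} {a b : ℝ} (hab : a ≤ b) (hxΩ : ∀ t ∈ Icc a b, x t ∈ Ω)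
    (hx : ∀ t ∈ Icc a b, HasDerivWithinAt x (f (x t)) (Icc a b) t) :
    ∃ Φ : F → ℝ → F, (∀ᶠ y in 𝓝 (x a), Φ y a = y ∧ ∀ t ∈ Icc a b, Φ y t ∈ Ω ∧
        HasDerivWithinAt (Φ y) (f (Φ y t)) (Icc a b) t) ∧
      Φ (x a) b = x b ∧
      ∃ L : F →L[ℝ] F, HasFDerivAt (fun y => Φ y b) L (x a) ∧
        ∀ J : ℝ → F, (∀ t ∈ Icc a b, HasDerivWithinAt J (fderiv ℝ f (x t) (J t)) (Icc a b) t) →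
          L (J a) = J b := by
  have hxc : ContinuousOn x (Icc a b) := fun t ht => (hx t ht).continuousWithinAt
  set S := x '' Icc a b
  have hS : IsCompact S := isCompact_Icc.image_of_continuousOn hxc
  have hSΩ : S ⊆ Ω := by rintro _ ⟨t, ht, rfl⟩; exact hxΩ t ht
  obtain ⟨δ, hδ, hδΩ⟩ := hS.exists_cthickening_subset_open hΩ hSΩ
  obtain ⟨χ, hχ1, hχ0, -⟩ := exists_contMDiffMap_one_nhds_of_subset_interior (n := 2) 𝓘(ℝ, F)
    hS.isClosed (t := Metric.cthickening δ S)
    ((Metric.self_subset_thickening hδ S).trans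
      (interior_maximal (Metric.thickening_subset_cthickening δ S) Metric.isOpen_thickening))
  have hχ : ContDiff ℝ 2 χ := χ.contMDiff.contDiff
  -- The cutoff is 1 on a neighbourhood V of the trajectory and is supported in a compact subset of
  -- Ω. Thus g is globally defined with compact support, and its flow and linearisation along x are
  -- those of f.
  set g : F → F := fun y => χ y • f y
  have hg : ContDiff ℝ 2 g := by
    refine contDiff_iff_contDiffAt.2 fun y => ?_
    by_cases hy : y ∈ Ω
    · exact hχ.contDiffAt.smul (hf.contDiffAt (hΩ.mem_nhds hy))
    · have h1 : (Metric.cthickening δ S)ᶜ ∈ 𝓝 y :=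
        Metric.isClosed_cthickening.isOpen_compl.mem_nhds fun h => hy (hδΩ h)
      refine (contDiffAt_const (c := (0 : F))).congr_of_eventuallyEq ?_
      filter_upwards [h1] with z hz
      simp [g, hχ0 z hz]
  have hgc : HasCompactSupport g := by
    refine HasCompactSupport.intro (hS.cthickening (r := δ)) fun y hy => ?_
    simp [g, hχ0 y hy]
  obtain ⟨V, hV, hSV, hV1⟩ := mem_nhdsSet_iff_exists.1 hχ1
  have hV1' : ∀ y ∈ V, χ y = 1 := hV1
  have hgx : ∀ t ∈ Icc a b, g =ᶠ[𝓝 (x t)] f := fun t ht => by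
    filter_upwards [hV.mem_nhds (hSV ⟨t, ht, rfl⟩)] with y hy
    simp [g, hV1' y hy]
  obtain ⟨Φ, hΦ, ⟨C, hC⟩, L, hL, hLJ⟩ := exists_flow_of_hasCompactSupport hg hgc hab
    (fun t ht => by rw [(hgx t ht).eq_of_nhds]; exact hx t ht)
  -- Solutions of g starting close enough to x(a) stay within ε of the trajectory, hence in V ∩ Ω,
  -- where g = f.
  obtain ⟨ε, hε, hεV⟩ := hS.exists_cthickening_subset_open (hV.inter hΩ)
    (subset_inter hSV hSΩ)
  refine ⟨Φ, ?_, ?_, L, hL, fun J hJ => hLJ J fun t ht => ?_⟩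
  · have h1 : Tendsto (fun y => dist y (x a) * C) (𝓝 (x a)) (𝓝 0) := by
      have : Tendsto (fun y => dist y (x a) * C) (𝓝 (x a)) (𝓝 (dist (x a) (x a) * C)) :=
        (continuous_id.dist continuous_const).mul continuous_const |>.tendsto _
      simpa using this
    filter_upwards [h1.eventually (gt_mem_nhds hε)] with y hy
    refine ⟨(hΦ y).1, fun t ht => ?_⟩
    have h2 : Φ y t ∈ V ∩ Ω := hεV (Metric.mem_cthickening_of_dist_le _ (x t) _ _ ⟨t, ht, rfl⟩
      ((hC y t ht).trans hy.le))
    refine ⟨h2.2, ?_⟩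
    have h3 := (hΦ y).2 t ht
    simpa [g, hV1' _ h2.1] using h3
  · have := hC (x a) b ⟨hab, le_rfl⟩
    simpa using this
  · rw [(hgx t ht).fderiv_eq]; exact hJ t ht

end Flow

/-! ### Tangent vectors and vector fields in chart coordinates -/

abbrev Eu (n : ℕ) := EuclideanSpace ℝ (Fin n)

section Coordinates

variable {n : ℕ} {M : Type*} [TopologicalSpace M] [ChartedSpace (EuclideanSpace ℝ (Fin n)) M]

/-- The domain of the preferred chart at `c`. -/
abbrev chSrc (n : ℕ) {M : Type*} [TopologicalSpace M]
    [ChartedSpace (EuclideanSpace ℝ (Fin n)) M] (c : M) : Set M :=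
  (chartAt (EuclideanSpace ℝ (Fin n)) c).source

/-- The coordinate domain of the preferred chart at `c`. -/
abbrev chTgt (n : ℕ) {M : Type*} [TopologicalSpace M]
    [ChartedSpace (EuclideanSpace ℝ (Fin n)) M] (c : M) : Set (Eu n) :=
  (extChartAt (𝓡 n) c).target

/-- The point with given coordinates in the chart at `c`. -/
abbrev pt (c : M) (z : Eu n) : M := (extChartAt (𝓡 n) c).symm z

theorem isOpen_chTgt (c : M) : IsOpen (chTgt n c) := isOpen_extChartAt_target c

theorem chSrc_eq (c : M) : chSrc n c = (extChartAt (𝓡 n) c).source :=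
  (extChartAt_source (I := 𝓡 n) c).symm

theorem pt_mem {c : M} {z : Eu n} (hz : z ∈ chTgt n c) : pt c z ∈ chSrc n c := by
  rw [chSrc_eq]; exact (extChartAt (𝓡 n) c).map_target hz

theorem ch_mem {c x : M} (hx : x ∈ chSrc n c) : extChartAt (𝓡 n) c x ∈ chTgt n c := by
  rw [chSrc_eq] at hx; exact (extChartAt (𝓡 n) c).map_source hx

theorem pt_ch {c x : M} (hx : x ∈ chSrc n c) : pt c (extChartAt (𝓡 n) c x) = x := by
  rw [chSrc_eq] at hx; exact (extChartAt (𝓡 n) c).left_inv hx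

theorem ch_pt {c : M} {z : Eu n} (hz : z ∈ chTgt n c) : extChartAt (𝓡 n) c (pt c z) = z :=
  (extChartAt (𝓡 n) c).right_inv hz

variable [IsManifold (𝓡 n) ∞ M]

/-- Components of a tangent vector at `x` in the chart at `c`. -/
def tc (c x : M) : TangentSpace (𝓡 n) x →L[ℝ] Eu n :=
  (trivializationAt (Eu n) (TangentSpace (𝓡 n) : M → Type _) c).continuousLinearMapAt ℝ x

/-- The tangent vector at `x` with given components in the chart at `c`. -/
def ts (c x : M) : Eu n →L[ℝ] TangentSpace (𝓡 n) x :=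
  (trivializationAt (Eu n) (TangentSpace (𝓡 n) : M → Type _) c).symmL ℝ x

/-- The vector field with constant components `w` in the chart at `c`. -/
def cfield (c : M) (w : Eu n) (x : M) : TangentSpace (𝓡 n) x := ts c x w

/-- The components of a vector field in the chart at `c`. -/
def crepr (c : M) (X : ∀ x : M, TangentSpace (𝓡 n) x) (z : Eu n) : Eu n :=
  tc c (pt c z) (X (pt c z))

theorem tc_ts {c x : M} (hx : x ∈ chSrc n c) (w : Eu n) : tc c x (ts c x w) = w :=
  (trivializationAt (Eu n) (TangentSpace (𝓡 n) : M → Type _) c).continuousLinearMapAt_symmL hx w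

theorem ts_tc {c x : M} (hx : x ∈ chSrc n c) (v : TangentSpace (𝓡 n) x) :
    ts c x (tc c x v) = v :=
  (trivializationAt (Eu n) (TangentSpace (𝓡 n) : M → Type _) c).symmL_continuousLinearMapAt hx v

theorem tc_injective {c x : M} (hx : x ∈ chSrc n c) : Function.Injective (tc (n := n) c x) :=
  Function.LeftInverse.injective (ts_tc hx)

theorem tc_eq_mfderiv {c x : M} (hx : x ∈ chSrc n c) :
    tc c x = mfderiv (𝓡 n) 𝓘(ℝ, Eu n) (extChartAt (𝓡 n) c) x :=
  TangentBundle.continuousLinearMapAt_trivializationAt hx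

theorem triv_apply {c x : M} (hx : x ∈ chSrc n c) (v : TangentSpace (𝓡 n) x) :
    (trivializationAt (Eu n) (TangentSpace (𝓡 n) : M → Type _) c ⟨x, v⟩).2 = tc c x v := by
  rw [tc, Trivialization.continuousLinearMapAt_apply, Trivialization.linearMapAt_apply]
  exact (if_pos hx).symm

/-- Links the extensions used in the definitions of curvature and of the derivative along a curve
with the coordinate fields `cfield`. -/
theorem extendVec_eq_cfield {x : M} (v : TangentSpace (𝓡 n) x) {y : M} (hy : y ∈ chSrc n x) :
    extendVec v y = cfield x (tc x x v) y := by
  simp only [extendVec, FiberBundle.extend, cfield, ts]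
  rw [triv_apply (mem_chart_source _ x), Trivialization.symmL_apply]
  exact hy

theorem crepr_cfield {c : M} {z : Eu n} (hz : z ∈ chTgt n c) (w : Eu n) :
    crepr c (cfield c w) z = w := tc_ts (pt_mem hz) w

theorem fieldDiffAt_iff {c x : M} (hx : x ∈ chSrc n c) (X : ∀ x : M, TangentSpace (𝓡 n) x) :
    FieldDiffAt X x ↔ DifferentiableAt ℝ (crepr c X) (extChartAt (𝓡 n) c x) := by
  rw [FieldDiffAt, Trivialization.mdifferentiableAt_section_iff (𝓡 n)
    (trivializationAt (Eu n) (TangentSpace (𝓡 n) : M → Type _) c) X hx]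
  have hsrc : chSrc n c ∈ 𝓝 x := (chartAt (Eu n) c).open_source.mem_nhds hx
  have h1 : (fun y => (trivializationAt (Eu n) (TangentSpace (𝓡 n) : M → Type _) c ⟨y, X y⟩).2)
      =ᶠ[𝓝 x] fun y => crepr c X (extChartAt (𝓡 n) c y) := by
    filter_upwards [hsrc] with y hy
    rw [triv_apply hy, crepr, pt_ch hy]
  have htgt : chTgt n c ∈ 𝓝 (extChartAt (𝓡 n) c x) := (isOpen_chTgt c).mem_nhds (ch_mem hx)
  constructor
  · intro h
    have h2 := h.congr_of_eventuallyEq h1.symm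
    have h3 : MDifferentiableAt 𝓘(ℝ, Eu n) (𝓡 n) (extChartAt (𝓡 n) c).symm
        (extChartAt (𝓡 n) c x) := by
      have := mdifferentiableWithinAt_extChartAt_symm (I := 𝓡 n) (ch_mem hx)
      rwa [modelWithCornersSelf_coe, range_id, mdifferentiableWithinAt_univ] at this
    have h4 : MDifferentiableAt (𝓡 n) 𝓘(ℝ, Eu n) (fun y => crepr c X (extChartAt (𝓡 n) c y))
      (pt c (extChartAt (𝓡 n) c x)) := by rw [pt_ch hx]; exact h2
    have h5 := (h4.comp _ h3).differentiableAt
    refine h5.congr_of_eventuallyEq ?_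
    filter_upwards [htgt] with z hz
    simp only [Function.comp]
    rw [ch_pt hz]
  · intro h
    exact (h.mdifferentiableAt.comp x (mdifferentiableAt_extChartAt hx)).congr_of_eventuallyEq h1

end Coordinates

/-! ### Christoffel symbols, Lie bracket and torsion in coordinates -/

section Connection

variable {n : ℕ} {M : Type*} [TopologicalSpace M] [ChartedSpace (EuclideanSpace ℝ (Fin n)) M]
  [IsManifold (𝓡 n) ∞ M]

theorem crepr_cfield_eventuallyEq {c x : M} (hx : x ∈ chSrc n c) (w : Eu n) :
    crepr c (cfield c w) =ᶠ[𝓝 (extChartAt (𝓡 n) c x)] fun _ => w := by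
  filter_upwards [(isOpen_chTgt c).mem_nhds (ch_mem hx)] with z hz
  exact crepr_cfield hz w

theorem fieldDiffAt_cfield {c x : M} (hx : x ∈ chSrc n c) (w : Eu n) :
    FieldDiffAt (cfield c w) x := by
  rw [fieldDiffAt_iff hx]
  exact (differentiableAt_const w).congr_of_eventuallyEq (crepr_cfield_eventuallyEq hx w)

theorem mdifferentiableAt_pt {c : M} {z : Eu n} (hz : z ∈ chTgt n c) :
    MDifferentiableAt 𝓘(ℝ, Eu n) (𝓡 n) (pt c) z := by
  have := mdifferentiableWithinAt_extChartAt_symm (I := 𝓡 n) hz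
  rwa [modelWithCornersSelf_coe, range_id, mdifferentiableWithinAt_univ] at this

theorem mdifferentiableAt_iff_coord {G : Type*} [NormedAddCommGroup G] [NormedSpace ℝ G]
    {f : M → G} {c x : M} (hx : x ∈ chSrc n c) : MDifferentiableAt (𝓡 n) 𝓘(ℝ, G) f x ↔
      DifferentiableAt ℝ (fun z => f (pt c z)) (extChartAt (𝓡 n) c x) := by
  constructor
  · intro h
    have h4 : MDifferentiableAt (𝓡 n) 𝓘(ℝ, G) f (pt c (extChartAt (𝓡 n) c x)) := by
      rwa [pt_ch hx]
    exact (h4.comp _ (mdifferentiableAt_pt (ch_mem hx))).differentiableAt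
  · intro h
    refine (h.mdifferentiableAt.comp x (mdifferentiableAt_extChartAt hx)).congr_of_eventuallyEq ?_
    filter_upwards [(chartAt (Eu n) c).open_source.mem_nhds hx] with y hy
    simp only [Function.comp]
    rw [pt_ch hy]

theorem mvfderiv_coord {f : M → ℝ} {c x : M} (hx : x ∈ chSrc n c)
    (hf : DifferentiableAt ℝ (fun z => f (pt c z)) (extChartAt (𝓡 n) c x))
    (v : TangentSpace (𝓡 n) x) :
    mvfderiv (𝓡 n) f x v = fderiv ℝ (fun z => f (pt c z)) (extChartAt (𝓡 n) c x) (tc c x v) := by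
  have h1 : f =ᶠ[𝓝 x] (fun z => f (pt c z)) ∘ extChartAt (𝓡 n) c := by
    filter_upwards [(chartAt (Eu n) c).open_source.mem_nhds hx] with y hy
    simp only [Function.comp]
    rw [pt_ch hy]
  have h2 : HasMFDerivAt (𝓡 n) 𝓘(ℝ, ℝ) f x _ :=
    (hf.hasFDerivAt.hasMFDerivAt.comp x
      (mdifferentiableAt_extChartAt hx).hasMFDerivAt).congr_of_eventuallyEq h1
  rw [mvfderiv, h2.mfderiv, tc_eq_mfderiv hx]
  rfl

variable (cov : LinearConnection n M)

/-- The Christoffel symbols in the chart at `c`: `christoffel cov c z u w` are the components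
at the point with coordinates `z` of the covariant derivative, in the direction with components
`u`, of the field with constant components `w`. -/
def christoffel (c : M) (z : Eu n) : Eu n →L[ℝ] Eu n →L[ℝ] Eu n :=
  ∑ i : Fin n, (ContinuousLinearMap.smulRightL ℝ (Eu n) (Eu n) (EuclideanSpace.proj i)).comp
    ((tc c (pt c z)).comp ((cov (cfield c (EuclideanSpace.single i 1)) (pt c z)).comp
      (ts c (pt c z))))

theorem christoffel_apply (c : M) (z u w : Eu n) :
    christoffel cov c z u w = ∑ i : Fin n, w i •
      tc c (pt c z) (cov (cfield c (EuclideanSpace.single i 1)) (pt c z) (ts c (pt c z) u)) := by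
  simp [christoffel, sum_apply]

variable {cov}

theorem cov_sum {ι : Type*} (s : Finset ι) (σ : ι → ∀ x : M, TangentSpace (𝓡 n) x) {x : M}
    (hσ : ∀ i, FieldDiffAt (σ i) x) : cov (∑ i ∈ s, σ i) x = ∑ i ∈ s, cov (σ i) x := by
  classical
  induction s using Finset.induction_on with
  | empty => simp
  | insert i s hi ih =>
    have hs : FieldDiffAt (∑ i ∈ s, σ i) x := by
      have := MDifferentiableAt.sum_section (s := s) (t := σ) (x₀ := x) (fun i _ => hσ i)
      convert this using 1
      funext y
      simp [Finset.sum_apply]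
    rw [Finset.sum_insert hi, Finset.sum_insert hi,
      cov.isCovariantDerivativeOnUniv.add (hσ i) hs, ih]

/-- Near x the field is a combination of the coordinate fields with its components as coefficients.
The Leibniz rule splits each term into a derivative of the coefficient and a Christoffel term. -/
theorem tc_cov {c x : M} (hx : x ∈ chSrc n c) {Y : ∀ x : M, TangentSpace (𝓡 n) x}
    (hY : FieldDiffAt Y x) (v : TangentSpace (𝓡 n) x) :
    tc c x (cov Y x v) = fderiv ℝ (crepr c Y) (extChartAt (𝓡 n) c x) (tc c x v) +
      christoffel cov c (extChartAt (𝓡 n) c x) (tc c x v)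
        (crepr c Y (extChartAt (𝓡 n) c x)) := by
  set f : Fin n → M → ℝ := fun i y => crepr c Y (extChartAt (𝓡 n) c y) i with hf
  set σ : Fin n → ∀ y : M, TangentSpace (𝓡 n) y := fun i =>
    cfield c (EuclideanSpace.single i 1) with hσ
  have hσd : ∀ i, FieldDiffAt (σ i) x := fun i => fieldDiffAt_cfield hx _
  have hYd := (fieldDiffAt_iff hx Y).1 hY
  have hYi : ∀ i, DifferentiableAt ℝ (fun z => crepr c Y z i) (extChartAt (𝓡 n) c x) := fun i =>
    (EuclideanSpace.proj (𝕜 := ℝ) i).differentiableAt.comp _ hYd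
  have hfe : ∀ i, (fun z => f i (pt c z)) =ᶠ[𝓝 (extChartAt (𝓡 n) c x)]
      fun z => crepr c Y z i := fun i => by
    filter_upwards [(isOpen_chTgt c).mem_nhds (ch_mem hx)] with z hz
    simp only [hf]
    rw [ch_pt hz]
  have hfd : ∀ i, MDifferentiableAt (𝓡 n) 𝓘(ℝ, ℝ) (f i) x := fun i =>
    (mdifferentiableAt_iff_coord hx).2 ((hYi i).congr_of_eventuallyEq (hfe i))
  have hfσ : ∀ i, FieldDiffAt (f i • σ i) x := fun i => (hfd i).smul_section (hσd i)
  have hev : ∀ᶠ y in 𝓝 x, Y y = (∑ i, f i • σ i) y := by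
    filter_upwards [(chartAt (Eu n) c).open_source.mem_nhds hx] with y hy
    apply tc_injective hy
    rw [Finset.sum_apply, map_sum]
    simp only [Pi.smul_apply', map_smul, hσ, cfield, tc_ts hy, hf, crepr]
    rw [pt_ch hy]
    ext j
    simp [Finset.sum_apply, Pi.single_apply]
  have hsum : FieldDiffAt (∑ i, f i • σ i) x := by
    have := MDifferentiableAt.sum_section (s := Finset.univ) (t := fun i => f i • σ i) (x₀ := x)
      (fun i _ => hfσ i)
    convert this using 1
    funext y
    simp [Finset.sum_apply]
  rw [cov.isCovariantDerivativeOnUniv.congr_of_eventuallyEq hY hsum Filter.univ_mem hev,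
    cov_sum _ _ hfσ, sum_apply, map_sum, christoffel_apply]
  have hterm : ∀ i, tc c x (cov (f i • σ i) x v) = crepr c Y (extChartAt (𝓡 n) c x) i •
      tc c x (cov (σ i) x v) + (fderiv ℝ (crepr c Y) (extChartAt (𝓡 n) c x) (tc c x v)) i •
        EuclideanSpace.single i 1 := by
    intro i
    rw [cov.isCovariantDerivativeOnUniv.leibniz (hσd i) (hfd i)]
    have h1 : mvfderiv (𝓡 n) (f i) x v =
        (fderiv ℝ (crepr c Y) (extChartAt (𝓡 n) c x) (tc c x v)) i := by
      rw [mvfderiv_coord hx ((hYi i).congr_of_eventuallyEq (hfe i)), (hfe i).fderiv_eq]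
      have := ((EuclideanSpace.proj (𝕜 := ℝ) i).hasFDerivAt.comp _ hYd.hasFDerivAt).fderiv
      exact DFunLike.congr_fun this _
    simp only [add_apply, smul_apply,
      ContinuousLinearMap.smulRight_apply, map_add, map_smul, h1]
    rw [show tc c x (σ i x) = EuclideanSpace.single i 1 from tc_ts hx _]
  simp only [hterm, Finset.sum_add_distrib]
  rw [add_comm]
  congr 1
  · ext j
    simp [Finset.sum_apply, Pi.single_apply]
  · rw [pt_ch hx, ts_tc hx]

theorem tc_cov_cfield {c x : M} (hx : x ∈ chSrc n c) (w : Eu n) (v : TangentSpace (𝓡 n) x) :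
    tc c x (cov (cfield c w) x v) =
      christoffel cov c (extChartAt (𝓡 n) c x) (tc c x v) w := by
  rw [tc_cov hx (fieldDiffAt_cfield hx w), (crepr_cfield_eventuallyEq hx w).fderiv_eq,
    crepr_cfield (ch_mem hx)]
  simp

theorem mfderiv_pt {c : M} {z : Eu n} (hz : z ∈ chTgt n c) :
    mfderiv 𝓘(ℝ, Eu n) (𝓡 n) (pt c) z = ts c (pt c z) := by
  have := TangentBundle.symmL_trivializationAt (I := 𝓡 n) (pt_mem hz)
  rw [modelWithCornersSelf_coe, range_id, mfderivWithin_univ, ch_pt hz] at this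
  exact this.symm

theorem mpullback_pt {c : M} {z : Eu n} (hz : z ∈ chTgt n c)
    (X : ∀ x : M, TangentSpace (𝓡 n) x) :
    VectorField.mpullback 𝓘(ℝ, Eu n) (𝓡 n) (pt c) X z = crepr c X z := by
  rw [VectorField.mpullback_apply, mfderiv_pt hz, crepr]
  have : (ts (n := n) c (pt c z)).inverse = tc c (pt c z) :=
    ContinuousLinearMap.inverse_eq (ContinuousLinearMap.ext fun v => ts_tc (pt_mem hz) v)
      (ContinuousLinearMap.ext fun v => tc_ts (pt_mem hz) v)
  exact DFunLike.congr_fun this _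

theorem mlieBracket_eq_lieBracket (V W : ∀ z : Eu n, TangentSpace 𝓘(ℝ, Eu n) z) :
    VectorField.mlieBracket 𝓘(ℝ, Eu n) V W = VectorField.lieBracket (E := Eu n) ℝ V W :=
  (VectorField.mlieBracketWithin_univ (I := 𝓘(ℝ, Eu n)) (V := V) (W := W)).symm.trans
    (VectorField.mlieBracketWithin_eq_lieBracketWithin.trans VectorField.lieBracketWithin_univ)

/-- The bracket is natural under pullback by the inverse chart, and in the model space it is the
usual DV(U) - DU(V). -/
theorem tc_mlieBracket {c x : M} (hx : x ∈ chSrc n c) {U V : ∀ x : M, TangentSpace (𝓡 n) x}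
    (hU : FieldDiffAt U x) (hV : FieldDiffAt V x) :
    tc c x (VectorField.mlieBracket (𝓡 n) U V x) =
      fderiv ℝ (crepr c V) (extChartAt (𝓡 n) c x) (tc c x (U x))
        - fderiv ℝ (crepr c U) (extChartAt (𝓡 n) c x) (tc c x (V x)) := by
  set z := extChartAt (𝓡 n) c x
  have hz : z ∈ chTgt n c := ch_mem hx
  have hpt : ContMDiffAt 𝓘(ℝ, Eu n) (𝓡 n) ∞ (pt c) z :=
    (contMDiffOn_extChartAt_symm c).contMDiffAt ((isOpen_chTgt c).mem_nhds hz)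
  have e : pt c z = x := pt_ch hx
  have : IsManifold (𝓡 n) (minSmoothness ℝ 3) M := by
    rw [minSmoothness_of_isRCLikeNormedField]
    exact IsManifold.of_le (n := ∞) (WithTop.coe_le_coe.2 (le_top (a := (3 : ℕ∞))))
  have h := VectorField.mpullback_mlieBracket (I := 𝓘(ℝ, Eu n)) (I' := 𝓡 n) (f := pt c)
    (V := U) (W := V) (x₀ := z) (by rw [e]; exact hU) (by rw [e]; exact hV) hpt (by
      rw [minSmoothness_of_isRCLikeNormedField]
      exact WithTop.coe_le_coe.2 (le_top (a := (2 : ℕ∞))))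
  have hev : ∀ X : ∀ x : M, TangentSpace (𝓡 n) x,
      VectorField.mpullback 𝓘(ℝ, Eu n) (𝓡 n) (pt c) X =ᶠ[𝓝 z] crepr c X := fun X => by
    filter_upwards [(isOpen_chTgt c).mem_nhds hz] with z' hz'
    exact mpullback_pt hz' X
  have hb : VectorField.mlieBracket 𝓘(ℝ, Eu n)
      (VectorField.mpullback 𝓘(ℝ, Eu n) (𝓡 n) (pt c) U)
      (VectorField.mpullback 𝓘(ℝ, Eu n) (𝓡 n) (pt c) V) z =
      VectorField.lieBracket ℝ (crepr c U) (crepr c V) z := by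
    exact (congrFun (mlieBracket_eq_lieBracket _ _) z).trans
      ((hev U).lieBracket_vectorField_eq (hev V))
  have h2 := (mpullback_pt hz (VectorField.mlieBracket (𝓡 n) U V)).symm.trans (h.trans hb)
  simp only [VectorField.lieBracket, crepr] at h2
  rw [e] at h2
  exact h2

/-- Evaluate the torsion on coordinate fields, whose bracket vanishes. -/
theorem tc_torsion {c x : M} (hx : x ∈ chSrc n c) (u w : Eu n) :
    tc c x (cov.torsion x (ts c x u) (ts c x w)) =
      christoffel cov c (extChartAt (𝓡 n) c x) u w
        - christoffel cov c (extChartAt (𝓡 n) c x) w u := by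
  have hu := fieldDiffAt_cfield hx u
  have hw := fieldDiffAt_cfield hx w
  have := cov.torsion_apply hu hw
  simp only [cfield] at this
  rw [this, map_sub, map_sub, tc_mlieBracket hx hu hw,
    (crepr_cfield_eventuallyEq hx w).fderiv_eq, (crepr_cfield_eventuallyEq hx u).fderiv_eq]
  have h1 := tc_cov_cfield (cov := cov) hx w (ts c x u)
  have h2 := tc_cov_cfield (cov := cov) hx u (ts c x w)
  rw [tc_ts hx] at h1 h2
  rw [← h1, ← h2]
  simp

end Connection

/-! ### Smoothness of Christoffel symbols; the curvature in coordinates -/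

section Connection

variable {n : ℕ} {M : Type*} [TopologicalSpace M] [ChartedSpace (EuclideanSpace ℝ (Fin n)) M]
  [IsManifold (𝓡 n) ∞ M]

/-- The vector field `X` is smooth at `x`. -/
abbrev SmoothFieldAt (X : ∀ x : M, TangentSpace (𝓡 n) x) (x : M) : Prop :=
  ContMDiffAt (𝓡 n) ((𝓡 n).prod 𝓘(ℝ, Eu n)) ∞ (fun y => TotalSpace.mk' (Eu n)
    (E := (TangentSpace (𝓡 n) : M → Type _)) y (X y)) x

theorem smoothFieldAt_iff {c x : M} (hx : x ∈ chSrc n c) (X : ∀ x : M, TangentSpace (𝓡 n) x) :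
    SmoothFieldAt X x ↔ ContDiffAt ℝ ∞ (crepr c X) (extChartAt (𝓡 n) c x) := by
  rw [SmoothFieldAt, Trivialization.contMDiffAt_section_iff (IB := 𝓡 n)
    (trivializationAt (Eu n) (TangentSpace (𝓡 n) : M → Type _) c) hx]
  have hsrc : chSrc n c ∈ 𝓝 x := (chartAt (Eu n) c).open_source.mem_nhds hx
  have h1 : (fun y => (trivializationAt (Eu n) (TangentSpace (𝓡 n) : M → Type _) c ⟨y, X y⟩).2)
      =ᶠ[𝓝 x] fun y => crepr c X (extChartAt (𝓡 n) c y) := by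
    filter_upwards [hsrc] with y hy
    rw [triv_apply hy, crepr, pt_ch hy]
  have htgt : chTgt n c ∈ 𝓝 (extChartAt (𝓡 n) c x) := (isOpen_chTgt c).mem_nhds (ch_mem hx)
  constructor
  · intro h
    have h2 := h.congr_of_eventuallyEq h1.symm
    have h3 : ContMDiffAt 𝓘(ℝ, Eu n) (𝓡 n) ∞ (extChartAt (𝓡 n) c).symm
        (extChartAt (𝓡 n) c x) :=
      (contMDiffOn_extChartAt_symm c).contMDiffAt htgt
    have h4 : ContMDiffAt (𝓡 n) 𝓘(ℝ, Eu n) ∞ (fun y => crepr c X (extChartAt (𝓡 n) c y))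
      (pt c (extChartAt (𝓡 n) c x)) := by rw [pt_ch hx]; exact h2
    have h5 := (h4.comp _ h3).contDiffAt
    refine h5.congr_of_eventuallyEq ?_
    filter_upwards [htgt] with z hz
    simp only [Function.comp]
    rw [ch_pt hz]
  · intro h
    exact (h.contMDiffAt.comp x (contMDiffAt_extChartAt' hx)).congr_of_eventuallyEq h1

theorem smoothFieldAt_cfield {c x : M} (hx : x ∈ chSrc n c) (w : Eu n) :
    SmoothFieldAt (cfield c w) x := by
  rw [smoothFieldAt_iff hx]
  exact contDiffAt_const.congr_of_eventuallyEq (crepr_cfield_eventuallyEq hx w)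

theorem extendVec_eventuallyEq {x : M} (v : TangentSpace (𝓡 n) x) :
    ∀ᶠ y in 𝓝 x, extendVec v y = cfield x (tc x x v) y := by
  filter_upwards [(chartAt (Eu n) x).open_source.mem_nhds (mem_chart_source _ x)] with y hy
  exact extendVec_eq_cfield v hy

theorem smoothFieldAt_extendVec {x : M} (v : TangentSpace (𝓡 n) x) :
    SmoothFieldAt (extendVec v) x := by
  refine (smoothFieldAt_cfield (mem_chart_source _ x) (tc x x v)).congr_of_eventuallyEq ?_
  filter_upwards [extendVec_eventuallyEq v] with y hy
  rw [hy]

theorem SmoothFieldAt.fieldDiffAt {X : ∀ x : M, TangentSpace (𝓡 n) x} {x : M}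
    (h : SmoothFieldAt X x) : FieldDiffAt X x := h.mdifferentiableAt (by simp)

theorem SmoothFieldAt.eventually_fieldDiffAt {X : ∀ x : M, TangentSpace (𝓡 n) x} {x : M}
    (h : SmoothFieldAt X x) : ∀ᶠ y in 𝓝 x, FieldDiffAt X y := by
  have h1 := (smoothFieldAt_iff (mem_chart_source _ x) X).1 h
  have h2 : ∀ᶠ z in 𝓝 (extChartAt (𝓡 n) x x), DifferentiableAt ℝ (crepr x X) z := by
    have h3 := (h1.of_le (m := 1) (WithTop.coe_le_coe.2 le_top)).eventually (by simp)
    filter_upwards [h3] with z hz using hz.differentiableAt (by simp)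
  have h4 := (continuousAt_extChartAt (I := 𝓡 n) x).eventually h2
  filter_upwards [h4, (chartAt (Eu n) x).open_source.mem_nhds (mem_chart_source _ x)] with y hy hy'
  exact (fieldDiffAt_iff hy' X).2 hy

variable {cov : LinearConnection n M}

/-- Smoothness of the connection is applied to globally smooth fields, while `cfield` is smooth only
on its chart. Multiplying by a bump function that is 1 near x repairs this, since covariant
derivatives are local. -/
theorem smoothFieldAt_cov [T2Space M] (hcov : cov.ContMDiffCovariantDerivative ∞) {c x : M}
    (hx : x ∈ chSrc n c) (u w : Eu n) :
    SmoothFieldAt (fun y => cov (cfield c w) y (cfield c u y)) x := by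
  obtain ⟨f, hf, -⟩ := (SmoothBumpFunction.nhds_basis_support (I := 𝓡 n)
    ((chartAt (Eu n) c).open_source.mem_nhds hx)).mem_iff.1
      ((chartAt (Eu n) c).open_source.mem_nhds hx)
  have hsm : ∀ w, ContMDiff (𝓡 n) ((𝓡 n).prod 𝓘(ℝ, Eu n)) ∞ (fun y => TotalSpace.mk' (Eu n)
      (E := (TangentSpace (𝓡 n) : M → Type _)) y (((f : M → ℝ) • cfield c w) y)) := fun w =>
    ContMDiffOn.smul_section_of_tsupport (u := chSrc n c) f.contMDiff.contMDiffOn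
      (chartAt (Eu n) c).open_source hf
      (fun y hy => (smoothFieldAt_cfield (n := n) hy w).contMDiffWithinAt)
  have h1 := hcov.contMDiff.contMDiff (σ := (f : M → ℝ) • cfield c w) (hsm w).contMDiffOn
  have h2 := ContMDiffAt.clm_bundle_apply (F₁ := Eu n) (F₂ := Eu n)
    (E₁ := (TangentSpace (𝓡 n) : M → Type _)) (E₂ := (TangentSpace (𝓡 n) : M → Type _))
    (b := fun y => y) (v := (f : M → ℝ) • cfield c u)
    (ϕ := fun y => cov ((f : M → ℝ) • cfield c w) y) (x := x) (n := ∞) (IB := 𝓡 n) (IM := 𝓡 n)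
    (h1 x (mem_univ x) |>.contMDiffAt univ_mem) (hsm u x)
  refine h2.congr_of_eventuallyEq ?_
  filter_upwards [f.eventuallyEq_one.eventuallyEq_nhds,
    (chartAt (Eu n) c).open_source.mem_nhds hx] with y hy hy'
  have e1 : ∀ w : Eu n, ((f : M → ℝ) • cfield c w) y = cfield c w y := fun w => by
    simp [hy.eq_of_nhds]
  have e2 : cov ((f : M → ℝ) • cfield c w) y = cov (cfield c w) y :=
    cov.isCovariantDerivativeOnUniv.congr_of_eventuallyEq ((hsm w y).mdifferentiableAt (by simp))
      (fieldDiffAt_cfield hy' w) Filter.univ_mem (by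
        filter_upwards [hy] with y' hy2
        simp [hy2])
  rw [e2, e1]

theorem contDiffOn_christoffel [T2Space M] (hcov : cov.ContMDiffCovariantDerivative ∞) (c : M) :
    ContDiffOn ℝ ∞ (christoffel cov c) (chTgt n c) := by
  refine contDiffOn_clm_apply.2 fun u => contDiffOn_clm_apply.2 fun w z hz => ?_
  have h := (smoothFieldAt_iff (pt_mem hz) _).1 (smoothFieldAt_cov hcov (pt_mem hz) u w)
  rw [ch_pt hz] at h
  refine (h.congr_of_eventuallyEq ?_).contDiffWithinAt
  filter_upwards [(isOpen_chTgt c).mem_nhds hz] with z' hz'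
  have := tc_cov_cfield (cov := cov) (pt_mem hz') w (cfield c u (pt c z'))
  rw [ch_pt hz', show tc c (pt c z') (cfield c u (pt c z')) = u from tc_ts (pt_mem hz') u] at this
  exact this.symm

/-- The transformation law of the Christoffel symbols, found by computing ∇ of one coordinate field
of c in both charts. The second derivative of the chart change appears as the derivative of the
components of that field in c'. -/
theorem christoffel_change {c c' x : M} (hx : x ∈ chSrc n c) (hx' : x ∈ chSrc n c')
    (u w : Eu n) :
    tc c' x (ts c x (christoffel cov c (extChartAt (𝓡 n) c x) u w)) =
      fderiv ℝ (crepr c' (cfield c w)) (extChartAt (𝓡 n) c' x) (tc c' x (ts c x u)) +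
        christoffel cov c' (extChartAt (𝓡 n) c' x) (tc c' x (ts c x u))
          (tc c' x (ts c x w)) := by
  have h1 := tc_cov_cfield (cov := cov) hx w (ts c x u)
  rw [tc_ts hx] at h1
  have h2 := tc_cov (cov := cov) hx' (fieldDiffAt_cfield hx w) (ts c x u)
  rw [← h1, ts_tc hx, h2]
  congr 2
  rw [crepr, pt_ch hx', cfield]

/-- The coordinate expression of the curvature tensor of a connection with Christoffel
symbols `Γ`. -/
def coordCurvature {E : Type*} [NormedAddCommGroup E] [NormedSpace ℝ E]
    (Γ : E → E →L[ℝ] E →L[ℝ] E) (z u v w : E) : E :=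
  fderiv ℝ Γ z u v w - fderiv ℝ Γ z v u w + Γ z u (Γ z v w) - Γ z v (Γ z u w)

theorem tc_cov_cov [T2Space M] (hcov : cov.ContMDiffCovariantDerivative ∞) {c x : M}
    (hx : x ∈ chSrc n c) {V W : ∀ x : M, TangentSpace (𝓡 n) x}
    (hV : SmoothFieldAt V x) (hW : SmoothFieldAt W x) (u : TangentSpace (𝓡 n) x) (z u' : Eu n)
    (hz : z = extChartAt (𝓡 n) c x) (hu : u' = tc c x u) :
    tc c x (cov (fun y => cov W y (V y)) x u) =
      fderiv ℝ (fderiv ℝ (crepr c W)) z u' (crepr c V z) +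
      fderiv ℝ (crepr c W) z (fderiv ℝ (crepr c V) z u') +
      fderiv ℝ (christoffel cov c) z u' (crepr c V z) (crepr c W z) +
      christoffel cov c z (fderiv ℝ (crepr c V) z u') (crepr c W z) +
      christoffel cov c z (crepr c V z) (fderiv ℝ (crepr c W) z u') +
      christoffel cov c z u' (fderiv ℝ (crepr c W) z (crepr c V z)) +
      christoffel cov c z u' (christoffel cov c z (crepr c V z) (crepr c W z)) := by
  subst hz hu
  set z := extChartAt (𝓡 n) c x with hzdef
  have hz : z ∈ chTgt n c := ch_mem hx
  have hΓ : ContDiffAt ℝ ∞ (christoffel cov c) z :=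
    (contDiffOn_christoffel hcov c).contDiffAt ((isOpen_chTgt c).mem_nhds hz)
  have hV' : ContDiffAt ℝ ∞ (crepr c V) z := (smoothFieldAt_iff hx V).1 hV
  have hW' : ContDiffAt ℝ ∞ (crepr c W) z := (smoothFieldAt_iff hx W).1 hW
  have hev : crepr c (fun y => cov W y (V y)) =ᶠ[𝓝 z] fun z =>
      fderiv ℝ (crepr c W) z (crepr c V z) + christoffel cov c z (crepr c V z) (crepr c W z) := by
    have h1 : ContinuousAt (pt (n := n) c) z := (mdifferentiableAt_pt hz).continuousAt
    have h2 : pt c z = x := pt_ch hx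
    have h3 := h1.eventually (by rw [h2]; exact hW.eventually_fieldDiffAt)
    filter_upwards [(isOpen_chTgt c).mem_nhds hz, h3] with z' hz' hW'
    have := tc_cov (cov := cov) (pt_mem hz') hW' (V (pt c z'))
    rw [ch_pt hz'] at this
    exact this
  have dW : ContDiffAt ℝ ∞ (fderiv ℝ (crepr c W)) z := hW'.fderiv_right (by simp)
  have dW1 := (dW.differentiableAt (by simp)).hasFDerivAt
  have dV1 := (hV'.differentiableAt (by simp)).hasFDerivAt
  have dW0 := (hW'.differentiableAt (by simp)).hasFDerivAt
  have dΓ := (hΓ.differentiableAt (by simp)).hasFDerivAt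
  have hd := (dW1.clm_apply dV1).add ((dΓ.clm_apply dV1).clm_apply dW0)
  have hd' := hd.congr_of_eventuallyEq hev
  have hfd : FieldDiffAt (fun y => cov W y (V y)) x := (fieldDiffAt_iff hx _).2 hd'.differentiableAt
  rw [tc_cov hx hfd, ← hzdef, hd'.fderiv, hev.eq_of_nhds]
  simp only [add_apply, ContinuousLinearMap.comp_apply, ContinuousLinearMap.flip_apply, map_add]
  abel

/-- The second derivatives of the components of the extension of w cancel by symmetry, and all first
derivatives of the extensions cancel against each other and against the bracket term. What remains
is tensorial, so every chart containing x may be used, not only the one in which the extensions are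
constant. -/
theorem tc_curvature [T2Space M] (hcov : cov.ContMDiffCovariantDerivative ∞) {c x : M}
    (hx : x ∈ chSrc n c) (u v w : TangentSpace (𝓡 n) x) :
    tc c x (curvature cov x u v w) =
      coordCurvature (christoffel cov c) (extChartAt (𝓡 n) c x) (tc c x u) (tc c x v)
        (tc c x w) := by
  set z := extChartAt (𝓡 n) c x with hzdef
  have hs := fun v : TangentSpace (𝓡 n) x => smoothFieldAt_extendVec v
  have hv : ∀ v : TangentSpace (𝓡 n) x, crepr c (extendVec v) z = tc c x v := fun v => by
    rw [crepr, pt_ch hx, extendVec, FiberBundle.extend_apply_self]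
  have hW := (smoothFieldAt_iff hx _).1 (hs w)
  have hsymm : ∀ a b, fderiv ℝ (fderiv ℝ (crepr c (extendVec w))) z a b =
      fderiv ℝ (fderiv ℝ (crepr c (extendVec w))) z b a := fun a b =>
    (hW.isSymmSndFDerivAt (by simp; exact WithTop.coe_le_coe.2 (le_top (a := (2 : ℕ∞))))).eq a b
  have hb := tc_mlieBracket hx (hs u).fieldDiffAt (hs v).fieldDiffAt
  rw [extendVec, extendVec, FiberBundle.extend_apply_self, FiberBundle.extend_apply_self] at hb
  rw [curvature, map_sub, map_sub,
    tc_cov_cov hcov hx (hs v) (hs w) u z (tc c x u) rfl rfl,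
    tc_cov_cov hcov hx (hs u) (hs w) v z (tc c x v) rfl rfl,
    tc_cov hx (hs w).fieldDiffAt, hb, ← hzdef]
  simp only [hv, map_sub, sub_apply]
  rw [hsymm (tc c x v) (tc c x u), coordCurvature]
  abel

end Connection

/-! ### Curvature identities from symmetry of second derivatives -/

section CoordinateCurvature

set_option synthInstance.maxHeartbeats 200000

variable {E : Type*} [NormedAddCommGroup E] [NormedSpace ℝ E]
  {Γ : E → E →L[ℝ] E →L[ℝ] E} {g : E → E →L[ℝ] E →L[ℝ] ℝ} {θ : E → E →L[ℝ] ℝ} {ξ : E → E} {z : E}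

theorem coordCurvature_swap (u v w : E) : coordCurvature Γ z u v w = -coordCurvature Γ z v u w := by
  simp only [coordCurvature]
  abel

theorem coordCurvature_add_right (u v w w' : E) :
    coordCurvature Γ z u v (w + w') = coordCurvature Γ z u v w + coordCurvature Γ z u v w' := by
  simp only [coordCurvature, map_add]
  abel

theorem coordCurvature_smul_right (u v w : E) (r : ℝ) :
    coordCurvature Γ z u v (r • w) = r • coordCurvature Γ z u v w := by
  simp only [coordCurvature, map_smul, smul_add, smul_sub]

theorem coordCurvature_add_left (u u' v w : E) :
    coordCurvature Γ z (u + u') v w = coordCurvature Γ z u v w + coordCurvature Γ z u' v w := by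
  simp only [coordCurvature, map_add, add_apply]
  abel

theorem coordCurvature_smul_left (u v w : E) (r : ℝ) :
    coordCurvature Γ z (r • u) v w = r • coordCurvature Γ z u v w := by
  simp only [coordCurvature, map_smul, smul_apply, smul_add, smul_sub]

theorem fderiv_fderiv_comm {F : Type*} [NormedAddCommGroup F] [NormedSpace ℝ F] {f : E → F}
    (hf : ContDiffAt ℝ ∞ f z) (u v : E) :
    fderiv ℝ (fderiv ℝ f) z u v = fderiv ℝ (fderiv ℝ f) z v u :=
  (hf.isSymmSndFDerivAt (by simp; exact WithTop.coe_le_coe.2 (le_top (a := (2 : ℕ∞))))).eq u v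

theorem hasFDerivAt_fderiv_apply {F : Type*} [NormedAddCommGroup F] [NormedSpace ℝ F] {f : E → F}
    (hf : ContDiffAt ℝ ∞ f z) (u : E) :
    HasFDerivAt (fun z => fderiv ℝ f z u) ((fderiv ℝ (fderiv ℝ f) z).flip u) z := by
  have h : ContDiffAt ℝ ∞ (fderiv ℝ f) z := hf.fderiv_right (by simp)
  simpa using (h.differentiableAt (by simp)).hasFDerivAt.clm_apply (hasFDerivAt_const u z)

theorem hasDerivAt_line {F : Type*} [NormedAddCommGroup F] [NormedSpace ℝ F] {f : E → F}
    (hf : DifferentiableAt ℝ f z) (v : E) :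
    HasDerivAt (fun t : ℝ => f (z + t • v)) (fderiv ℝ f z v) 0 := by
  have hl : HasDerivAt (fun t : ℝ => z + t • v) v 0 := by
    simpa using ((hasDerivAt_id (0 : ℝ)).smul_const v).const_add z
  exact HasFDerivAt.comp_hasDerivAt (0 : ℝ) (f := fun t : ℝ => z + t • v) (l := f)
    (by simpa using hf.hasFDerivAt) hl

theorem exists_hasDerivAt_line {F : Type*} [NormedAddCommGroup F] [NormedSpace ℝ F] {f : E → F}
    (hf : ContDiffAt ℝ ∞ f z) (v : E) : ∃ f' : F, HasDerivAt (fun t : ℝ => f (z + t • v)) f' 0 :=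
  ⟨_, hasDerivAt_line (hf.differentiableAt (by simp)) v⟩

/-- Differentiate ∇g = 0 once more: the second derivative of g(a,b) is symmetric in the two
directions, and its antisymmetric part is g(R a, b) + g(a, R b). -/
theorem coordCurvature_skew (hΓ : ContDiffAt ℝ ∞ Γ z) (hg : ContDiffAt ℝ ∞ g z)
    (h : ∀ᶠ z in 𝓝 z, ∀ u a b,
      fderiv ℝ (fun z => g z a b) z u = g z (Γ z u a) b + g z a (Γ z u b))
    (u v a b : E) :
    g z (coordCurvature Γ z u v a) b = -g z a (coordCurvature Γ z u v b) := by
  have hz : ∀ v, z + (0 : ℝ) • v = z := fun v => by simp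
  have dΓ := fun v => hasDerivAt_line (hΓ.differentiableAt (by simp)) v
  have dΓ' : ∀ v u a, HasDerivAt (fun t : ℝ => Γ (z + t • v) u a) (fderiv ℝ Γ z v u a) 0 :=
    fun v u a => by
      have := ((dΓ v).clm_apply (hasDerivAt_const 0 u)).clm_apply (hasDerivAt_const 0 a)
      simpa only [map_zero, add_zero] using this
  have hgab : ∀ a b, ContDiffAt ℝ ∞ (fun z => g z a b) z := fun a b =>
    (hg.clm_apply contDiffAt_const).clm_apply contDiffAt_const
  have dg : ∀ v, ∃ g' : E →L[ℝ] E →L[ℝ] ℝ, HasDerivAt (fun t : ℝ => g (z + t • v)) g' 0 ∧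
      ∀ a b, g' a b = g z (Γ z v a) b + g z a (Γ z v b) := fun v => by
    obtain ⟨g', h1⟩ := exists_hasDerivAt_line hg v
    refine ⟨g', h1, fun a b => ?_⟩
    have h2 := (h1.clm_apply (hasDerivAt_const 0 a)).clm_apply (hasDerivAt_const 0 b)
    have h4 := h2.unique (hasDerivAt_line ((hgab a b).differentiableAt (by simp)) v)
    rw [h.self_of_nhds] at h4
    simpa only [map_zero, add_zero] using h4
  have key : ∀ u v, fderiv ℝ (fderiv ℝ (fun z => g z a b)) z v u =
      g z (Γ z v (Γ z u a)) b + g z (Γ z u a) (Γ z v b) + g z (fderiv ℝ Γ z v u a) b +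
      g z (Γ z v a) (Γ z u b) + g z a (Γ z v (Γ z u b)) + g z a (fderiv ℝ Γ z v u b) := by
    intro u v
    obtain ⟨g', hg', hg'e⟩ := dg v
    have h1 := hasDerivAt_line (hasFDerivAt_fderiv_apply (hgab a b) u).differentiableAt v
    rw [(hasFDerivAt_fderiv_apply (hgab a b) u).fderiv, ContinuousLinearMap.flip_apply] at h1
    have h2 := ((hg'.clm_apply (dΓ' v u a)).clm_apply (hasDerivAt_const 0 b)).add
        ((hg'.clm_apply (hasDerivAt_const 0 a)).clm_apply (dΓ' v u b))
    have hc : Tendsto (fun t : ℝ => z + t • v) (𝓝 0) (𝓝 z) := by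
      have := (hasDerivAt_line (f := id) (z := z) differentiableAt_id v).continuousAt.tendsto
      simpa only [id, hz] using this
    have h3 := h1.unique (h2.congr_of_eventuallyEq ((hc.eventually h).mono fun t ht => ht u a b))
    simp only [add_apply, map_zero, add_zero, hz, hg'e] at h3
    rw [h3]
    ring
  have h1 := key u v
  have h2 := key v u
  rw [fderiv_fderiv_comm (hgab a b)] at h1
  simp only [coordCurvature, map_sub, map_add, sub_apply, add_apply]
  linarith

/-- The curvature is the integrability obstruction for Dξ = -Γξ, and it vanishes on ξ because D²ξ is
symmetric. -/
theorem coordCurvature_parallel (hΓ : ContDiffAt ℝ ∞ Γ z) (hξ : ContDiffAt ℝ ∞ ξ z)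
    (h : ∀ᶠ z in 𝓝 z, ∀ u, fderiv ℝ ξ z u = -Γ z u (ξ z)) (u v : E) :
    coordCurvature Γ z u v (ξ z) = 0 := by
  have dΓ := (hΓ.differentiableAt (by simp)).hasFDerivAt
  have dξ := (hξ.differentiableAt (by simp)).hasFDerivAt
  have key : ∀ u v, fderiv ℝ (fderiv ℝ ξ) z v u =
      -fderiv ℝ Γ z v u (ξ z) + Γ z u (Γ z v (ξ z)) := by
    intro u v
    have h2 : HasFDerivAt (fun z => -Γ z u (ξ z)) _ z :=
      ((dΓ.clm_apply (hasFDerivAt_const u z)).clm_apply dξ).neg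
    have h3 := (hasFDerivAt_fderiv_apply hξ u).unique
      (h2.congr_of_eventuallyEq (h.mono fun z hz => hz u))
    have h4 := DFunLike.congr_fun h3 v
    simp only [add_apply, ContinuousLinearMap.comp_apply, ContinuousLinearMap.flip_apply,
      zero_apply, map_zero, zero_add, neg_apply] at h4
    rw [h4, h.self_of_nhds, map_neg]
    abel
  have h1 := key u v
  have h2 := key v u
  rw [fderiv_fderiv_comm hξ] at h1
  have h3 := h2.symm.trans h1
  rw [coordCurvature, ← sub_eq_zero.2 h3.symm]
  abel

/-- Differentiate the torsion identity. Since ξ is parallel, its derivative combines with the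
quadratic terms of the curvature so that these cancel, and the cyclic sum reduces to d(dθ) ξ, zero
by symmetry of D²θ. -/
theorem coordCurvature_bianchi (hΓ : ContDiffAt ℝ ∞ Γ z) (hξ : ContDiffAt ℝ ∞ ξ z)
    (hθ : ContDiffAt ℝ ∞ θ z) (h : ∀ᶠ z in 𝓝 z, ∀ u, fderiv ℝ ξ z u = -Γ z u (ξ z))
    (hT : ∀ᶠ z in 𝓝 z, ∀ u v, Γ z u v - Γ z v u = (fderiv ℝ θ z u v - fderiv ℝ θ z v u) • ξ z)
    (u v w : E) :
    coordCurvature Γ z u v w + coordCurvature Γ z v w u + coordCurvature Γ z w u v = 0 := by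
  have dΓ := (hΓ.differentiableAt (by simp)).hasFDerivAt
  have dξ := (hξ.differentiableAt (by simp)).hasFDerivAt
  have hu : ∀ u a, HasFDerivAt (fun z => Γ z u a) (((fderiv ℝ Γ z).flip u).flip a) z :=
    fun u a => by
      simpa using (dΓ.clm_apply (hasFDerivAt_const u z)).clm_apply (hasFDerivAt_const a z)
  have hω : ∀ u a, HasFDerivAt (fun z => fderiv ℝ θ z u a)
      (((fderiv ℝ (fderiv ℝ θ) z).flip u).flip a) z := fun u a => by
    simpa using (hasFDerivAt_fderiv_apply hθ u).clm_apply (hasFDerivAt_const a z)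
  have key : ∀ u v w, fderiv ℝ Γ z u v w - fderiv ℝ Γ z u w v =
      (fderiv ℝ (fderiv ℝ θ) z u v w - fderiv ℝ (fderiv ℝ θ) z u w v) • ξ z
        - Γ z u (Γ z v w - Γ z w v) := by
    intro u v w
    have h1 : HasFDerivAt (fun z => Γ z v w - Γ z w v) _ z := (hu v w).sub (hu w v)
    have h2 := ((hω v w).sub (hω w v)).smul dξ
    have h3 := h1.unique (h2.congr_of_eventuallyEq (hT.mono fun z hz => hz v w))
    have h4 := DFunLike.congr_fun h3 u
    simp only [add_apply, sub_apply, smul_apply, ContinuousLinearMap.smulRight_apply,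
      ContinuousLinearMap.flip_apply, Pi.sub_apply] at h4
    rw [h4, hT.self_of_nhds, h.self_of_nhds, map_smul, smul_neg]
    abel
  have e : coordCurvature Γ z u v w + coordCurvature Γ z v w u + coordCurvature Γ z w u v =
      (fderiv ℝ Γ z u v w - fderiv ℝ Γ z u w v) + Γ z u (Γ z v w - Γ z w v) +
      ((fderiv ℝ Γ z v w u - fderiv ℝ Γ z v u w) + Γ z v (Γ z w u - Γ z u w)) +
      ((fderiv ℝ Γ z w u v - fderiv ℝ Γ z w v u) + Γ z w (Γ z u v - Γ z v u)) := by
    simp only [coordCurvature, map_sub]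
    abel
  rw [e, key, key, key, fderiv_fderiv_comm hθ v u, fderiv_fderiv_comm hθ w u,
    fderiv_fderiv_comm hθ w v]
  module

/-- Pair symmetry of a curvature-like tensor. -/
theorem pair_symm_of_bianchi {V : Type*} {r : V → V → V → V → ℝ}
    (h1 : ∀ a b c d, r a b c d = -r b a c d) (h2 : ∀ a b c d, r a b c d = -r a b d c)
    (h3 : ∀ a b c d, r a b c d + r b c a d + r c a b d = 0) (a b c d : V) :
    r a b c d = r c d a b := by
  have e1 := h3 a b c d
  have e2 := h3 b c d a
  have e3 := h3 c d a b
  have e4 := h3 d a b c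
  have := h1 c a b d
  have := h1 d b c a
  have := h1 a c d b
  have := h1 b d a c
  have := h2 a b c d
  have := h2 b c d a
  have := h2 c d a b
  have := h2 d a b c
  have := h2 a c b d
  have := h2 b d c a
  linarith

end CoordinateCurvature

/-! ### Velocity, covariant derivative and parallel transport along a curve -/

section Curves

variable {n : ℕ} {M : Type*} [TopologicalSpace M] [ChartedSpace (EuclideanSpace ℝ (Fin n)) M]

theorem ContinuousWithinAt.eventually_chSrc {γ : ℝ → M} {s : Set ℝ} {t : ℝ} {c : M}
    (h : ContinuousWithinAt γ s t) (hc : γ t ∈ chSrc n c) : ∀ᶠ r in 𝓝[s] t, γ r ∈ chSrc n c :=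
  h.eventually ((chartAt (Eu n) c).open_source.mem_nhds hc)

theorem exists_forall_mem_chSrc {γ : ℝ → M} {a b t : ℝ} (hγ : ContinuousOn γ (Icc a b)) (ht : t ∈ Icc a b)
    {c : M} (hc : γ t ∈ chSrc n c) :
    ∃ ε > 0, ∀ r ∈ Icc a b, |r - t| < ε → γ r ∈ chSrc n c := by
  have := (hγ t ht).eventually_chSrc hc
  rw [eventually_nhdsWithin_iff] at this
  obtain ⟨ε, hε, h⟩ := Metric.eventually_nhds_iff.1 this
  exact ⟨ε, hε, fun r hr hrt => h (by rwa [Real.dist_eq]) hr⟩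

variable [IsManifold (𝓡 n) ∞ M]

theorem sum_smul_single (v : Eu n) :
    ∑ i, v i • EuclideanSpace.single i (1 : ℝ) = v := by
  ext j
  simp [Finset.sum_apply, Pi.single_apply]

theorem HasFDerivAt.along {F G : Type*} [NormedAddCommGroup F] [NormedSpace ℝ F]
    [NormedAddCommGroup G] [NormedSpace ℝ G] {l : F → G} {l' : F →L[ℝ] G} {f : ℝ → F} {f' : F}
    {s : Set ℝ} {t : ℝ} (hl : HasFDerivAt l l' (f t)) (hf : HasDerivWithinAt f f' s t) :
    HasDerivWithinAt (fun r => l (f r)) (l' f') s t :=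
  hl.comp_hasDerivWithinAt t hf

theorem hasFDerivAt_chart_change {c c' x : M} (hx : x ∈ chSrc n c) (hx' : x ∈ chSrc n c') :
    HasFDerivAt (fun z => extChartAt (𝓡 n) c' (pt c z)) ((tc c' x).comp (ts c x))
      (extChartAt (𝓡 n) c x) := by
  have h1 : HasMFDerivAt 𝓘(ℝ, Eu n) (𝓡 n) (pt c) (extChartAt (𝓡 n) c x) (ts c x) := by
    have := (mdifferentiableAt_pt (ch_mem hx)).hasMFDerivAt
    rw [mfderiv_pt (ch_mem hx), pt_ch hx] at this
    exact this
  have h2 : HasMFDerivAt (𝓡 n) 𝓘(ℝ, Eu n) (extChartAt (𝓡 n) c')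
      (pt c (extChartAt (𝓡 n) c x)) (tc c' x) := by
    rw [pt_ch hx, tc_eq_mfderiv hx']
    exact (mdifferentiableAt_extChartAt hx').hasMFDerivAt
  exact (h2.comp _ h1).hasFDerivAt

/-- `U t` is the velocity at time `t` of the curve `γ` on `s`. -/
def HasVelocityAt (γ : ℝ → M) (U : ∀ t, TangentSpace (𝓡 n) (γ t)) (s : Set ℝ) (t : ℝ) : Prop :=
  ContinuousWithinAt γ s t ∧ ∀ c, γ t ∈ chSrc n c →
    HasDerivWithinAt (fun r => extChartAt (𝓡 n) c (γ r)) (tc c (γ t) (U t)) s t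

/-- The covariant derivative at time `t` of the vector field `V` along the curve `γ` with
velocity `U` is `D t`. -/
def HasCovDerivAt (cov : LinearConnection n M) (γ : ℝ → M)
    (U V D : ∀ t, TangentSpace (𝓡 n) (γ t)) (s : Set ℝ) (t : ℝ) : Prop :=
  ∀ c, γ t ∈ chSrc n c → HasDerivWithinAt (fun r => tc c (γ r) (V r))
    (tc c (γ t) (D t) - christoffel cov c (extChartAt (𝓡 n) c (γ t)) (tc c (γ t) (U t))
      (tc c (γ t) (V t))) s t

variable {γ : ℝ → M} {U V W D D' : ∀ t, TangentSpace (𝓡 n) (γ t)} {s s' : Set ℝ} {t : ℝ}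
  {cov : LinearConnection n M}

/-- `HasVelocityAt` quantifies over all charts, which is convenient to use. By the chain rule for
the chart change, one chart is enough to verify it. -/
theorem HasVelocityAt.of_chart {c : M} (hcont : ContinuousWithinAt γ s t) (hc : γ t ∈ chSrc n c)
    (h : HasDerivWithinAt (fun r => extChartAt (𝓡 n) c (γ r)) (tc c (γ t) (U t)) s t) :
    HasVelocityAt γ U s t := by
  refine ⟨hcont, fun c' hc' => ?_⟩
  have h1 := (hasFDerivAt_chart_change hc hc').along h
  rw [ContinuousLinearMap.comp_apply, ts_tc hc] at h1
  refine h1.congr_of_eventuallyEq ?_ ?_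
  · filter_upwards [hcont.eventually_chSrc hc] with r hr
    rw [pt_ch hr]
  · rw [pt_ch hc]

theorem HasVelocityAt.mono (h : HasVelocityAt γ U s t) (hs : s ∈ 𝓝[s'] t) :
    HasVelocityAt γ U s' t :=
  ⟨h.1.mono_of_mem_nhdsWithin hs, fun c hc => (h.2 c hc).mono_of_mem_nhdsWithin hs⟩

theorem HasCovDerivAt.mono (h : HasCovDerivAt cov γ U V D s t) (hs : s ∈ 𝓝[s'] t) :
    HasCovDerivAt cov γ U V D s' t :=
  fun c hc => (h c hc).mono_of_mem_nhdsWithin hs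

/-- Independence of the chart: expand V in the coordinate fields of c, differentiate their
components in c' along γ, and insert `christoffel_change`; the inhomogeneous terms cancel. -/
theorem HasCovDerivAt.of_chart {c : M} (hU : HasVelocityAt γ U s t) (hc : γ t ∈ chSrc n c)
    (h : HasDerivWithinAt (fun r => tc c (γ r) (V r))
      (tc c (γ t) (D t) - christoffel cov c (extChartAt (𝓡 n) c (γ t)) (tc c (γ t) (U t))
        (tc c (γ t) (V t))) s t) : HasCovDerivAt cov γ U V D s t := by
  intro c' hc'
  set σ : Fin n → ∀ x : M, TangentSpace (𝓡 n) x := fun i =>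
    cfield c (EuclideanSpace.single i (1 : ℝ)) with hσ
  have hσ' : ∀ i, HasDerivWithinAt (fun r => crepr c' (σ i) (extChartAt (𝓡 n) c' (γ r)))
      (fderiv ℝ (crepr c' (σ i)) (extChartAt (𝓡 n) c' (γ t)) (tc c' (γ t) (U t))) s t := fun i =>
    ((fieldDiffAt_iff hc' _).1 (fieldDiffAt_cfield hc _)).hasFDerivAt.along (hU.2 c' hc')
  have hvi : ∀ i, HasDerivWithinAt (fun r => tc c (γ r) (V r) i) _ s t := fun i =>
    (EuclideanSpace.proj (𝕜 := ℝ) i).hasFDerivAt.along h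
  have hsum := HasDerivWithinAt.fun_sum (u := Finset.univ) fun i _ => (hvi i).smul (hσ' i)
  have hexp : ∀ r, γ r ∈ chSrc n c → γ r ∈ chSrc n c' → ∀ v : Eu n,
      ∑ i, v i • crepr c' (σ i) (extChartAt (𝓡 n) c' (γ r)) =
        tc c' (γ r) (ts c (γ r) v) := fun r hr hr' v => by
    conv_rhs => rw [← sum_smul_single v, map_sum, map_sum]
    refine Finset.sum_congr rfl fun i _ => ?_
    rw [map_smul, map_smul, crepr, pt_ch hr']
    rfl
  have heq : ∀ r, γ r ∈ chSrc n c → γ r ∈ chSrc n c' → tc c' (γ r) (V r) =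
      ∑ i, tc c (γ r) (V r) i • crepr c' (σ i) (extChartAt (𝓡 n) c' (γ r)) :=
    fun r hr hr' => by rw [hexp r hr hr', ts_tc hr]
  have h2 := hsum.congr_of_eventuallyEq (f₁ := fun r => tc c' (γ r) (V r)) (by
    filter_upwards [hU.1.eventually_chSrc hc, hU.1.eventually_chSrc hc'] with r hr hr'
    exact heq r hr hr') (heq t hc hc')
  refine h2.congr_deriv ?_
  symm
  rw [Finset.sum_add_distrib]
  have e1 := hexp t hc hc' (tc c (γ t) (D t) - christoffel cov c (extChartAt (𝓡 n) c (γ t))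
    (tc c (γ t) (U t)) (tc c (γ t) (V t)))
  have e2 : ∀ i, fderiv ℝ (crepr c' (σ i)) (extChartAt (𝓡 n) c' (γ t)) (tc c' (γ t) (U t)) =
      tc c' (γ t) (ts c (γ t) (christoffel cov c (extChartAt (𝓡 n) c (γ t)) (tc c (γ t) (U t))
        (EuclideanSpace.single i 1))) - christoffel cov c' (extChartAt (𝓡 n) c' (γ t))
          (tc c' (γ t) (U t)) (tc c' (γ t) (ts c (γ t) (EuclideanSpace.single i 1))) := fun i => by
    rw [christoffel_change hc hc', ts_tc hc]
    abel
  have e3 : ∑ i, tc c (γ t) (V t) i • fderiv ℝ (crepr c' (σ i)) (extChartAt (𝓡 n) c' (γ t))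
      (tc c' (γ t) (U t)) =
      tc c' (γ t) (ts c (γ t) (christoffel cov c (extChartAt (𝓡 n) c (γ t)) (tc c (γ t) (U t))
        (tc c (γ t) (V t)))) - christoffel cov c' (extChartAt (𝓡 n) c' (γ t))
          (tc c' (γ t) (U t)) (tc c' (γ t) (V t)) := by
    simp only [e2, smul_sub, Finset.sum_sub_distrib, ← map_smul, ← map_sum, sum_smul_single]
    rw [ts_tc hc]
  refine Eq.trans ?_ (congrArg₂ (· + ·) e3.symm e1.symm)
  simp only [map_sub]
  rw [ts_tc hc]
  abel

theorem HasCovDerivAt.add (hV : HasCovDerivAt cov γ U V D s t)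
    (hW : HasCovDerivAt cov γ U W D' s t) :
    HasCovDerivAt cov γ U (fun r => V r + W r) (fun r => D r + D' r) s t := by
  intro c hc
  have := (hV c hc).fun_add (hW c hc)
  simp only [← map_add] at this
  refine this.congr_deriv ?_
  simp only [map_add]
  abel

theorem HasCovDerivAt.fsmul {f : ℝ → ℝ} {f' : ℝ} (hV : HasCovDerivAt cov γ U V D s t)
    (hf : HasDerivWithinAt f f' s t) :
    HasCovDerivAt cov γ U (fun r => f r • V r) (fun r => f' • V r + f r • D r) s t := by
  intro c hc
  have := hf.fun_smul (hV c hc)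
  simp only [← map_smul] at this
  refine this.congr_deriv ?_
  simp only [map_add, map_smul, smul_sub]
  abel

theorem HasCovDerivAt.sum {ι : Type*} (I : Finset ι) {V D : ι → ∀ t, TangentSpace (𝓡 n) (γ t)}
    (hV : ∀ i, HasCovDerivAt cov γ U (V i) (D i) s t) :
    HasCovDerivAt cov γ U (fun r => ∑ i ∈ I, V i r) (fun r => ∑ i ∈ I, D i r) s t := by
  intro c hc
  have := HasDerivWithinAt.fun_sum (u := I) fun i _ => hV i c hc
  simp only [← map_sum] at this
  refine this.congr_deriv ?_
  simp only [map_sum, Finset.sum_sub_distrib]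

theorem HasVelocityAt.hasCovDerivAt_section (hU : HasVelocityAt γ U s t)
    {X : ∀ x : M, TangentSpace (𝓡 n) x} (hX : FieldDiffAt X (γ t)) :
    HasCovDerivAt cov γ U (fun r => X (γ r)) (fun r => cov X (γ r) (U r)) s t := by
  intro c hc
  have h1 := ((fieldDiffAt_iff hc X).1 hX).hasFDerivAt.along (hU.2 c hc)
  have e : ∀ r, γ r ∈ chSrc n c →
      tc c (γ r) (X (γ r)) = crepr c X (extChartAt (𝓡 n) c (γ r)) := fun r hr => by
    rw [crepr, pt_ch hr]
  have h2 := h1.congr_of_eventuallyEq (f₁ := fun r => tc c (γ r) (X (γ r))) (by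
    filter_upwards [hU.1.eventually_chSrc hc] with r hr using e r hr) (e t hc)
  refine h2.congr_deriv ?_
  rw [tc_cov hc hX, e t hc]
  abel

theorem abs_sub_lt_of_mem_Icc {r s t x ε : ℝ} (hr : |r - t| < ε) (hs : |s - t| < ε)
    (hx : x ∈ Icc r s) : |x - t| < ε := by
  rw [abs_lt] at *
  constructor <;> linarith [hx.1, hx.2]

theorem Icc_mem_nhdsWithin_of_subset {a b a' b' : ℝ} (h : Icc a' b' ⊆ Icc a b) :
    Icc a b ∈ 𝓝[Icc a' b'] t := mem_of_superset self_mem_nhdsWithin h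

theorem HasCovDerivAt.glue {a r b : ℝ} (har : a ≤ r) (hrb : r ≤ b)
    (hV : ∀ t ∈ Icc a r, HasCovDerivAt cov γ U V D (Icc a r) t)
    (hW : ∀ t ∈ Icc r b, HasCovDerivAt cov γ U W D (Icc r b) t) (h : V r = W r) :
    ∀ t ∈ Icc a b, HasCovDerivAt cov γ U (glueAt r V W) D (Icc a b) t := by
  refine glueAt_local (fun f S t => HasCovDerivAt cov γ U f D S t) ?_ ?_ ?_ har hrb hV hW h
  · intro f g S t ht hfg hf c hc
    have := (hf c hc).congr (f₁ := fun r => tc c (γ r) (g r))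
      (fun u hu => by rw [hfg u hu]) (by rw [hfg t ht])
    rwa [hfg t ht] at this
  · intro f S S' t hS hf
    exact hf.mono hS
  · intro f S S' t hf hf' c hc
    exact (hf c hc).union (hf' c hc)

/-- In one chart a parallel field solves a linear ODE, so it exists for as long as γ stays in the
chart. Such pieces are glued along the interval. -/
theorem exists_parallel [T2Space M] (hcov : cov.ContMDiffCovariantDerivative ∞) {a b : ℝ}
    (hab : a ≤ b) (hU : ∀ t ∈ Icc a b, HasVelocityAt γ U (Icc a b) t)
    (hUc : ∀ c, ContinuousOn (fun r => tc c (γ r) (U r)) (Icc a b ∩ γ ⁻¹' chSrc n c))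
    (v : TangentSpace (𝓡 n) (γ a)) :
    ∃ V : ∀ t, TangentSpace (𝓡 n) (γ t), V a = v ∧
      ∀ t ∈ Icc a b, HasCovDerivAt cov γ U V (fun _ => 0) (Icc a b) t := by
  refine Icc_induction (P := fun τ => ∃ V : ∀ t, TangentSpace (𝓡 n) (γ t), V a = v ∧
      ∀ t ∈ Icc a τ, HasCovDerivAt cov γ U V (fun _ => 0) (Icc a τ) t) hab ?_ ?_
  · refine ⟨fun t => ts (γ a) (γ t) (tc (γ a) (γ a) v), ts_tc (mem_chart_source _ _) _, ?_⟩
    intro t _ c _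
    rw [Icc_self]
    exact HasFDerivWithinAt.of_subsingleton subsingleton_singleton
  · intro t ht
    have hγ : ContinuousOn γ (Icc a b) := fun t ht => (hU t ht).1
    obtain ⟨ε, hε, hsrc⟩ := exists_forall_mem_chSrc hγ ht (mem_chart_source (Eu n) (γ t))
    refine ⟨ε, hε, ?_⟩
    rintro r hr s hs hrs hrt hst ⟨V, hVa, hV⟩
    set c := γ t
    have hsub : Icc r s ⊆ Icc a b := Icc_subset_Icc hr.1 hs.2
    have hmem : ∀ x ∈ Icc r s, γ x ∈ chSrc n c := fun x hx =>
      hsrc x (hsub hx) (abs_sub_lt_of_mem_Icc hrt hst hx)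
    have hA : ContinuousOn (fun x => -christoffel cov c (extChartAt (𝓡 n) c (γ x))
        (tc c (γ x) (U x))) (Icc r s) := by
      refine ContinuousOn.neg (ContinuousOn.clm_apply ?_ ((hUc c).mono fun x hx =>
        ⟨hsub hx, hmem x hx⟩))
      refine ContinuousOn.comp (g := christoffel cov c)
        (contDiffOn_christoffel hcov c).continuousOn (t := chTgt n c) ?_
        fun x hx => ch_mem (hmem x hx)
      exact fun x hx => ((hU x (hsub hx)).2 c (hmem x hx)).continuousWithinAt.mono hsub
    obtain ⟨K, hK⟩ := lipschitzWith_clm_of_continuousOn hA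
    obtain ⟨w, hw0, hw⟩ := exists_ode_solution (f := fun x => ⇑(-christoffel cov c
      (extChartAt (𝓡 n) c (γ x)) (tc c (γ x) (U x)))) hrs hK
      (fun x => hA.clm_apply continuousOn_const) (tc c (γ r) (V r))
    have hr' : γ r ∈ chSrc n c := hmem r ⟨le_rfl, hrs⟩
    have hW : ∀ x ∈ Icc r s, HasCovDerivAt cov γ U (fun x => ts c (γ x) (w x)) (fun _ => 0)
        (Icc r s) x := by
      intro x hx
      refine HasCovDerivAt.of_chart ((hU x (hsub hx)).mono (Icc_mem_nhdsWithin_of_subset hsub))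
        (hmem x hx) ?_
      rw [tc_ts (hmem x hx), map_zero, zero_sub]
      refine (hw x hx).congr (fun y hy => tc_ts (hmem y hy) _) (tc_ts (hmem x hx) _)
    refine ⟨glueAt r V (fun x => ts c (γ x) (w x)), ?_, HasCovDerivAt.glue hr.1 hrs hV hW ?_⟩
    · rw [glueAt_of_le hr.1, hVa]
    · rw [hw0, ts_tc hr']

end Curves

/-! ### Geodesics in the sense of the definition and in coordinates -/

section Geodesics

theorem contDiffOn_two_of_hasDerivWithinAt {F : Type*} [NormedAddCommGroup F] [NormedSpace ℝ F]
    {f v w : ℝ → F} {s : Set ℝ} (hs : UniqueDiffOn ℝ s)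
    (hf : ∀ t ∈ s, HasDerivWithinAt f (v t) s t) (hv : ∀ t ∈ s, HasDerivWithinAt v (w t) s t)
    (hw : ContinuousOn w s) : ContDiffOn ℝ 2 f s := by
  have h1 : ContDiffOn ℝ 1 v s := (contDiffOn_one_iff_derivWithin hs).2
    ⟨fun t ht => (hv t ht).differentiableWithinAt,
      hw.congr fun t ht => (hv t ht).derivWithin (hs t ht)⟩
  rw [show (2 : ℕ∞ω) = 1 + 1 by norm_num, contDiffOn_succ_iff_derivWithin hs]
  exact ⟨fun t ht => (hf t ht).differentiableWithinAt, by simp,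
    h1.congr fun t ht => (hf t ht).derivWithin (hs t ht)⟩

variable {n : ℕ} {M : Type*} [TopologicalSpace M] [ChartedSpace (EuclideanSpace ℝ (Fin n)) M]
  [IsManifold (𝓡 n) ∞ M] {γ : ℝ → M} {U V W D D' : ∀ t, TangentSpace (𝓡 n) (γ t)} {s s' : Set ℝ}
  {t : ℝ} {cov : LinearConnection n M}

theorem hasVelocityAt_velocity (h : MDifferentiableWithinAt 𝓘(ℝ, ℝ) (𝓡 n) γ s t) :
    HasVelocityAt γ (velocity n γ s) s t := by
  refine ⟨h.continuousWithinAt, fun c hc => ?_⟩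
  have h1 : HasMFDerivWithinAt 𝓘(ℝ, ℝ) 𝓘(ℝ, Eu n) (extChartAt (𝓡 n) c ∘ γ) s t _ :=
    (mdifferentiableAt_extChartAt hc).hasMFDerivAt.comp_hasMFDerivWithinAt t h.hasMFDerivWithinAt
  rw [← tc_eq_mfderiv hc] at h1
  exact HasFDerivWithinAt.hasDerivWithinAt (f := fun r => extChartAt (𝓡 n) c (γ r))
    h1.hasFDerivWithinAt

theorem HasVelocityAt.velocity_eq (h : HasVelocityAt γ U s t) (hs : UniqueDiffWithinAt ℝ s t) :
    velocity n γ s t = U t := by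
  have hc : γ t ∈ chSrc n (γ t) := mem_chart_source _ _
  have hd : MDifferentiableWithinAt 𝓘(ℝ, ℝ) (𝓡 n) γ s t := by
    refine mdifferentiableWithinAt_iff_target.2 ⟨h.1, ?_⟩
    exact ((h.2 _ hc).differentiableWithinAt).mdifferentiableWithinAt
  have h1 := (hasVelocityAt_velocity hd).2 _ hc
  exact tc_injective hc (hs.eq_deriv _ h1 (h.2 _ hc))

theorem tc_cov_extendVec {x : M} (v u : TangentSpace (𝓡 n) x) :
    tc x x (cov (extendVec v) x u) =
      christoffel cov x (extChartAt (𝓡 n) x x) (tc x x u) (tc x x v) := by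
  have hx : x ∈ chSrc n x := mem_chart_source _ _
  rw [cov.isCovariantDerivativeOnUniv.congr_of_eventuallyEq
    (smoothFieldAt_extendVec v).fieldDiffAt (fieldDiffAt_cfield hx _) Filter.univ_mem
    (extendVec_eventuallyEq v)]
  exact tc_cov_cfield hx _ _

theorem triv_derivWithin_eq (hγ : ContinuousWithinAt γ s t) (hts : t ∈ s) :
    derivWithin (fun r => (trivializationAt (Eu n) (TangentSpace (𝓡 n) : M → Type _) (γ t)
      ⟨γ r, V r⟩).2) s t = derivWithin (fun r => tc (γ t) (γ r) (V r)) s t := by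
  refine Filter.EventuallyEq.derivWithin_eq_of_mem ?_ hts
  filter_upwards [hγ.eventually_chSrc (n := n) (mem_chart_source _ (γ t))] with r hr
  exact triv_apply hr _

theorem tc_covDerivAlong (hγ : ContinuousWithinAt γ s t) (hts : t ∈ s) :
    tc (γ t) (γ t) (covDerivAlong cov γ s V t) =
      derivWithin (fun r => tc (γ t) (γ r) (V r)) s t +
        christoffel cov (γ t) (extChartAt (𝓡 n) (γ t) (γ t))
          (tc (γ t) (γ t) (velocity n γ s t)) (tc (γ t) (γ t) (V t)) := by
  rw [covDerivAlong, map_add, tc_cov_extendVec, triv_derivWithin_eq hγ hts]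
  congr 1
  exact tc_ts (mem_chart_source _ _) _

theorem IsGeodesicOn.hasVelocityAt (hγ : IsGeodesicOn cov γ s) (ht : t ∈ s) :
    HasVelocityAt γ (velocity n γ s) s t :=
  hasVelocityAt_velocity ((hγ.1 t ht).mdifferentiableWithinAt (by norm_num))

/-- The C² assumption makes the components of the velocity differentiable, so the `derivWithin` in
`covDerivAlong` is a genuine derivative and not the default 0. -/
theorem IsGeodesicOn.hasCovDerivAt (hγ : IsGeodesicOn cov γ s) (hs : UniqueDiffOn ℝ s)
    (ht : t ∈ s) :
    HasCovDerivAt cov γ (velocity n γ s) (velocity n γ s) (fun _ => 0) s t := by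
  have hc : γ t ∈ chSrc n (γ t) := mem_chart_source _ _
  have hcont := (hγ.hasVelocityAt ht).1
  refine HasCovDerivAt.of_chart (hγ.hasVelocityAt ht) hc ?_
  have h1 : ContDiffWithinAt ℝ 2 (fun r => extChartAt (𝓡 n) (γ t) (γ r)) s t := by
    rw [← contMDiffWithinAt_iff_contDiffWithinAt]
    exact (contMDiffWithinAt_iff_target.1 (hγ.1 t ht)).2
  have h2 := h1.derivWithin (m := 1) hs (by norm_num) ht
  have h3 : (fun r => tc (γ t) (γ r) (velocity n γ s r)) =ᶠ[𝓝[s] t]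
      derivWithin (fun r => extChartAt (𝓡 n) (γ t) (γ r)) s := by
    filter_upwards [hcont.eventually_chSrc hc, self_mem_nhdsWithin] with r hr hrs
    exact (((hγ.hasVelocityAt hrs).2 _ hr).derivWithin (hs r hrs)).symm
  have h4 := (h2.differentiableWithinAt (by norm_num)).congr_of_eventuallyEq h3
    (h3.eq_of_nhdsWithin ht)
  have h5 := tc_covDerivAlong (cov := cov) (V := velocity n γ s) hcont ht
  rw [hγ.2 t ht] at h5
  rw [h5, add_sub_cancel_right]
  exact h4.hasDerivWithinAt

/-- The C² regularity comes for free: the second derivative of the coordinates is -Γ(U,U), which is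
continuous. -/
theorem isGeodesicOn_Icc [T2Space M] (hcov : cov.ContMDiffCovariantDerivative ∞) {a b : ℝ}
    (hab : a < b) (hU : ∀ t ∈ Icc a b, HasVelocityAt γ U (Icc a b) t)
    (hUU : ∀ t ∈ Icc a b, HasCovDerivAt cov γ U U (fun _ => 0) (Icc a b) t) :
    IsGeodesicOn cov γ (Icc a b) := by
  have hs : UniqueDiffOn ℝ (Icc a b) := uniqueDiffOn_Icc hab
  have hvel : ∀ t ∈ Icc a b, velocity n γ (Icc a b) t = U t := fun t ht =>
    (hU t ht).velocity_eq (hs t ht)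
  refine ⟨fun t ht => ?_, fun t ht => ?_⟩
  · refine contMDiffWithinAt_iff_target.2 ⟨(hU t ht).1, ?_⟩
    have hγ : ContinuousOn γ (Icc a b) := fun t ht => (hU t ht).1
    set c := γ t
    have hc : γ t ∈ chSrc n c := mem_chart_source _ _
    obtain ⟨ε, hε, hsrc⟩ := exists_forall_mem_chSrc hγ ht hc
    have hsrc' : ∀ r ∈ Icc a b ∩ Metric.ball t ε, γ r ∈ chSrc n c := fun r hr =>
      hsrc r hr.1 (by rw [← Real.dist_eq]; exact hr.2)
    have hsub : Icc a b ∩ Metric.ball t ε ⊆ Icc a b := inter_subset_left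
    have hx : ∀ r ∈ Icc a b ∩ Metric.ball t ε, HasDerivWithinAt
        (fun r => extChartAt (𝓡 n) c (γ r)) (tc c (γ r) (U r)) (Icc a b ∩ Metric.ball t ε) r :=
      fun r hr => ((hU r hr.1).2 c (hsrc' r hr)).mono hsub
    have hu : ∀ r ∈ Icc a b ∩ Metric.ball t ε, HasDerivWithinAt (fun r => tc c (γ r) (U r))
        (-christoffel cov c (extChartAt (𝓡 n) c (γ r)) (tc c (γ r) (U r)) (tc c (γ r) (U r)))
        (Icc a b ∩ Metric.ball t ε) r := fun r hr => by
      simpa only [map_zero, zero_sub] using (hUU r hr.1 c (hsrc' r hr)).mono hsub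
    have huc : ContinuousOn (fun r => tc c (γ r) (U r)) (Icc a b ∩ Metric.ball t ε) :=
      fun r hr => (hu r hr).continuousWithinAt
    have h2 := contDiffOn_two_of_hasDerivWithinAt (hs.inter Metric.isOpen_ball) hx hu
      ((ContinuousOn.clm_apply (ContinuousOn.clm_apply (ContinuousOn.comp
        (g := christoffel cov c) (contDiffOn_christoffel hcov c).continuousOn
        (fun r hr => (hx r hr).continuousWithinAt) fun r hr => ch_mem (hsrc' r hr)) huc) huc).neg)
    rw [contMDiffWithinAt_iff_contDiffWithinAt]
    exact (h2 t ⟨ht, Metric.mem_ball_self hε⟩).mono_of_mem_nhdsWithin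
      (inter_mem_nhdsWithin _ (Metric.ball_mem_nhds t hε))
  · have hc : γ t ∈ chSrc n (γ t) := mem_chart_source _ _
    refine tc_injective hc ?_
    rw [tc_covDerivAlong (hU t ht).1 ht, hvel t ht, map_zero]
    have h1 : derivWithin (fun r => tc (γ t) (γ r) (velocity n γ (Icc a b) r)) (Icc a b) t =
        derivWithin (fun r => tc (γ t) (γ r) (U r)) (Icc a b) t :=
      derivWithin_congr (fun r hr => by rw [hvel r hr]) (by rw [hvel t ht])
    rw [h1, (hUU t ht _ hc).derivWithin (hs t ht), map_zero]
    abel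

end Geodesics

/-! ### The geodesic spray on the tangent bundle -/

section GeodesicFlow

variable {n : ℕ} {M : Type*} [TopologicalSpace M] [ChartedSpace (EuclideanSpace ℝ (Fin n)) M]

theorem isOpen_chTgt_prod (c : M) : IsOpen (chTgt n c ×ˢ (univ : Set (Eu n))) :=
  (isOpen_chTgt c).prod isOpen_univ

variable [IsManifold (𝓡 n) ∞ M]

/-- Coordinates on the tangent bundle induced by the chart at `c`. -/
abbrev tbc (c : M) (p : TangentBundle (𝓡 n) M) : Eu n × Eu n :=
  (extChartAt (𝓡 n) c p.1, tc c p.1 p.2)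

/-- The tangent vector with given coordinates in the chart at `c`. -/
abbrev tbp (c : M) (q : Eu n × Eu n) : TangentBundle (𝓡 n) M :=
  ⟨pt c q.1, ts c (pt c q.1) q.2⟩

theorem tbp_tbc {c : M} {p : TangentBundle (𝓡 n) M} (hp : p.1 ∈ chSrc n c) :
    tbp c (tbc c p) = p := by
  obtain ⟨x, v⟩ := p
  simp only [tbp, tbc]
  rw [pt_ch hp, ts_tc hp]

/-- The geodesic spray in the chart at `c`. -/
def spray (cov : LinearConnection n M) (c : M) (q : Eu n × Eu n) : Eu n × Eu n :=
  (q.2, -christoffel cov c q.1 q.2 q.2)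

/-- The curve `β` in the tangent bundle is, at time `t`, the velocity curve of a geodesic. -/
def IsGeodesicLift (cov : LinearConnection n M) (β : ℝ → TangentBundle (𝓡 n) M) (s : Set ℝ)
    (t : ℝ) : Prop :=
  HasVelocityAt (fun r => (β r).1) (fun r => (β r).2) s t ∧
    HasCovDerivAt cov (fun r => (β r).1) (fun r => (β r).2) (fun r => (β r).2) (fun _ => 0) s t

variable {cov : LinearConnection n M} {β β' : ℝ → TangentBundle (𝓡 n) M} {s s' : Set ℝ} {t : ℝ}

theorem IsGeodesicLift.mono (h : IsGeodesicLift cov β s t) (hs : s ∈ 𝓝[s'] t) :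
    IsGeodesicLift cov β s' t := ⟨h.1.mono hs, h.2.mono hs⟩

theorem IsGeodesicLift.chart (h : IsGeodesicLift cov β s t) {c : M} (hc : (β t).1 ∈ chSrc n c) :
    HasDerivWithinAt (fun r => tbc c (β r)) (spray cov c (tbc c (β t))) s t := by
  refine (h.1.2 c hc).prodMk ?_
  simpa only [map_zero, zero_sub] using h.2 c hc

theorem isGeodesicLift_of_chart {c : M} {ζ : ℝ → Eu n × Eu n} (hζ : ∀ t ∈ s, (ζ t).1 ∈ chTgt n c)
    (h : ∀ t ∈ s, HasDerivWithinAt ζ (spray cov c (ζ t)) s t) (ht : t ∈ s) :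
    IsGeodesicLift cov (fun r => tbp c (ζ r)) s t := by
  have h1 := (hasFDerivAt_fst (𝕜 := ℝ) (p := ζ t)).along (h t ht)
  have h2 := (hasFDerivAt_snd (𝕜 := ℝ) (p := ζ t)).along (h t ht)
  have hc : (tbp c (ζ t)).1 ∈ chSrc n c := pt_mem (hζ t ht)
  have hv : HasVelocityAt (fun r => (tbp c (ζ r)).1) (fun r => (tbp c (ζ r)).2) s t := by
    refine HasVelocityAt.of_chart ?_ hc ?_
    · exact ContinuousAt.comp_continuousWithinAt (f := fun r => (ζ r).1) (g := pt (n := n) c)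
        (mdifferentiableAt_pt (hζ t ht)).continuousAt h1.continuousWithinAt
    · refine (h1.congr (fun r hr => ch_pt (hζ r hr)) (ch_pt (hζ t ht))).congr_deriv ?_
      exact (tc_ts (pt_mem (hζ t ht)) _).symm
  refine ⟨hv, HasCovDerivAt.of_chart hv hc ?_⟩
  refine (h2.congr (fun r hr => tc_ts (pt_mem (hζ r hr)) _)
    (tc_ts (pt_mem (hζ t ht)) _)).congr_deriv ?_
  have e1 := tc_ts (pt_mem (hζ t ht)) (ζ t).2
  have e2 := ch_pt (hζ t ht)
  rw [map_zero, zero_sub, e1, e2]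
  rfl

theorem isGeodesicLift_glue {a r b : ℝ} (har : a ≤ r) (hrb : r ≤ b)
    (h1 : ∀ t ∈ Icc a r, IsGeodesicLift cov β (Icc a r) t)
    (h2 : ∀ t ∈ Icc r b, IsGeodesicLift cov β' (Icc r b) t) (h : β r = β' r) :
    ∀ t ∈ Icc a b, IsGeodesicLift cov (glueAt r β β') (Icc a b) t := by
  refine glueAt_local (fun f S t => IsGeodesicLift cov f S t) ?_ ?_ ?_ har hrb h1 h2 h
  · intro f g S t ht hfg hf
    refine ⟨⟨hf.1.1.congr (fun u hu => by rw [hfg u hu]) (by rw [hfg t ht]), fun c hc => ?_⟩,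
      fun c hc => ?_⟩
    · change (g t).1 ∈ _ at hc
      rw [← hfg t ht] at hc
      refine ((hf.1.2 c hc).congr (f₁ := fun r => extChartAt (𝓡 n) c (g r).1)
        (fun u hu => by simp only [hfg u hu]) (by simp only [hfg t ht])).congr_deriv ?_
      change tc c (f t).1 (f t).2 = tc c (g t).1 (g t).2
      rw [hfg t ht]
    · change (g t).1 ∈ _ at hc
      rw [← hfg t ht] at hc
      refine ((hf.2 c hc).congr (f₁ := fun r => tc c (g r).1 (g r).2)
        (fun u hu => ?_) ?_).congr_deriv ?_
      · change tc c (g u).1 (g u).2 = tc c (f u).1 (f u).2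
        rw [hfg u hu]
      · change tc c (g t).1 (g t).2 = tc c (f t).1 (f t).2
        rw [hfg t ht]
      · change tc c (f t).1 0 - christoffel cov c (extChartAt (𝓡 n) c (f t).1)
          (tc c (f t).1 (f t).2) (tc c (f t).1 (f t).2) = tc c (g t).1 0 -
          christoffel cov c (extChartAt (𝓡 n) c (g t).1)
          (tc c (g t).1 (g t).2) (tc c (g t).1 (g t).2)
        rw [hfg t ht]
  · intro f S S' t hS hf
    exact hf.mono hS
  · intro f S S' t hf hf'
    exact ⟨⟨hf.1.1.union hf'.1.1, fun c hc => (hf.1.2 c hc).union (hf'.1.2 c hc)⟩,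
      fun c hc => (hf.2 c hc).union (hf'.2 c hc)⟩

/-- The derivative of a chart change of TM contains second derivatives of the chart change of M. For
a pair of vectors (v, w) written as (v, w - Γ(v,u)) these are absorbed by `christoffel_change`, so
such pairs have an intrinsic meaning. This lets linearised geodesics pass between charts. -/
theorem exists_hasFDerivAt_transition {c c' x : M} (hx : x ∈ chSrc n c) (hx' : x ∈ chSrc n c')
    (u : Eu n) : ∃ L : Eu n × Eu n →L[ℝ] Eu n × Eu n,
      HasFDerivAt (fun q => tbc c' (tbp c q)) L (extChartAt (𝓡 n) c x, u) ∧
      ∀ v w : TangentSpace (𝓡 n) x,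
        L (tc c x v, tc c x w - christoffel cov c (extChartAt (𝓡 n) c x) (tc c x v) u) =
          (tc c' x v, tc c' x w - christoffel cov c' (extChartAt (𝓡 n) c' x) (tc c' x v)
            (tc c' x (ts c x u))) := by
  set q₀ : Eu n × Eu n := (extChartAt (𝓡 n) c x, u) with hq₀
  set σ : Fin n → ∀ x : M, TangentSpace (𝓡 n) x := fun i =>
    cfield c (EuclideanSpace.single i (1 : ℝ)) with hσ
  have h1 : HasFDerivAt (fun q : Eu n × Eu n => extChartAt (𝓡 n) c' (pt c q.1)) _ q₀ :=
    HasFDerivAt.comp (g := fun z => extChartAt (𝓡 n) c' (pt c z)) q₀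
      (hasFDerivAt_chart_change hx hx') hasFDerivAt_fst
  have hpx : pt c q₀.1 = x := pt_ch hx
  have h2 : ∀ i, HasFDerivAt (fun q : Eu n × Eu n => crepr c' (σ i)
      (extChartAt (𝓡 n) c' (pt c q.1))) _ q₀ := fun i =>
    HasFDerivAt.comp (g := crepr c' (σ i)) q₀ (by
      rw [hpx]
      exact ((fieldDiffAt_iff hx' _).1 (fieldDiffAt_cfield hx _)).hasFDerivAt) h1
  have h3 : ∀ i, HasFDerivAt (fun q : Eu n × Eu n => q.2 i) _ q₀ := fun i =>
    HasFDerivAt.comp (g := fun z : Eu n => z i) q₀ (EuclideanSpace.proj (𝕜 := ℝ) i).hasFDerivAt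
      hasFDerivAt_snd
  have h4 := HasFDerivAt.fun_sum (u := Finset.univ) fun i _ => (h3 i).smul (h2 i)
  have hcont : ContinuousAt (fun q : Eu n × Eu n => pt c q.1) q₀ :=
    ContinuousAt.comp (f := Prod.fst) (g := pt (n := n) c)
      (mdifferentiableAt_pt (ch_mem hx)).continuousAt continuousAt_fst
  have hev : ∀ᶠ q in 𝓝 q₀, pt c q.1 ∈ chSrc n c ∧ pt c q.1 ∈ chSrc n c' := by
    have e1 := hcont.eventually_mem ((chartAt (Eu n) c).open_source.mem_nhds (hpx.symm ▸ hx))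
    have e2 := hcont.eventually_mem ((chartAt (Eu n) c').open_source.mem_nhds (hpx.symm ▸ hx'))
    exact e1.and e2
  have hexp : ∀ y, y ∈ chSrc n c → y ∈ chSrc n c' → ∀ v : Eu n,
      ∑ i, v i • crepr c' (σ i) (extChartAt (𝓡 n) c' y) = tc c' y (ts c y v) := fun y hy hy' v => by
    conv_rhs => rw [← sum_smul_single v, map_sum, map_sum]
    refine Finset.sum_congr rfl fun i _ => ?_
    rw [map_smul, map_smul, crepr, pt_ch hy']
    rfl
  have h5 := h1.prodMk h4
  refine ⟨_, h5.congr_of_eventuallyEq (hev.mono fun q hq => ?_), fun v w => ?_⟩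
  · exact Prod.ext rfl (hexp _ hq.1 hq.2 q.2).symm
  · refine Prod.ext ?_ ?_
    · change tc c' x (ts c x (tc c x v)) = _
      rw [ts_tc hx]
    · have e2 : ∀ i, fderiv ℝ (crepr c' (σ i)) (extChartAt (𝓡 n) c' x) (tc c' x v) =
          tc c' x (ts c x (christoffel cov c (extChartAt (𝓡 n) c x) (tc c x v)
            (EuclideanSpace.single i 1))) - christoffel cov c' (extChartAt (𝓡 n) c' x)
              (tc c' x v) (tc c' x (ts c x (EuclideanSpace.single i 1))) := fun i => by
        rw [christoffel_change hx hx', ts_tc hx]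
        abel
      have e3 : ∑ i, u i • fderiv ℝ (crepr c' (σ i)) (extChartAt (𝓡 n) c' x) (tc c' x v) =
          tc c' x (ts c x (christoffel cov c (extChartAt (𝓡 n) c x) (tc c x v) u)) -
            christoffel cov c' (extChartAt (𝓡 n) c' x) (tc c' x v) (tc c' x (ts c x u)) := by
        simp only [e2, smul_sub, Finset.sum_sub_distrib, ← map_smul, ← map_sum, sum_smul_single]
      have e4 := hexp x hx hx' (tc c x w - christoffel cov c (extChartAt (𝓡 n) c x) (tc c x v) u)
      simp only [ContinuousLinearMap.prod_apply, sum_apply, add_apply,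
        smul_apply, ContinuousLinearMap.smulRight_apply, ContinuousLinearMap.comp_apply,
        ContinuousLinearMap.coe_fst', ContinuousLinearMap.coe_snd', hpx, ts_tc hx,
        Finset.sum_add_distrib]
      refine (congrArg₂ (· + ·) e3 e4).trans ?_
      simp only [map_sub, ts_tc hx]
      abel

variable [T2Space M]

theorem contDiffOn_spray (hcov : cov.ContMDiffCovariantDerivative ∞) (c : M) :
    ContDiffOn ℝ ∞ (spray cov c) (chTgt n c ×ˢ univ) := by
  have h : ContDiffOn ℝ ∞ (fun q : Eu n × Eu n => christoffel cov c q.1) (chTgt n c ×ˢ univ) :=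
    ContDiffOn.comp (g := christoffel cov c) (contDiffOn_christoffel hcov c) contDiffOn_fst
      fun q hq => hq.1
  exact contDiffOn_snd.prodMk ((h.clm_apply contDiffOn_snd).clm_apply contDiffOn_snd).neg

set_option synthInstance.maxHeartbeats 200000 in
theorem fderiv_spray (hcov : cov.ContMDiffCovariantDerivative ∞) {c : M} {q : Eu n × Eu n}
    (hq : q.1 ∈ chTgt n c) (v w : Eu n) :
    fderiv ℝ (spray cov c) q (v, w) = (w, -(fderiv ℝ (christoffel cov c) q.1 v q.2 q.2 +
      christoffel cov c q.1 w q.2 + christoffel cov c q.1 q.2 w)) := by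
  have hΓ : HasFDerivAt (christoffel cov c) (fderiv ℝ (christoffel cov c) q.1) q.1 :=
    (((contDiffOn_christoffel hcov c).contDiffAt ((isOpen_chTgt c).mem_nhds hq)).differentiableAt
      (by simp)).hasFDerivAt
  have h1 : HasFDerivAt (fun q : Eu n × Eu n => christoffel cov c q.1) _ q :=
    HasFDerivAt.comp (g := christoffel cov c) q hΓ (hasFDerivAt_fst (𝕜 := ℝ) (p := q))
  have h2 : HasFDerivAt (spray cov c) _ q := HasFDerivAt.prodMk hasFDerivAt_snd
    ((h1.clm_apply hasFDerivAt_snd).clm_apply hasFDerivAt_snd).neg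
  rw [h2.fderiv]
  simp only [ContinuousLinearMap.prod_apply, neg_apply, add_apply, ContinuousLinearMap.comp_apply,
    ContinuousLinearMap.flip_apply, ContinuousLinearMap.coe_snd', ContinuousLinearMap.coe_fst']
  congr 2
  abel

/-- Agreement at a time is propagated by local uniqueness for the spray, which is locally Lipschitz.
-/
theorem IsGeodesicLift.unique (hcov : cov.ContMDiffCovariantDerivative ∞) {a b : ℝ} (hab : a ≤ b)
    (h1 : ∀ t ∈ Icc a b, IsGeodesicLift cov β (Icc a b) t)
    (h2 : ∀ t ∈ Icc a b, IsGeodesicLift cov β' (Icc a b) t) (h : β a = β' a) : β b = β' b := by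
  refine Icc_induction (P := fun τ => β τ = β' τ) hab h fun t ht => ?_
  have c1 : ContinuousOn (fun r => (β r).1) (Icc a b) := fun t ht => (h1 t ht).1.1
  have c2 : ContinuousOn (fun r => (β' r).1) (Icc a b) := fun t ht => (h2 t ht).1.1
  by_cases hne : (β t).1 = (β' t).1
  · set c := (β t).1
    have hc : (β t).1 ∈ chSrc n c := mem_chart_source _ _
    have hc' : (β' t).1 ∈ chSrc n c := by rw [← hne]; exact hc
    obtain ⟨ε₁, hε₁, hs1⟩ := exists_forall_mem_chSrc c1 ht hc
    obtain ⟨ε₂, hε₂, hs2⟩ := exists_forall_mem_chSrc c2 ht hc'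
    have d1 := (h1 t ht).chart hc
    have d2 := (h2 t ht).chart hc'
    by_cases hq : tbc c (β t) = tbc c (β' t)
    · have hmem : tbc c (β t) ∈ chTgt n c ×ˢ (univ : Set (Eu n)) := ⟨ch_mem hc, mem_univ _⟩
      obtain ⟨K, N, hN, hK⟩ := (((contDiffOn_spray hcov c).contDiffAt
        ((isOpen_chTgt_prod c).mem_nhds hmem)).of_le (m := 1)
          (WithTop.coe_le_coe.2 le_top)).exists_lipschitzOnWith
      have e1 := d1.continuousWithinAt.eventually_mem hN
      have e2 := d2.continuousWithinAt.eventually_mem (s := N) (by simpa only [← hq] using hN)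
      obtain ⟨ε₃, hε₃, h3⟩ := Metric.eventually_nhds_iff.1
        (eventually_nhdsWithin_iff.1 (e1.and e2))
      refine ⟨min ε₁ (min ε₂ ε₃), lt_min hε₁ (lt_min hε₂ hε₃), ?_⟩
      intro r hr s hs hrs hrt hst hβr
      have hsub : Icc r s ⊆ Icc a b := Icc_subset_Icc hr.1 hs.2
      have habs : ∀ x ∈ Icc r s, |x - t| < min ε₁ (min ε₂ ε₃) := fun x hx =>
        abs_sub_lt_of_mem_Icc hrt hst hx
      simp only [lt_min_iff] at habs
      have hx1 : ∀ x ∈ Icc r s, (β x).1 ∈ chSrc n c := fun x hx => hs1 x (hsub hx) (habs x hx).1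
      have hx2 : ∀ x ∈ Icc r s, (β' x).1 ∈ chSrc n c := fun x hx =>
        hs2 x (hsub hx) (habs x hx).2.1
      have hx3 : ∀ x ∈ Icc r s, tbc c (β x) ∈ N ∧ tbc c (β' x) ∈ N := fun x hx =>
        h3 (by rw [Real.dist_eq]; exact (habs x hx).2.2) (hsub hx)
      have D1 : ∀ x ∈ Icc r s, HasDerivWithinAt (fun r => tbc c (β r))
          (spray cov c (tbc c (β x))) (Icc r s) x := fun x hx =>
        ((h1 x (hsub hx)).chart (hx1 x hx)).mono hsub
      have D2 : ∀ x ∈ Icc r s, HasDerivWithinAt (fun r => tbc c (β' r))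
          (spray cov c (tbc c (β' x))) (Icc r s) x := fun x hx =>
        ((h2 x (hsub hx)).chart (hx2 x hx)).mono hsub
      have := ODE_solution_unique_of_mem_Icc_right (v := fun _ => spray cov c) (s := fun _ => N)
        (K := K) (f := fun r => tbc c (β r)) (g := fun r => tbc c (β' r)) (a := r) (b := s)
        (fun _ _ => hK) (fun x hx => (D1 x hx).continuousWithinAt)
        (fun x hx => (D1 x (Ico_subset_Icc_self hx)).Icc_to_Ici hx)
        (fun x hx => (hx3 x (Ico_subset_Icc_self hx)).1)
        (fun x hx => (D2 x hx).continuousWithinAt)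
        (fun x hx => (D2 x (Ico_subset_Icc_self hx)).Icc_to_Ici hx)
        (fun x hx => (hx3 x (Ico_subset_Icc_self hx)).2) (by simp only [hβr])
        ⟨hrs, le_rfl⟩
      rw [← tbp_tbc (hx1 s ⟨hrs, le_rfl⟩), ← tbp_tbc (hx2 s ⟨hrs, le_rfl⟩)]
      exact congrArg _ this
    -- If the lifts differ at t, they differ at all nearby times by continuity, so the premise of
    -- the local step is false there. The same reasoning applies below to distinct base points,
    -- where M being Hausdorff is needed.
    · have e1 := (d1.continuousWithinAt.prodMk d2.continuousWithinAt).eventually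
        (isClosed_diagonal.isOpen_compl.mem_nhds (x := (tbc c (β t), tbc c (β' t))) hq)
      obtain ⟨ε₃, hε₃, h3⟩ := Metric.eventually_nhds_iff.1 (eventually_nhdsWithin_iff.1 e1)
      refine ⟨ε₃, hε₃, ?_⟩
      intro r hr s hs hrs hrt hst hβr
      exact absurd (by simp only [hβr]; rfl) (h3 (by rwa [Real.dist_eq]) hr)
  · have e1 := ((c1 t ht).prodMk (c2 t ht)).eventually
      (isClosed_diagonal.isOpen_compl.mem_nhds (x := ((β t).1, (β' t).1)) hne)
    obtain ⟨ε₃, hε₃, h3⟩ := Metric.eventually_nhds_iff.1 (eventually_nhdsWithin_iff.1 e1)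
    refine ⟨ε₃, hε₃, ?_⟩
    intro r hr s hs hrs hrt hst hβr
    exact absurd (by simp only [hβr]; rfl) (h3 (by rwa [Real.dist_eq]) hr)

end GeodesicFlow

/-! ### Jacobi fields as derivatives of geodesic variations -/

section ExpMap

theorem DifferentiableAt.along {F G : Type*} [NormedAddCommGroup F] [NormedSpace ℝ F]
    [NormedAddCommGroup G] [NormedSpace ℝ G] {l : F → G} {f : ℝ → F} {f' : F}
    {s : Set ℝ} {t : ℝ} (hl : DifferentiableAt ℝ l (f t)) (hf : HasDerivWithinAt f f' s t) :
    HasDerivWithinAt (fun r => l (f r)) (fderiv ℝ l (f t) f') s t :=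
  hl.hasFDerivAt.along hf

theorem HasDerivWithinAt.clm_apply₂ {E F G : Type*} [NormedAddCommGroup E] [NormedSpace ℝ E]
    [NormedAddCommGroup F] [NormedSpace ℝ F] [NormedAddCommGroup G] [NormedSpace ℝ G]
    {A : ℝ → E →L[ℝ] F →L[ℝ] G} {A' : E →L[ℝ] F →L[ℝ] G} {v : ℝ → E} {w : ℝ → F} {v' : E} {w' : F}
    {s : Set ℝ} {t : ℝ} (hA : HasDerivWithinAt A A' s t) (hv : HasDerivWithinAt v v' s t)
    (hw : HasDerivWithinAt w w' s t) :
    HasDerivWithinAt (fun r => A r (v r) (w r))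
      (A' (v t) (w t) + A t v' (w t) + A t (v t) w') s t := by
  refine ((hA.clm_apply hv).clm_apply hw).congr_deriv ?_
  simp only [add_apply]

-- Turns the Jacobi system into the linearised spray equation. In coordinates ∇V = W - T(V,U) reads
-- v' = w - Γ(v,u), as the torsion exchanges the arguments of Γ; so w - Γ(v,u) is exactly the
-- velocity component of the linearised equation.
set_option synthInstance.maxHeartbeats 200000 in
theorem hasDerivWithinAt_jacobi_coord {E : Type*} [NormedAddCommGroup E] [NormedSpace ℝ E]
    {Γ : E → E →L[ℝ] E →L[ℝ] E} {x u v w : ℝ → E} {s : Set ℝ} {t : ℝ}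
    (hΓ : DifferentiableAt ℝ Γ (x t)) (hx : HasDerivWithinAt x (u t) s t)
    (hu : HasDerivWithinAt u (-Γ (x t) (u t) (u t)) s t)
    (hv : HasDerivWithinAt v (w t - Γ (x t) (v t) (u t)) s t)
    (hw : HasDerivWithinAt w (-coordCurvature Γ (x t) (v t) (u t) (u t) -
      Γ (x t) (u t) (w t)) s t) :
    HasDerivWithinAt (fun r => w r - Γ (x r) (v r) (u r))
      (-(fderiv ℝ Γ (x t) (v t) (u t) (u t) +
        Γ (x t) (w t - Γ (x t) (v t) (u t)) (u t) +
        Γ (x t) (u t) (w t - Γ (x t) (v t) (u t)))) s t := by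
  have h1 := DifferentiableAt.along (G := E →L[ℝ] E →L[ℝ] E) hΓ hx
  have h2 := HasDerivWithinAt.clm_apply₂ h1 hv hu
  refine (HasDerivWithinAt.fun_sub hw h2).congr_deriv ?_
  simp only [coordCurvature, map_sub, map_neg]
  simp only [sub_apply]
  abel

variable {n : ℕ} {M : Type*} [TopologicalSpace M] [ChartedSpace (EuclideanSpace ℝ (Fin n)) M]
  [IsManifold (𝓡 n) ∞ M]

/-- The fields `V` and `W = ∇_{γ'} V + T(V, γ')` form a solution of the Jacobi equation along the
geodesic `γ` with velocity `U`. -/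
structure IsJacobiOn (cov : LinearConnection n M) (γ : ℝ → M)
    (U V W : ∀ t, TangentSpace (𝓡 n) (γ t)) (s : Set ℝ) : Prop where
  fst : ∀ t ∈ s, HasCovDerivAt cov γ U V
    (fun r => W r - cov.torsion (γ r) (V r) (U r)) s t
  snd : ∀ t ∈ s, HasCovDerivAt cov γ U W (fun r => -curvature cov (γ r) (V r) (U r) (U r)) s t

/-- Coordinates of the solution of the linearised geodesic equation given by a Jacobi field. -/
def jacobiCoord (cov : LinearConnection n M) (c : M) {x : M} (u v w : TangentSpace (𝓡 n) x) :
    Eu n × Eu n :=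
  (tc c x v, tc c x w - christoffel cov c (extChartAt (𝓡 n) c x) (tc c x v) (tc c x u))

variable {cov : LinearConnection n M} {γ : ℝ → M} {U V W : ∀ t, TangentSpace (𝓡 n) (γ t)}
  {s : Set ℝ} {t : ℝ} [T2Space M]

theorem differentiableAt_christoffel (hcov : cov.ContMDiffCovariantDerivative ∞) {c : M} {z : Eu n}
    (hz : z ∈ chTgt n c) : DifferentiableAt ℝ (christoffel cov c) z :=
  ((contDiffOn_christoffel hcov c).contDiffAt ((isOpen_chTgt c).mem_nhds hz)).differentiableAt
    (by simp)

theorem IsJacobiOn.hasDerivWithinAt (hcov : cov.ContMDiffCovariantDerivative ∞)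
    (h : IsJacobiOn cov γ U V W s) (ht : t ∈ s) (hU : HasVelocityAt γ U s t)
    (hUU : HasCovDerivAt cov γ U U (fun _ => 0) s t) {c : M} (hc : γ t ∈ chSrc n c) :
    HasDerivWithinAt (fun r => jacobiCoord cov c (U r) (V r) (W r))
      (fderiv ℝ (spray cov c) (extChartAt (𝓡 n) c (γ t), tc c (γ t) (U t))
        (jacobiCoord cov c (U t) (V t) (W t))) s t := by
  have hT := tc_torsion (cov := cov) hc (tc c (γ t) (V t)) (tc c (γ t) (U t))
  rw [ts_tc hc, ts_tc hc] at hT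
  have hv : HasDerivWithinAt (fun r => tc c (γ r) (V r)) (tc c (γ t) (W t) - christoffel cov c
      (extChartAt (𝓡 n) c (γ t)) (tc c (γ t) (V t)) (tc c (γ t) (U t))) s t := by
    refine (h.fst t ht c hc).congr_deriv ?_
    rw [map_sub, hT]
    abel
  have hu := (hUU c hc).congr_deriv (by rw [map_zero, zero_sub])
  have hw := (h.snd t ht c hc).congr_deriv (by rw [map_neg, tc_curvature hcov hc])
  have hΓ := differentiableAt_christoffel hcov (ch_mem hc)
  have h1 := hasDerivWithinAt_jacobi_coord (E := Eu n) (Γ := christoffel cov c)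
    (x := fun r => extChartAt (𝓡 n) c (γ r)) (u := fun r => tc c (γ r) (U r))
    (v := fun r => tc c (γ r) (V r)) (w := fun r => tc c (γ r) (W r)) hΓ (hU.2 c hc) hu hv hw
  have h2 := fderiv_spray hcov (q := (extChartAt (𝓡 n) c (γ t), tc c (γ t) (U t))) (ch_mem hc)
    (tc c (γ t) (V t)) (tc c (γ t) (W t) - christoffel cov c (extChartAt (𝓡 n) c (γ t))
      (tc c (γ t) (V t)) (tc c (γ t) (U t)))
  exact (hv.prodMk h1).congr_deriv h2.symm

/-- The statement is carried forward in time: the family built up to r is prolonged by the flow of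
the spray in a chart, and the derivatives are composed. To survive a change of chart it describes
the derivative in every chart at the endpoint. `hu₀` serves to regard `U a` as a vector of ℝⁿ, in
which the initial velocities vary. -/
theorem exists_geodesic_variation (hcov : cov.ContMDiffCovariantDerivative ∞) {a b : ℝ}
    (hab : a ≤ b) (hU : ∀ t ∈ Icc a b, HasVelocityAt γ U (Icc a b) t)
    (hUU : ∀ t ∈ Icc a b, HasCovDerivAt cov γ U U (fun _ => 0) (Icc a b) t) (u₀ : Eu n)
    (hu₀ : U a = u₀) :
    ∃ β : Eu n → ℝ → TangentBundle (𝓡 n) M,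
      (∀ᶠ w in 𝓝 u₀, β w a = ⟨γ a, w⟩ ∧
        ∀ t ∈ Icc a b, IsGeodesicLift cov (β w) (Icc a b) t) ∧
      β u₀ b = ⟨γ b, U b⟩ ∧ ContinuousAt (fun w => (β w b).1) u₀ ∧
      ∀ c, γ b ∈ chSrc n c → ∃ L : Eu n →L[ℝ] Eu n × Eu n,
        HasFDerivAt (fun w => tbc c (β w b)) L u₀ ∧
        ∀ V W : ∀ t, TangentSpace (𝓡 n) (γ t), IsJacobiOn cov γ U V W (Icc a b) → V a = 0 →
          L (W a) = jacobiCoord cov c (U b) (V b) (W b) := by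
  refine Icc_induction (P := fun τ => ∃ β : Eu n → ℝ → TangentBundle (𝓡 n) M,
      (∀ᶠ w in 𝓝 u₀, β w a = ⟨γ a, w⟩ ∧
        ∀ t ∈ Icc a τ, IsGeodesicLift cov (β w) (Icc a τ) t) ∧
      β u₀ τ = ⟨γ τ, U τ⟩ ∧ ContinuousAt (fun w => (β w τ).1) u₀ ∧
      ∀ c, γ τ ∈ chSrc n c → ∃ L : Eu n →L[ℝ] Eu n × Eu n,
        HasFDerivAt (fun w => tbc c (β w τ)) L u₀ ∧
        ∀ V W : ∀ t, TangentSpace (𝓡 n) (γ t), IsJacobiOn cov γ U V W (Icc a b) → V a = 0 →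
          L (W a) = jacobiCoord cov c (U τ) (V τ) (W τ)) hab ?_ ?_
  · refine ⟨fun w _ => ⟨γ a, w⟩, Eventually.of_forall fun w => ⟨rfl, fun t _ => ?_⟩, ?_,
      continuousAt_const, fun c hc => ?_⟩
    · rw [Icc_self]
      refine ⟨⟨continuousWithinAt_const, fun c _ => ?_⟩, fun c _ => ?_⟩
      · exact HasFDerivWithinAt.of_subsingleton subsingleton_singleton
      · exact HasFDerivWithinAt.of_subsingleton subsingleton_singleton
    · rw [hu₀]
    -- At time a the base point is fixed and the vector varies linearly, which matches the
    -- coordinates (0, W) of a Jacobi field with V(a) = 0.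
    · refine ⟨ContinuousLinearMap.prod 0 (tc c (γ a)), ?_, fun V W _ hV => ?_⟩
      · exact (hasFDerivAt_const (extChartAt (𝓡 n) c (γ a)) u₀).prodMk
          (ContinuousLinearMap.hasFDerivAt (tc c (γ a) : Eu n →L[ℝ] Eu n))
      · simp only [jacobiCoord, hV, map_zero]
        exact Prod.ext rfl (sub_zero _).symm
  · intro t ht
    have hγ : ContinuousOn γ (Icc a b) := fun t ht => (hU t ht).1
    obtain ⟨ε, hε, hsrc⟩ := exists_forall_mem_chSrc hγ ht (mem_chart_source (Eu n) (γ t))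
    refine ⟨ε, hε, ?_⟩
    rintro r hr s hs hrs hrt hst ⟨β, hβ, hβr, hβc, hβL⟩
    set c := γ t
    have hsub : Icc r s ⊆ Icc a b := Icc_subset_Icc hr.1 hs.2
    have hmem : ∀ x ∈ Icc r s, γ x ∈ chSrc n c := fun x hx =>
      hsrc x (hsub hx) (abs_sub_lt_of_mem_Icc hrt hst hx)
    set ζ : ℝ → Eu n × Eu n := fun x => (extChartAt (𝓡 n) c (γ x), tc c (γ x) (U x)) with hζ
    have hζΩ : ∀ x ∈ Icc r s, ζ x ∈ chTgt n c ×ˢ (univ : Set (Eu n)) := fun x hx =>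
      ⟨ch_mem (hmem x hx), mem_univ _⟩
    have hζd : ∀ x ∈ Icc r s, HasDerivWithinAt ζ (spray cov c (ζ x)) (Icc r s) x := fun x hx =>
      (IsGeodesicLift.chart (β := fun x => ⟨γ x, U x⟩) ⟨hU x (hsub hx), hUU x (hsub hx)⟩
        (hmem x hx)).mono hsub
    obtain ⟨Φ, hΦ, hΦs, LΦ, hLΦ, hLJ⟩ := exists_flow_near (isOpen_chTgt_prod c)
      ((contDiffOn_spray hcov c).of_le (WithTop.coe_le_coe.2 le_top)) hrs hζΩ hζd
    have hcr : γ r ∈ chSrc n c := hmem r ⟨le_rfl, hrs⟩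
    obtain ⟨L, hL, hLr⟩ := hβL c hcr
    have hζr : tbc c (β u₀ r) = ζ r := by rw [hβr]
    have hcont : Tendsto (fun w => tbc c (β w r)) (𝓝 u₀) (𝓝 (ζ r)) := by
      rw [← hζr]; exact hL.continuousAt
    have hev : ∀ᶠ w in 𝓝 u₀, (β w r).1 ∈ chSrc n c :=
      hβc.eventually_mem ((chartAt (Eu n) c).open_source.mem_nhds (by
        simp only [hβr]; exact hcr))
    have hglue : ∀ᶠ w in 𝓝 u₀, β w r = tbp c (Φ (tbc c (β w r)) r) := by
      filter_upwards [hcont.eventually hΦ, hev] with w hw hw'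
      rw [hw.1, tbp_tbc hw']
    set β' : Eu n → ℝ → TangentBundle (𝓡 n) M := fun w =>
      glueAt r (β w) (fun x => tbp c (Φ (tbc c (β w r)) x)) with hβ'
    have hβs : ∀ᶠ w in 𝓝 u₀, β' w s = tbp c (Φ (tbc c (β w r)) s) := by
      filter_upwards [hglue] with w hw
      exact glueAt_of_ge hw hrs
    have hΦζ : Φ (tbc c (β u₀ r)) s = ζ s := by rw [hζr, hΦs]
    have hdΦ : HasFDerivAt (fun w => Φ (tbc c (β w r)) s) (LΦ.comp L) u₀ :=
      HasFDerivAt.comp (g := fun y => Φ y s) u₀ (by rw [hζr]; exact hLΦ) hL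
    have hcs : γ s ∈ chSrc n c := hmem s ⟨hrs, le_rfl⟩
    refine ⟨β', ?_, ?_, ?_, fun c' hc' => ?_⟩
    · filter_upwards [hβ, hcont.eventually hΦ, hglue] with w hw hw' hg
      refine ⟨?_, isGeodesicLift_glue hr.1 hrs hw.2 (fun x hx => ?_) hg⟩
      · rw [← hw.1]; exact glueAt_of_le hr.1
      · exact isGeodesicLift_of_chart (fun y hy => (hw'.2 y hy).1.1)
          (fun y hy => (hw'.2 y hy).2) hx
    · rw [hβs.self_of_nhds, hΦζ]
      exact tbp_tbc (p := ⟨γ s, U s⟩) hcs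
    · have h1 : ContinuousAt (fun w => pt c (Φ (tbc c (β w r)) s).1) u₀ := by
        refine ContinuousAt.comp (g := pt (n := n) c) (f := fun w => (Φ (tbc c (β w r)) s).1) ?_ ?_
        · rw [hΦζ]
          exact (mdifferentiableAt_pt (ch_mem hcs)).continuousAt
        · exact continuous_fst.continuousAt.comp hdΦ.continuousAt
      refine h1.congr ?_
      filter_upwards [hβs] with w hw
      rw [hw]
    -- The derivative in the chart c' is the composite of the derivative up to r, that of the flow
    -- from r to s in the chart c, and that of the transition from c to c'; each takes Jacobi
    -- coordinates to Jacobi coordinates.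
    · obtain ⟨K, hK, hKJ⟩ := exists_hasFDerivAt_transition (cov := cov) hcs hc' (tc c (γ s) (U s))
      have h1 : HasFDerivAt (fun w => tbc c' (tbp c (Φ (tbc c (β w r)) s))) (K.comp (LΦ.comp L))
          u₀ := HasFDerivAt.comp (g := fun q => tbc c' (tbp c q)) u₀ (by rw [hΦζ]; exact hK) hdΦ
      refine ⟨_, h1.congr_of_eventuallyEq (hβs.mono fun w hw => by simp only [hw]), ?_⟩
      intro V W hJ hV
      have h2 := hLJ (fun x => jacobiCoord cov c (U x) (V x) (W x)) fun x hx =>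
        (hJ.hasDerivWithinAt hcov (hsub hx) (hU x (hsub hx)) (hUU x (hsub hx)) (hmem x hx)).mono
          hsub
      refine (congrArg K ((congrArg LΦ (hLr V W hJ hV)).trans h2)).trans ((hKJ _ _).trans ?_)
      rw [ts_tc hcs]
      rfl

end ExpMap

/-! ### The exponential map and conjugate points -/

section ConjugatePoints

variable {n : ℕ} {M : Type*} [TopologicalSpace M] [ChartedSpace (EuclideanSpace ℝ (Fin n)) M]
  [IsManifold (𝓡 n) ∞ M] {cov : LinearConnection n M}

/-- The geodesic equation is quadratic in the velocity, so it survives an affine change of time.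
This adapts geodesics on [a, b] to the unit interval in the definition of exp. -/
theorem IsGeodesicLift.rescale {β : ℝ → TangentBundle (𝓡 n) M} {a b : ℝ} (hab : a < b)
    (h : ∀ t ∈ Icc a b, IsGeodesicLift cov β (Icc a b) t) {t : ℝ} (ht : t ∈ Icc (0 : ℝ) 1) :
    IsGeodesicLift cov (fun r => ⟨(β (a + (b - a) * r)).1, (b - a) • (β (a + (b - a) * r)).2⟩)
      (Icc 0 1) t := by
  have hmaps : MapsTo (fun r => a + (b - a) * r) (Icc (0 : ℝ) 1) (Icc a b) := fun r hr =>
    ⟨by nlinarith [hr.1], by nlinarith [hr.2]⟩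
  have haff : HasDerivWithinAt (fun r => a + (b - a) * r) (b - a) (Icc (0 : ℝ) 1) t := by
    simpa using ((hasDerivWithinAt_id t (Icc (0 : ℝ) 1)).const_mul (b - a)).const_add a
  have h1 := h _ (hmaps ht)
  refine ⟨⟨ContinuousWithinAt.comp (f := fun r => a + (b - a) * r) (g := fun r => (β r).1) h1.1.1
    haff.continuousWithinAt hmaps, fun c hc => ?_⟩, fun c hc => ?_⟩
  · refine ((h1.1.2 c hc).scomp t haff hmaps).congr_deriv ?_
    exact (map_smul _ _ _).symm
  · have h2 := (((h1.2 c hc).scomp t haff hmaps).const_smul (b - a))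
    refine (h2.congr (fun r _ => ?_) ?_).congr_deriv ?_
    · exact map_smul _ _ _
    · exact map_smul _ _ _
    · simp only [map_smul, smul_apply, map_zero, zero_sub, smul_neg]

variable [T2Space M]

/-- By uniqueness of geodesics, the choice made in `expMap` does not matter. -/
theorem expMap_eq_of_isGeodesicLift (hcov : cov.ContMDiffCovariantDerivative ∞) {p : M}
    {v : Eu n} {β : ℝ → TangentBundle (𝓡 n) M}
    (h : ∀ t ∈ Icc (0 : ℝ) 1, IsGeodesicLift cov β (Icc 0 1) t) (h0 : β 0 = ⟨p, v⟩) :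
    v ∈ expDomain cov p ∧ expMap cov p v = (β 1).1 := by
  have hu : UniqueDiffOn ℝ (Icc (0 : ℝ) 1) := uniqueDiffOn_Icc zero_lt_one
  have hmem : v ∈ expDomain cov p := by
    refine ⟨fun r => (β r).1, isGeodesicOn_Icc hcov zero_lt_one (fun t ht => (h t ht).1)
      (fun t ht => (h t ht).2), ?_⟩
    rw [(h 0 ⟨le_rfl, zero_le_one⟩).1.velocity_eq (hu 0 ⟨le_rfl, zero_le_one⟩)]
    exact h0
  refine ⟨hmem, ?_⟩
  rw [expMap, dif_pos hmem]
  obtain ⟨hg, hg0⟩ := hmem.choose_spec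
  have hl : ∀ t ∈ Icc (0 : ℝ) 1, IsGeodesicLift cov
      (fun r => ⟨hmem.choose r, velocity n hmem.choose (Icc 0 1) r⟩) (Icc 0 1) t := fun t ht =>
    ⟨hg.hasVelocityAt ht, hg.hasCovDerivAt hu ht⟩
  exact congrArg TotalSpace.proj
    (IsGeodesicLift.unique hcov zero_le_one hl h (hg0.trans h0.symm))

/-- Near (b - a)U(a), the map exp is v ↦ endpoint of the geodesic variation with initial velocity
v/(b - a). Its differential therefore sends W(a) to V(b)/(b - a) = 0, although W(a) ≠ 0. -/
theorem isConjugateAlong_of_isJacobiOn (hcov : cov.ContMDiffCovariantDerivative ∞) {γ : ℝ → M}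
    {U V W : ∀ t, TangentSpace (𝓡 n) (γ t)} {a b : ℝ}
    (hab : a < b) (hU : ∀ t ∈ Icc a b, HasVelocityAt γ U (Icc a b) t)
    (hUU : ∀ t ∈ Icc a b, HasCovDerivAt cov γ U U (fun _ => 0) (Icc a b) t)
    (hJ : IsJacobiOn cov γ U V W (Icc a b)) (hVa : V a = 0) (hVb : V b = 0) (hW : W a ≠ 0) :
    IsConjugateAlong cov (γ a) ((b - a) • U a) (γ b) := by
  obtain ⟨β, hβ, hβb, hβc, hβL⟩ := exists_geodesic_variation hcov hab.le hU hUU (U a) rfl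
  have hba : b - a ≠ 0 := (sub_pos.2 hab).ne'
  set v₀ : Eu n := (b - a) • U a with hv₀
  have hv₀' : (b - a)⁻¹ • v₀ = U a := inv_smul_smul₀ hba _
  have hsc : HasFDerivAt (fun v : Eu n => (b - a)⁻¹ • v)
      ((b - a)⁻¹ • ContinuousLinearMap.id ℝ (Eu n)) v₀ := (hasFDerivAt_id (𝕜 := ℝ) v₀).const_smul (b - a)⁻¹
  have hsc' : Tendsto (fun v : Eu n => (b - a)⁻¹ • v) (𝓝 v₀) (𝓝 (U a : Eu n)) := by
    have := hsc.continuousAt.tendsto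
    rwa [hv₀'] at this
  have hev : ∀ᶠ v in 𝓝 v₀, v ∈ expDomain cov (γ a) ∧
      expMap cov (γ a) v = (β ((b - a)⁻¹ • v) b).1 := by
    filter_upwards [hsc'.eventually hβ] with v hv
    have h1 := expMap_eq_of_isGeodesicLift hcov (p := γ a) (v := v)
      (fun t ht => IsGeodesicLift.rescale hab hv.2 ht) (by
        have hz : ∀ q : TangentBundle (𝓡 n) M, q = ⟨γ a, (b - a)⁻¹ • v⟩ →
            (⟨q.1, (b - a) • q.2⟩ : TangentBundle (𝓡 n) M) = ⟨γ a, v⟩ := by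
          rintro _ rfl
          exact congrArg (fun w : Eu n => (⟨γ a, w⟩ : TangentBundle (𝓡 n) M))
            (smul_inv_smul₀ hba v)
        exact hz _ (by rw [mul_zero, add_zero]; exact hv.1))
    refine ⟨h1.1, h1.2.trans ?_⟩
    rw [mul_one, add_sub_cancel]
  have hval : expMap cov (γ a) v₀ = γ b := by
    rw [hev.self_of_nhds.2]
    exact (congrArg (fun w : Eu n => (β w b).1) hv₀').trans (congrArg TotalSpace.proj hβb)
  have hc : γ b ∈ chSrc n (γ b) := mem_chart_source _ _
  obtain ⟨L, hL, hLJ⟩ := hβL (γ b) hc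
  have hcont : ContinuousAt (expMap cov (γ a)) v₀ := by
    have h1 : ContinuousAt (fun v => (β ((b - a)⁻¹ • v) b).1) v₀ :=
      ContinuousAt.comp (g := fun w => (β w b).1) (f := fun v : Eu n => (b - a)⁻¹ • v)
        (by rw [hv₀']; exact hβc) hsc.continuousAt
    refine h1.congr ?_
    filter_upwards [hev] with v hv using hv.2.symm
  have hd : HasFDerivAt (fun v => extChartAt (𝓡 n) (γ b) (expMap cov (γ a) v))
      ((ContinuousLinearMap.fst ℝ (Eu n) (Eu n)).comp
        (L.comp ((b - a)⁻¹ • ContinuousLinearMap.id ℝ (Eu n)))) v₀ := by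
    have h1 : HasFDerivAt (fun v => tbc (γ b) (β ((b - a)⁻¹ • v) b))
        (L.comp ((b - a)⁻¹ • ContinuousLinearMap.id ℝ (Eu n))) v₀ :=
      HasFDerivAt.comp (g := fun w => tbc (γ b) (β w b)) v₀ (by rw [hv₀']; exact hL) hsc
    have h2 := HasFDerivAt.comp (g := Prod.fst) v₀ hasFDerivAt_fst h1
    refine h2.congr_of_eventuallyEq ?_
    filter_upwards [hev] with v hv
    simp only [hv.2]
    rfl
  have hmd : MDifferentiableAt (𝓡 n) (𝓡 n) (expMap cov (γ a)) v₀ := by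
    refine mdifferentiableAt_iff_target.2 ⟨hcont, ?_⟩
    rw [hval]
    exact hd.differentiableAt.mdifferentiableAt
  refine ⟨hev.self_of_nhds.1, hval, hmd, fun hinj => hW ?_⟩
  set T : Eu n →L[ℝ] Eu n := tc (γ b) (expMap cov (γ a) v₀) with hT
  set D : Eu n →L[ℝ] Eu n := mfderiv (𝓡 n) (𝓡 n) (expMap cov (γ a)) v₀ with hD
  have h1 : HasFDerivAt (fun v => extChartAt (𝓡 n) (γ b) (expMap cov (γ a) v)) (T.comp D) v₀ := by
    have hTe : T = mfderiv (𝓡 n) 𝓘(ℝ, Eu n) (extChartAt (𝓡 n) (γ b)) (expMap cov (γ a) v₀) :=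
      tc_eq_mfderiv (by rw [hval]; exact hc)
    rw [hTe]
    exact (HasMFDerivAt.comp v₀ (mdifferentiableAt_extChartAt
      (by rw [hval]; exact hc)).hasMFDerivAt hmd.hasMFDerivAt).hasFDerivAt
  have h2 := h1.unique hd
  set w₀ : Eu n := W a
  have h3 : T (D w₀) = 0 := by
    refine (DFunLike.congr_fun h2 w₀).trans ?_
    change (L ((b - a)⁻¹ • w₀)).1 = 0
    rw [map_smul, Prod.smul_fst]
    have h4 : (L w₀).1 = tc (γ b) (γ b) (V b) := congrArg Prod.fst (hLJ V W hJ hVa)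
    rw [hVb, map_zero] at h4
    rw [h4, smul_zero]
  have hTinj : Function.Injective T := tc_injective (c := γ b) (by rw [hval]; exact hc)
  have h5 : D w₀ = D 0 := by
    rw [map_zero]
    exact hTinj (h3.trans (map_zero _).symm)
  exact hinj h5

end ConjugatePoints

/-! ### Forms, endomorphism fields and the exterior derivative in coordinates -/

section SmoothTensors

variable {n : ℕ} {M : Type*} [TopologicalSpace M] [ChartedSpace (EuclideanSpace ℝ (Fin n)) M]

theorem ContMDiffAt.contDiffAt_coord {f : M → ℝ} {c : M} {z : Eu n} (hz : z ∈ chTgt n c)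
    [IsManifold (𝓡 n) ∞ M] (hf : ContMDiffAt (𝓡 n) 𝓘(ℝ, ℝ) ∞ f (pt c z)) :
    ContDiffAt ℝ ∞ (fun z => f (pt c z)) z :=
  (ContMDiffAt.comp z hf
    ((contMDiffOn_extChartAt_symm c).contMDiffAt ((isOpen_chTgt c).mem_nhds hz))).contDiffAt

variable [IsManifold (𝓡 n) ∞ M]

theorem SmoothOneForm.contMDiffAt_apply {θ : ∀ x : M, TangentSpace (𝓡 n) x →L[ℝ] ℝ}
    (hθ : SmoothOneForm θ) {Y : ∀ x : M, TangentSpace (𝓡 n) x} {x : M}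
    (hY : SmoothFieldAt Y x) : ContMDiffAt (𝓡 n) 𝓘(ℝ, ℝ) ∞ (fun y => θ y (Y y)) x := by
  have h2 := ContMDiffAt.clm_bundle_apply (F₁ := EuclideanSpace ℝ (Fin n)) (F₂ := ℝ)
    (E₁ := (TangentSpace (𝓡 n) : M → Type _)) (E₂ := Bundle.Trivial M ℝ) (b := fun y => y)
    (ϕ := θ) (v := Y) (IB := 𝓡 n) (IM := 𝓡 n) (n := ∞) (hθ x) hY
  simpa [contMDiffAt_section] using h2

theorem SmoothEndField.smoothFieldAt {J : ∀ x : M, TangentSpace (𝓡 n) x →L[ℝ] TangentSpace (𝓡 n) x}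
    (hJ : SmoothEndField J) {Y : ∀ x : M, TangentSpace (𝓡 n) x} {x : M}
    (hY : SmoothFieldAt Y x) : SmoothFieldAt (fun y => J y (Y y)) x :=
  ContMDiffAt.clm_bundle_apply (F₁ := Eu n) (F₂ := Eu n)
    (E₁ := (TangentSpace (𝓡 n) : M → Type _)) (E₂ := (TangentSpace (𝓡 n) : M → Type _))
    (b := fun y => y) (ϕ := J) (v := Y) (IB := 𝓡 n) (IM := 𝓡 n) (n := ∞) (hJ x) hY

theorem SmoothEndField.fieldDiffAt {J : ∀ x : M, TangentSpace (𝓡 n) x →L[ℝ] TangentSpace (𝓡 n) x}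
    (hJ : SmoothEndField J) {Y : ∀ x : M, TangentSpace (𝓡 n) x} {x : M}
    (hY : FieldDiffAt Y x) : FieldDiffAt (fun y => J y (Y y)) x :=
  MDifferentiableAt.clm_bundle_apply (F₁ := Eu n) (F₂ := Eu n)
    (E₁ := (TangentSpace (𝓡 n) : M → Type _)) (E₂ := (TangentSpace (𝓡 n) : M → Type _))
    (b := fun y => y) (ϕ := J) (v := Y) (IB := 𝓡 n) (IM := 𝓡 n)
    ((hJ x).mdifferentiableAt (by simp)) hY

/-- The components of a one-form in the chart at `c`. -/
def formCoord (θ : ∀ x : M, TangentSpace (𝓡 n) x →L[ℝ] ℝ) (c : M) (z : Eu n) : Eu n →L[ℝ] ℝ :=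
  (θ (pt c z)).comp (ts c (pt c z))

/-- The components of a field of endomorphisms in the chart at `c`. -/
def endCoord (J : ∀ x : M, TangentSpace (𝓡 n) x →L[ℝ] TangentSpace (𝓡 n) x) (c : M) (z : Eu n) :
    Eu n →L[ℝ] Eu n :=
  (tc c (pt c z)).comp ((J (pt c z)).comp (ts c (pt c z)))

theorem SmoothOneForm.contDiffAt_formCoord {θ : ∀ x : M, TangentSpace (𝓡 n) x →L[ℝ] ℝ}
    (hθ : SmoothOneForm θ) {c : M} {z : Eu n} (hz : z ∈ chTgt n c) :
    ContDiffAt ℝ ∞ (formCoord θ c) z := by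
  have h : ContDiffOn ℝ ∞ (formCoord θ c) (chTgt n c) := contDiffOn_clm_apply.2 fun w z hz =>
    (ContMDiffAt.contDiffAt_coord hz
      (hθ.contMDiffAt_apply (smoothFieldAt_cfield (pt_mem hz) w))).contDiffWithinAt
  exact h.contDiffAt ((isOpen_chTgt c).mem_nhds hz)

theorem SmoothEndField.contDiffAt_endCoord
    {J : ∀ x : M, TangentSpace (𝓡 n) x →L[ℝ] TangentSpace (𝓡 n) x}
    (hJ : SmoothEndField J) {c : M} {z : Eu n} (hz : z ∈ chTgt n c) :
    ContDiffAt ℝ ∞ (endCoord J c) z := by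
  have h : ContDiffOn ℝ ∞ (endCoord J c) (chTgt n c) := contDiffOn_clm_apply.2 fun w z hz => by
    have := (smoothFieldAt_iff (pt_mem hz) _).1
      (hJ.smoothFieldAt (smoothFieldAt_cfield (pt_mem hz) w))
    rw [ch_pt hz] at this
    exact this.contDiffWithinAt
  exact h.contDiffAt ((isOpen_chTgt c).mem_nhds hz)

theorem fderiv_clm_apply_const {E F G : Type*} [NormedAddCommGroup E] [NormedSpace ℝ E]
    [NormedAddCommGroup F] [NormedSpace ℝ F] [NormedAddCommGroup G] [NormedSpace ℝ G]
    {A : E → F →L[ℝ] G} {z : E} (hA : DifferentiableAt ℝ A z) (u : E) (w : F) :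
    fderiv ℝ (fun z => A z w) z u = fderiv ℝ A z u w := by
  have := (hA.hasFDerivAt.clm_apply (hasFDerivAt_const w z)).fderiv
  rw [this]
  simp

theorem two_mul_extDerivForm_coord {θ : ∀ x : M, TangentSpace (𝓡 n) x →L[ℝ] ℝ}
    (hθ : SmoothOneForm θ) {c x : M} (hx : x ∈ chSrc n c) (u v : Eu n) :
    2 * extDerivForm θ hθ x (ts c x u) (ts c x v) =
      fderiv ℝ (formCoord θ c) (extChartAt (𝓡 n) c x) u v -
        fderiv ℝ (formCoord θ c) (extChartAt (𝓡 n) c x) v u := by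
  have hu := fieldDiffAt_cfield hx u
  have hv := fieldDiffAt_cfield hx v
  have h := extDerivForm_apply hθ hu hv
  have hd : DifferentiableAt ℝ (formCoord θ c) (extChartAt (𝓡 n) c x) :=
    (hθ.contDiffAt_formCoord (ch_mem hx)).differentiableAt (by simp)
  have hm : ∀ w w' : Eu n, mvfderiv (𝓡 n) (fun y => θ y (cfield c w y)) x (ts c x w') =
      fderiv ℝ (formCoord θ c) (extChartAt (𝓡 n) c x) w' w := fun w w' => by
    have h1 := mvfderiv_coord (f := fun y => θ y (cfield c w y)) hx
      (hd.clm_apply (differentiableAt_const w)) (ts c x w')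
    rw [h1, tc_ts hx]
    exact fderiv_clm_apply_const hd w' w
  have hb : VectorField.mlieBracket (𝓡 n) (cfield c u) (cfield c v) x = 0 := by
    apply tc_injective hx
    rw [tc_mlieBracket hx hu hv, (crepr_cfield_eventuallyEq hx v).fderiv_eq,
      (crepr_cfield_eventuallyEq hx u).fderiv_eq]
    simp
  rw [hb, map_zero] at h
  have h1 := hm v u
  have h2 := hm u v
  simp only [cfield] at h h1 h2
  rw [h, h1, h2]
  ring

end SmoothTensors

/-! ### Algebra of the pseudo-Hermitian structure -/

namespace PseudoHermitian

variable {m : ℕ} {M : Type*} [TopologicalSpace M]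
  [ChartedSpace (EuclideanSpace ℝ (Fin (2 * m + 1))) M] [IsManifold (𝓡 (2 * m + 1)) ∞ M]
  (S : PseudoHermitian m M) {x : M}

theorem J_reeb (x : M) : S.J x (S.reeb x) = 0 := S.J_vertical x _ (S.reeb_spec x).2

theorem θ_reeb (x : M) : S.θ x (S.reeb x) = 1 := (S.reeb_spec x).1

theorem dθ_swap (x : M) (v w : TangentSpace (𝓡 (2 * m + 1)) x) : S.dθ x v w = -S.dθ x w v :=
  extDerivForm_swap S.smooth_θ x v w

theorem dθ_reeb_left (x : M) (w : TangentSpace (𝓡 (2 * m + 1)) x) : S.dθ x (S.reeb x) w = 0 :=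
  (S.reeb_spec x).2 w

theorem θ_projH (x : M) (v : TangentSpace (𝓡 (2 * m + 1)) x) : S.θ x (S.projH x v) = 0 := by
  rw [projH, map_sub, map_smul, θ_reeb]
  simp

theorem J_projH (x : M) (v : TangentSpace (𝓡 (2 * m + 1)) x) :
    S.J x (S.projH x v) = S.J x v := by
  rw [projH, map_sub, map_smul, J_reeb, smul_zero, sub_zero]

theorem dθ_projH_left (x : M) (v w : TangentSpace (𝓡 (2 * m + 1)) x) :
    S.dθ x (S.projH x v) w = S.dθ x v w := by
  rw [projH, map_sub, map_smul, sub_apply, smul_apply, dθ_reeb_left, smul_zero, sub_zero]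

theorem dθ_projH_right (x : M) (v w : TangentSpace (𝓡 (2 * m + 1)) x) :
    S.dθ x v (S.projH x w) = S.dθ x v w := by
  rw [dθ_swap, dθ_projH_left, ← dθ_swap]

theorem θ_J_apply (x : M) (v : TangentSpace (𝓡 (2 * m + 1)) x) : S.θ x (S.J x v) = 0 := by
  rw [← J_projH]
  exact S.θ_J x _ (S.θ_projH x v)

theorem J_J_apply (x : M) (v : TangentSpace (𝓡 (2 * m + 1)) x) :
    S.J x (S.J x v) = -S.projH x v := by
  rw [← S.J_projH x v]
  exact S.J_J x _ (S.θ_projH x v)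

theorem metric_eq (x : M) (v w : TangentSpace (𝓡 (2 * m + 1)) x) :
    S.metric x v w = S.θ x v * S.θ x w + S.dθ x v (S.J x w) := by
  rw [metric, J_projH, dθ_projH_left]

/-- A horizontal vector field extending a horizontal vector. -/
def horizontalExtend (v : TangentSpace (𝓡 (2 * m + 1)) x) (y : M) :
    TangentSpace (𝓡 (2 * m + 1)) y := S.projH y (extendVec v y)

/-- The projection π_H equals -J², so its regularity follows from that of J, with no appeal to
regularity of ξ. -/
theorem horizontalExtend_eq (v : TangentSpace (𝓡 (2 * m + 1)) x) :
    S.horizontalExtend v = fun y => -S.J y (S.J y (extendVec v y)) := by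
  funext y
  rw [J_J_apply, neg_neg, horizontalExtend]

theorem θ_horizontalExtend (v : TangentSpace (𝓡 (2 * m + 1)) x) (y : M) :
    S.θ y (S.horizontalExtend v y) = 0 := S.θ_projH y _

theorem horizontalExtend_self {v : TangentSpace (𝓡 (2 * m + 1)) x} (hv : S.θ x v = 0) :
    S.horizontalExtend v x = v := by
  rw [horizontalExtend, extendVec, FiberBundle.extend_apply_self, projH, hv, zero_smul, sub_zero]

theorem fieldDiffAt_horizontalExtend (v : TangentSpace (𝓡 (2 * m + 1)) x) :
    FieldDiffAt (S.horizontalExtend v) x := by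
  rw [horizontalExtend_eq]
  exact mdifferentiableAt_neg_section (S.smooth_J.fieldDiffAt (S.smooth_J.fieldDiffAt
    (smoothFieldAt_extendVec v).fieldDiffAt))

/-- For horizontal fields dθ(X,Y) = -½θ([X,Y]), and integrability says that [X,Y] - [JX,JY] is
horizontal. Vertical components contribute nothing to either side. -/
theorem dθ_J_J (x : M) (v w : TangentSpace (𝓡 (2 * m + 1)) x) :
    S.dθ x (S.J x v) (S.J x w) = S.dθ x v w := by
  wlog hv : S.θ x v = 0 generalizing v
  · have := this (S.projH x v) (S.θ_projH x v)
    rwa [J_projH, dθ_projH_left] at this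
  wlog hw : S.θ x w = 0 generalizing w
  · have := this (S.projH x w) (S.θ_projH x w)
    rwa [J_projH, dθ_projH_right] at this
  have key : ∀ X Y : ∀ y : M, TangentSpace (𝓡 (2 * m + 1)) y, (∀ y, S.θ y (X y) = 0) →
      (∀ y, S.θ y (Y y) = 0) → FieldDiffAt X x → FieldDiffAt Y x →
      S.dθ x (X x) (Y x) = -(1 / 2) * S.θ x (VectorField.mlieBracket (𝓡 (2 * m + 1)) X Y x) := by
    intro X Y hX hY hXd hYd
    rw [dθ, extDerivForm_apply S.smooth_θ hXd hYd]
    simp only [hX, hY]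
    have h0 : mvfderiv (𝓡 (2 * m + 1)) (fun _ : M => (0 : ℝ)) x = 0 := by
      exact mvfderiv_const 0
    rw [h0]
    simp
  set X := S.horizontalExtend v
  set Y := S.horizontalExtend w
  have hX := S.θ_horizontalExtend v
  have hY := S.θ_horizontalExtend w
  have hXd := S.fieldDiffAt_horizontalExtend v
  have hYd := S.fieldDiffAt_horizontalExtend w
  have h1 := key X Y hX hY hXd hYd
  have h2 := key (fun y => S.J y (X y)) (fun y => S.J y (Y y)) (fun y => S.θ_J_apply y _)
    (fun y => S.θ_J_apply y _) (S.smooth_J.fieldDiffAt hXd) (S.smooth_J.fieldDiffAt hYd)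
  have h3 := S.integrable_horizontal X Y x hX hY hXd hYd
  rw [map_sub, sub_eq_zero] at h3
  rw [show X x = v from S.horizontalExtend_self hv,
    show Y x = w from S.horizontalExtend_self hw] at h1 h2
  rw [h1, h2, h3]

theorem metric_comm (x : M) (v w : TangentSpace (𝓡 (2 * m + 1)) x) :
    S.metric x v w = S.metric x w v := by
  rw [metric_eq, metric_eq, mul_comm, ← S.dθ_J_J x v, J_J_apply, map_neg, dθ_projH_right,
    ← dθ_swap]

theorem metric_reeb_right (x : M) (v : TangentSpace (𝓡 (2 * m + 1)) x) :
    S.metric x v (S.reeb x) = S.θ x v := by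
  rw [metric_eq, θ_reeb, J_reeb, map_zero, mul_one, add_zero]

theorem metric_reeb_left (x : M) (v : TangentSpace (𝓡 (2 * m + 1)) x) :
    S.metric x (S.reeb x) v = S.θ x v := by
  rw [metric_comm, metric_reeb_right]

theorem metric_self_nonneg (x : M) (v : TangentSpace (𝓡 (2 * m + 1)) x) :
    0 ≤ S.metric x v v := by
  by_cases h : S.projH x v = 0
  · rw [metric, h, map_zero, zero_apply, add_zero]
    exact mul_self_nonneg _
  · exact add_nonneg (mul_self_nonneg _) (S.levi_pos x _ (S.θ_projH x v) h).le

theorem eq_zero_of_metric_self (x : M) {v : TangentSpace (𝓡 (2 * m + 1)) x}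
    (hv : S.metric x v v = 0) : v = 0 := by
  by_cases h : S.projH x v = 0
  · rw [metric, h, map_zero, zero_apply, add_zero] at hv
    rw [projH, mul_self_eq_zero.1 hv, zero_smul, sub_zero] at h
    exact h
  · have := S.levi_pos x _ (S.θ_projH x v) h
    rw [metric] at hv
    have h2 := mul_self_nonneg (S.θ x v)
    change 0 < S.dθ x _ _ at this
    linarith

theorem metric_J_J (x : M) (v : TangentSpace (𝓡 (2 * m + 1)) x) :
    S.metric x (S.J x v) (S.J x v) = S.metric x v v - S.θ x v ^ 2 := by
  rw [metric_eq, metric_eq, θ_J_apply, dθ_J_J]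
  ring

theorem metric_add_left (x : M) (u v w : TangentSpace (𝓡 (2 * m + 1)) x) :
    S.metric x (u + v) w = S.metric x u w + S.metric x v w := by
  rw [metric_eq, metric_eq, metric_eq, map_add, map_add, add_apply]; ring

theorem metric_smul_left (x : M) (r : ℝ) (v w : TangentSpace (𝓡 (2 * m + 1)) x) :
    S.metric x (r • v) w = r * S.metric x v w := by
  rw [metric_eq, metric_eq, map_smul, map_smul, smul_apply, smul_eq_mul, smul_eq_mul]; ring

theorem metric_add_right (x : M) (u v w : TangentSpace (𝓡 (2 * m + 1)) x) :
    S.metric x u (v + w) = S.metric x u v + S.metric x u w := by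
  rw [metric_comm, metric_add_left, metric_comm, S.metric_comm x w]

theorem metric_smul_right (x : M) (r : ℝ) (v w : TangentSpace (𝓡 (2 * m + 1)) x) :
    S.metric x v (r • w) = r * S.metric x v w := by
  rw [metric_comm, metric_smul_left, metric_comm]

/-- The Reeb field is defined by choice at each point. Smoothness comes from w + J²w = θ(w)ξ,
applied to a smooth field w with θ(w) ≠ 0 near x. -/
theorem smoothFieldAt_reeb (x : M) : SmoothFieldAt S.reeb x := by
  have hx : x ∈ chSrc (2 * m + 1) x := mem_chart_source _ _
  obtain ⟨w, hw⟩ : ∃ w : TangentSpace (𝓡 (2 * m + 1)) x, S.θ x w ≠ 0 :=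
    ⟨S.reeb x, by rw [θ_reeb]; exact one_ne_zero⟩
  have hs := smoothFieldAt_extendVec w
  have hθ := S.smooth_θ.contMDiffAt_apply hs
  have hne : S.θ x (extendVec w x) ≠ 0 := by
    rwa [extendVec, FiberBundle.extend_apply_self]
  have h1 := (hθ.inv₀ hne).smul_section
    (hs.add_section (S.smooth_J.smoothFieldAt (S.smooth_J.smoothFieldAt hs)))
  refine h1.congr_of_eventuallyEq ?_
  filter_upwards [hθ.continuousAt.eventually_ne hne] with y hy
  congr 1
  change S.reeb y = (S.θ y (extendVec w y))⁻¹ •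
    (extendVec w y + S.J y (S.J y (extendVec w y)))
  rw [J_J_apply, projH, neg_sub, add_sub_cancel, smul_smul, inv_mul_cancel₀ hy, one_smul]

end PseudoHermitian

/-- The derivative of A is stated with its vector argument frozen, the form in which the parallelism
equations `fderiv_endCoord` and `fderiv_metricCoord` are available. -/
theorem HasDerivWithinAt.clm_along {E F G : Type*} [NormedAddCommGroup E] [NormedSpace ℝ E]
    [NormedAddCommGroup F] [NormedSpace ℝ F] [NormedAddCommGroup G] [NormedSpace ℝ G]
    {A : E → F →L[ℝ] G} {f : ℝ → E} {v : ℝ → F} {f' : E} {v' : F} {s : Set ℝ} {t : ℝ}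
    (hA : DifferentiableAt ℝ A (f t)) (hf : HasDerivWithinAt f f' s t)
    (hv : HasDerivWithinAt v v' s t) :
    HasDerivWithinAt (fun r => A (f r) (v r))
      (fderiv ℝ (fun z => A z (v t)) (f t) f' + A (f t) v') s t := by
  rw [fderiv_clm_apply_const hA]
  exact (hA.hasFDerivAt.along hf).clm_apply hv

set_option synthInstance.maxHeartbeats 200000 in
theorem HasDerivWithinAt.clm_along₂ {E F F' G : Type*} [NormedAddCommGroup E] [NormedSpace ℝ E]
    [NormedAddCommGroup F] [NormedSpace ℝ F] [NormedAddCommGroup F'] [NormedSpace ℝ F']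
    [NormedAddCommGroup G] [NormedSpace ℝ G] {A : E → F →L[ℝ] F' →L[ℝ] G} {f : ℝ → E}
    {v : ℝ → F} {w : ℝ → F'} {f' : E} {v' : F} {w' : F'} {s : Set ℝ} {t : ℝ}
    (hA : DifferentiableAt ℝ A (f t)) (hf : HasDerivWithinAt f f' s t)
    (hv : HasDerivWithinAt v v' s t) (hw : HasDerivWithinAt w w' s t) :
    HasDerivWithinAt (fun r => A (f r) (v r) (w r))
      (fderiv ℝ (fun z => A z (v t) (w t)) (f t) f' + A (f t) v' (w t) + A (f t) (v t) w') s t := by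
  have h := (HasDerivWithinAt.clm_along (G := F' →L[ℝ] G) hA hf hv).clm_apply hw
  have hd : DifferentiableAt ℝ (fun z => A z (v t)) (f t) :=
    DifferentiableAt.clm_apply (H := F' →L[ℝ] G) hA (differentiableAt_const _)
  rwa [add_apply, ← fderiv_clm_apply_const hd] at h

/-! ### The Webster metric in coordinates and the parallel tensors -/

namespace PseudoHermitian

variable {m : ℕ} {M : Type*} [TopologicalSpace M]
  [ChartedSpace (EuclideanSpace ℝ (Fin (2 * m + 1))) M] [IsManifold (𝓡 (2 * m + 1)) ∞ M]
  (S : PseudoHermitian m M) {cov : LinearConnection (2 * m + 1) M} {c x : M}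
  {z : Eu (2 * m + 1)}

/-- The components of the Webster metric in the chart at `c`. -/
def metricCoord (c : M) (z : Eu (2 * m + 1)) : Eu (2 * m + 1) →L[ℝ] Eu (2 * m + 1) →L[ℝ] ℝ :=
  (formCoord S.θ c z).smulRight (formCoord S.θ c z) +
    (1 / 2 : ℝ) • (fderiv ℝ (formCoord S.θ c) z - (fderiv ℝ (formCoord S.θ c) z).flip).bilinearComp
      (ContinuousLinearMap.id ℝ (Eu (2 * m + 1))) (endCoord S.J c z)

theorem metricCoord_eq (c : M) (z u v : Eu (2 * m + 1)) : S.metricCoord c z u v =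
    formCoord S.θ c z u * formCoord S.θ c z v +
      (1 / 2) * (fderiv ℝ (formCoord S.θ c) z u (endCoord S.J c z v) -
        fderiv ℝ (formCoord S.θ c) z (endCoord S.J c z v) u) := rfl

theorem metricCoord_pt (hz : z ∈ chTgt (2 * m + 1) c) (u v : Eu (2 * m + 1)) :
    S.metricCoord c z u v = S.metric (pt c z) (ts c (pt c z) u) (ts c (pt c z) v) := by
  have hx := pt_mem hz
  have h := two_mul_extDerivForm_coord S.smooth_θ hx u (endCoord S.J c z v)
  rw [ch_pt hz] at h
  have h2 : ts c (pt c z) (endCoord S.J c z v) = S.J (pt c z) (ts c (pt c z) v) := ts_tc hx _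
  rw [h2] at h
  rw [metricCoord_eq, ← h, metric_eq, dθ, ← mul_assoc]
  norm_num
  rfl

theorem metricCoord_apply (hx : x ∈ chSrc (2 * m + 1) c) (u v : Eu (2 * m + 1)) :
    S.metricCoord c (extChartAt (𝓡 (2 * m + 1)) c x) u v = S.metric x (ts c x u) (ts c x v) := by
  have := S.metricCoord_pt (ch_mem hx) u v
  rwa [pt_ch hx] at this

theorem metricCoord_tc (hx : x ∈ chSrc (2 * m + 1) c) (v w : TangentSpace (𝓡 (2 * m + 1)) x) :
    S.metricCoord c (extChartAt (𝓡 (2 * m + 1)) c x) (tc c x v) (tc c x w) = S.metric x v w := by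
  rw [metricCoord_apply S hx, ts_tc hx, ts_tc hx]

theorem contDiffAt_metricCoord (hz : z ∈ chTgt (2 * m + 1) c) :
    ContDiffAt ℝ ∞ (S.metricCoord c) z := by
  have h : ContDiffOn ℝ ∞ (S.metricCoord c) (chTgt (2 * m + 1) c) := by
    refine contDiffOn_clm_apply.2 fun u => contDiffOn_clm_apply.2 fun v z hz => ?_
    have hθ := S.smooth_θ.contDiffAt_formCoord hz
    have hJ := S.smooth_J.contDiffAt_endCoord hz
    have hd : ContDiffAt ℝ ∞ (fderiv ℝ (formCoord S.θ c)) z := hθ.fderiv_right (by simp)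
    have hJv : ContDiffAt ℝ ∞ (fun z => endCoord S.J c z v) z := hJ.clm_apply contDiffAt_const
    exact (((hθ.clm_apply contDiffAt_const).mul (hθ.clm_apply contDiffAt_const)).add
      (contDiffAt_const.mul (((hd.clm_apply contDiffAt_const).clm_apply hJv).sub
        ((hd.clm_apply hJv).clm_apply contDiffAt_const)))).contDiffWithinAt
  exact h.contDiffAt ((isOpen_chTgt c).mem_nhds hz)

theorem projH_add_reeb (x : M) (v : TangentSpace (𝓡 (2 * m + 1)) x) :
    S.projH x (S.θ x v • S.reeb x + S.projH x v) = S.projH x v := by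
  rw [projH, projH, add_sub_cancel]

theorem metric_zero_left (x : M) (w : TangentSpace (𝓡 (2 * m + 1)) x) : S.metric x 0 w = 0 := by
  rw [metric_eq, map_zero, map_zero, zero_apply, zero_mul, add_zero]

theorem metric_neg_left (x : M) (v w : TangentSpace (𝓡 (2 * m + 1)) x) :
    S.metric x (-v) w = -S.metric x v w := by
  rw [← neg_one_smul ℝ v, metric_smul_left, neg_one_mul]

namespace IsTanakaWebster

variable {S}

theorem fderiv_metricCoord (hTW : S.IsTanakaWebster cov) (hz : z ∈ chTgt (2 * m + 1) c) (u a b : Eu (2 * m + 1)) :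
    fderiv ℝ (fun z => S.metricCoord c z a b) z u =
      S.metricCoord c z (christoffel cov c z u a) b +
        S.metricCoord c z a (christoffel cov c z u b) := by
  have hx := pt_mem hz
  have h := hTW.metric_parallel (cfield c a) (cfield c b) (pt c z) (ts c (pt c z) u)
    (fieldDiffAt_cfield hx a) (fieldDiffAt_cfield hx b)
  have he : (fun z => S.metric (pt c z) (cfield c a (pt c z)) (cfield c b (pt c z))) =ᶠ[𝓝 z]
      fun z => S.metricCoord c z a b := by
    filter_upwards [(isOpen_chTgt c).mem_nhds hz] with z' hz'
    exact (S.metricCoord_pt hz' a b).symm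
  have hd : DifferentiableAt ℝ (fun z => S.metricCoord c z a b) z :=
    (((S.contDiffAt_metricCoord hz).clm_apply contDiffAt_const).clm_apply
      contDiffAt_const).differentiableAt (by simp)
  have hc := ch_pt hz
  rw [mvfderiv_coord hx (by rw [hc]; exact hd.congr_of_eventuallyEq he), hc, he.fderiv_eq,
    tc_ts hx] at h
  rw [h, S.metricCoord_pt hz, S.metricCoord_pt hz]
  have e : ∀ w, cov (cfield c w) (pt c z) (ts c (pt c z) u) =
      ts c (pt c z) (christoffel cov c z u w) := fun w => by
    have := tc_cov_cfield (cov := cov) hx w (ts c (pt c z) u)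
    rw [tc_ts hx, hc] at this
    rw [← this, ts_tc hx]
  rw [e, e]
  rfl

theorem fderiv_endCoord (hTW : S.IsTanakaWebster cov) (hz : z ∈ chTgt (2 * m + 1) c) (u w : Eu (2 * m + 1)) :
    fderiv ℝ (fun z => endCoord S.J c z w) z u = endCoord S.J c z (christoffel cov c z u w) -
      christoffel cov c z u (endCoord S.J c z w) := by
  have hx := pt_mem hz
  have hc := ch_pt hz
  have h := congrArg (tc c (pt c z)) (hTW.J_parallel (cfield c w) (pt c z) (ts c (pt c z) u)
    (fieldDiffAt_cfield hx w))
  rw [tc_cov hx (S.smooth_J.fieldDiffAt (fieldDiffAt_cfield hx w)), tc_ts hx, hc] at h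
  have e : cov (cfield c w) (pt c z) (ts c (pt c z) u) =
      ts c (pt c z) (christoffel cov c z u w) := by
    have := tc_cov_cfield (cov := cov) hx w (ts c (pt c z) u)
    rw [tc_ts hx, hc] at this
    rw [← this, ts_tc hx]
  rw [e] at h
  exact eq_sub_of_add_eq h

/-- Since |ξ| = 1, the vector ∇ξ is horizontal. Since ξ is orthogonal to H and ∇ preserves H, ∇ξ is
also orthogonal to every horizontal vector, in particular to itself. -/
theorem cov_reeb (hTW : S.IsTanakaWebster cov) (v : TangentSpace (𝓡 (2 * m + 1)) x) : cov S.reeb x v = 0 := by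
  have hξ := (S.smoothFieldAt_reeb x).fieldDiffAt
  have hconst : ∀ (f : M → ℝ) (r : ℝ), (∀ y, f y = r) →
      mvfderiv (𝓡 (2 * m + 1)) f x v = 0 := fun f r hf => by
    rw [show f = fun _ => r from funext hf, mvfderiv_const]
    rfl
  have h1 := hTW.metric_parallel S.reeb S.reeb x v hξ hξ
  rw [hconst _ 1 (fun y => by rw [metric_reeb_left, θ_reeb]), metric_reeb_right,
    metric_reeb_left] at h1
  have h2 : S.θ x (cov S.reeb x v) = 0 := by linarith
  have h3 := hTW.metric_parallel S.reeb (S.horizontalExtend (cov S.reeb x v)) x v hξ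
    (S.fieldDiffAt_horizontalExtend _)
  have h4 := hTW.horizontal (S.horizontalExtend (cov S.reeb x v)) x v
    (S.fieldDiffAt_horizontalExtend _) (S.θ_horizontalExtend _)
  rw [hconst _ 0 (fun y => by rw [metric_reeb_left, θ_horizontalExtend]), metric_reeb_left,
    S.horizontalExtend_self h2, show S.θ x _ = 0 from h4, add_zero] at h3
  exact S.eq_zero_of_metric_self x h3.symm

theorem fderiv_reeb (hTW : S.IsTanakaWebster cov) (hz : z ∈ chTgt (2 * m + 1) c) (u : Eu (2 * m + 1)) :
    fderiv ℝ (crepr c S.reeb) z u = -christoffel cov c z u (crepr c S.reeb z) := by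
  have hx := pt_mem hz
  have h := tc_cov (cov := cov) hx (S.smoothFieldAt_reeb _).fieldDiffAt (ts c (pt c z) u)
  rw [hTW.cov_reeb, map_zero, tc_ts hx, ch_pt hz] at h
  exact eq_neg_of_add_eq_zero_left h.symm

/-- The formula for horizontal vectors extends to all vectors because both sides vanish when one
argument is ξ. -/
theorem torsion_eq (hTW : S.IsTanakaWebster cov) (hS : S.IsSasakian cov) (v w : TangentSpace (𝓡 (2 * m + 1)) x) :
    cov.torsion x v w = (2 * S.dθ x v w) • S.reeb x := by
  have hv : v = S.projH x v + S.θ x v • S.reeb x := (sub_add_cancel _ _).symm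
  have hw : w = S.projH x w + S.θ x w • S.reeb x := (sub_add_cancel _ _).symm
  have hS' : ∀ u, cov.torsion x u (S.reeb x) = 0 := fun u => by
    rw [cov.torsion_antisymm, hS, neg_zero]
  have h := hTW.torsion_horizontal x _ (S.θ_projH x v) _ (S.θ_projH x w)
  rw [dθ_projH_left, dθ_projH_right] at h
  rw [← h]
  conv_lhs => rw [hv, hw]
  rw [map_add (cov.torsion x _), map_smul (cov.torsion x _), hS', smul_zero, add_zero, map_add,
    map_smul, add_apply, smul_apply, hS, smul_zero, add_zero]

theorem christoffel_sub (hTW : S.IsTanakaWebster cov) (hS : S.IsSasakian cov) (hz : z ∈ chTgt (2 * m + 1) c)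
    (u v : Eu (2 * m + 1)) :
    christoffel cov c z u v - christoffel cov c z v u =
      (fderiv ℝ (formCoord S.θ c) z u v - fderiv ℝ (formCoord S.θ c) z v u) •
        crepr c S.reeb z := by
  have hx := pt_mem hz
  have h := tc_torsion (cov := cov) hx u v
  have h2 := two_mul_extDerivForm_coord S.smooth_θ hx u v
  rw [hTW.torsion_eq hS, map_smul, dθ, h2, ch_pt hz] at h
  exact h.symm

/-! ### Curvature of the Tanaka–Webster connection in the Sasakian case -/

section Curvature

variable [T2Space M]

theorem metric_curvature_swap_right (hTW : S.IsTanakaWebster cov) (a b v w : TangentSpace (𝓡 (2 * m + 1)) x) :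
    S.metric x (curvature cov x a b v) w = -S.metric x (curvature cov x a b w) v := by
  have hx : x ∈ chSrc (2 * m + 1) x := mem_chart_source _ _
  have hz := ch_mem hx
  have h := coordCurvature_skew
    ((contDiffOn_christoffel hTW.smooth x).contDiffAt ((isOpen_chTgt x).mem_nhds hz))
    (S.contDiffAt_metricCoord hz)
    (Filter.eventually_of_mem ((isOpen_chTgt x).mem_nhds hz)
      fun z hz u a b => hTW.fderiv_metricCoord hz u a b)
    (tc x x a) (tc x x b) (tc x x v) (tc x x w)
  rw [← tc_curvature hTW.smooth hx, ← tc_curvature hTW.smooth hx, S.metricCoord_tc hx,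
    S.metricCoord_tc hx] at h
  rw [h, S.metric_comm x v]

theorem curvature_reeb_right (hTW : S.IsTanakaWebster cov) (u v : TangentSpace (𝓡 (2 * m + 1)) x) :
    curvature cov x u v (S.reeb x) = 0 := by
  have hx : x ∈ chSrc (2 * m + 1) x := mem_chart_source _ _
  have hz := ch_mem hx
  have h := coordCurvature_parallel
    ((contDiffOn_christoffel hTW.smooth x).contDiffAt ((isOpen_chTgt x).mem_nhds hz))
    ((smoothFieldAt_iff hx _).1 (S.smoothFieldAt_reeb x))
    (Filter.eventually_of_mem ((isOpen_chTgt x).mem_nhds hz) fun z hz u => hTW.fderiv_reeb hz u)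
    (tc x x u) (tc x x v)
  apply tc_injective hx
  rw [tc_curvature hTW.smooth hx, map_zero, ← h, crepr, pt_ch hx]

theorem curvature_bianchi (hTW : S.IsTanakaWebster cov) (hS : S.IsSasakian cov) (u v w : TangentSpace (𝓡 (2 * m + 1)) x) :
    curvature cov x u v w + curvature cov x v w u + curvature cov x w u v = 0 := by
  have hx : x ∈ chSrc (2 * m + 1) x := mem_chart_source _ _
  have hz := ch_mem hx
  have h := coordCurvature_bianchi
    ((contDiffOn_christoffel hTW.smooth x).contDiffAt ((isOpen_chTgt x).mem_nhds hz))
    ((smoothFieldAt_iff hx _).1 (S.smoothFieldAt_reeb x))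
    (S.smooth_θ.contDiffAt_formCoord hz)
    (Filter.eventually_of_mem ((isOpen_chTgt x).mem_nhds hz) fun z hz u => hTW.fderiv_reeb hz u)
    (Filter.eventually_of_mem ((isOpen_chTgt x).mem_nhds hz)
      fun z hz u v => hTW.christoffel_sub hS hz u v)
    (tc x x u) (tc x x v) (tc x x w)
  apply tc_injective hx
  rw [map_add, map_add, tc_curvature hTW.smooth hx, tc_curvature hTW.smooth hx,
    tc_curvature hTW.smooth hx, map_zero, h]

theorem curvature_swap (hcov : cov.ContMDiffCovariantDerivative ∞)
    (u v w : TangentSpace (𝓡 (2 * m + 1)) x) :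
    curvature cov x u v w = -curvature cov x v u w := by
  have hx : x ∈ chSrc (2 * m + 1) x := mem_chart_source _ _
  apply tc_injective hx
  rw [map_neg, tc_curvature hcov hx, tc_curvature hcov hx, coordCurvature_swap]

theorem metric_curvature_pair (hTW : S.IsTanakaWebster cov) (hS : S.IsSasakian cov) (a b v w : TangentSpace (𝓡 (2 * m + 1)) x) :
    S.metric x (curvature cov x a b v) w = S.metric x (curvature cov x v w a) b := by
  refine pair_symm_of_bianchi (r := fun a b v w => S.metric x (curvature cov x a b v) w)
    (fun a b v w => ?_) (fun a b v w => hTW.metric_curvature_swap_right a b v w)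
    (fun a b v w => ?_) a b v w
  · rw [curvature_swap hTW.smooth, metric_neg_left]
  · rw [← metric_add_left, ← metric_add_left, hTW.curvature_bianchi hS, metric_zero_left]

/-- Pair symmetry moves ξ into the last slot of R, where it gives zero because ξ is parallel. -/
theorem curvature_reeb_left (hTW : S.IsTanakaWebster cov) (hS : S.IsSasakian cov) (v w : TangentSpace (𝓡 (2 * m + 1)) x) :
    curvature cov x (S.reeb x) v w = 0 := by
  apply S.eq_zero_of_metric_self x
  rw [hTW.metric_curvature_pair hS, curvature_reeb_right hTW, metric_zero_left]

theorem curvature_add_left (hcov : cov.ContMDiffCovariantDerivative ∞)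
    (u u' v w : TangentSpace (𝓡 (2 * m + 1)) x) :
    curvature cov x (u + u') v w = curvature cov x u v w + curvature cov x u' v w := by
  have hx : x ∈ chSrc (2 * m + 1) x := mem_chart_source _ _
  apply tc_injective hx
  simp only [tc_curvature hcov hx, map_add, coordCurvature_add_left]

theorem curvature_smul_left (hcov : cov.ContMDiffCovariantDerivative ∞) (r : ℝ)
    (u v w : TangentSpace (𝓡 (2 * m + 1)) x) :
    curvature cov x (r • u) v w = r • curvature cov x u v w := by
  have hx : x ∈ chSrc (2 * m + 1) x := mem_chart_source _ _
  apply tc_injective hx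
  simp only [tc_curvature hcov hx, map_smul, coordCurvature_smul_left]

theorem curvature_add_right (hcov : cov.ContMDiffCovariantDerivative ∞)
    (u v w w' : TangentSpace (𝓡 (2 * m + 1)) x) :
    curvature cov x u v (w + w') = curvature cov x u v w + curvature cov x u v w' := by
  have hx : x ∈ chSrc (2 * m + 1) x := mem_chart_source _ _
  apply tc_injective hx
  simp only [tc_curvature hcov hx, map_add, coordCurvature_add_right]

theorem curvature_smul_right (hcov : cov.ContMDiffCovariantDerivative ∞) (r : ℝ)
    (u v w : TangentSpace (𝓡 (2 * m + 1)) x) :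
    curvature cov x u v (r • w) = r • curvature cov x u v w := by
  have hx : x ∈ chSrc (2 * m + 1) x := mem_chart_source _ _
  apply tc_injective hx
  simp only [tc_curvature hcov hx, map_smul, coordCurvature_smul_right]

/-- The Jacobi operator `R(·, u)u` only sees the horizontal part of `u`. -/
theorem curvature_projH (hTW : S.IsTanakaWebster cov) (hS : S.IsSasakian cov)
    (a u : TangentSpace (𝓡 (2 * m + 1)) x) :
    curvature cov x a u u = curvature cov x a (S.projH x u) (S.projH x u) := by
  have hu : u = S.θ x u • S.reeb x + S.projH x u := (add_sub_cancel _ _).symm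
  have hr : ∀ v, curvature cov x a v u = curvature cov x a v (S.projH x u) := fun v => by
    conv_lhs => rw [hu]
    rw [curvature_add_right hTW.smooth, curvature_smul_right hTW.smooth, hTW.curvature_reeb_right,
      smul_zero, zero_add]
  rw [hr, curvature_swap hTW.smooth, curvature_swap hTW.smooth a]
  conv_lhs => rw [hu]
  rw [S.projH_add_reeb, curvature_add_left hTW.smooth, curvature_smul_left hTW.smooth,
    hTW.curvature_reeb_left hS, smul_zero, zero_add]

end Curvature

/-! ### Fields along a curve -/

section Curves

variable {γ : ℝ → M} {U V W D D' : ∀ t, TangentSpace (𝓡 (2 * m + 1)) (γ t)} {s : Set ℝ} {t : ℝ}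

theorem hasCovDerivAt_J (hTW : S.IsTanakaWebster cov) (hU : HasVelocityAt γ U s t)
    (hV : HasCovDerivAt cov γ U V D s t) :
    HasCovDerivAt cov γ U (fun r => S.J (γ r) (V r)) (fun r => S.J (γ r) (D r)) s t := by
  intro c hc
  have hz := ch_mem hc
  have hJ := HasDerivWithinAt.clm_along (A := endCoord S.J c)
    ((S.smooth_J.contDiffAt_endCoord hz).differentiableAt (by simp)) (hU.2 c hc) (hV c hc)
  have he : ∀ r, γ r ∈ chSrc (2 * m + 1) c → ∀ v : TangentSpace (𝓡 (2 * m + 1)) (γ r),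
      endCoord S.J c (extChartAt (𝓡 (2 * m + 1)) c (γ r)) (tc c (γ r) v) =
        tc c (γ r) (S.J (γ r) v) := fun r hr v => by
    have : endCoord S.J c (extChartAt (𝓡 (2 * m + 1)) c (γ r)) =
      (tc c (γ r)).comp ((S.J (γ r)).comp (ts c (γ r))) := by rw [endCoord, pt_ch hr]
    rw [this]
    exact congrArg _ (congrArg _ (ts_tc hr v))
  refine (hJ.congr_of_eventuallyEq (f₁ := fun r => tc c (γ r) (S.J (γ r) (V r))) ?_
    (he t hc _).symm).congr_deriv ?_
  · filter_upwards [hU.1.eventually_chSrc hc] with r hr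
    exact (he r hr _).symm
  · rw [hTW.fderiv_endCoord hz, map_sub, he t hc, he t hc]
    abel

theorem hasDerivWithinAt_metric (hTW : S.IsTanakaWebster cov) (hU : HasVelocityAt γ U s t)
    (hV : HasCovDerivAt cov γ U V D s t) (hW : HasCovDerivAt cov γ U W D' s t) :
    HasDerivWithinAt (fun r => S.metric (γ r) (V r) (W r))
      (S.metric (γ t) (D t) (W t) + S.metric (γ t) (V t) (D' t)) s t := by
  set c := γ t
  have hc : γ t ∈ chSrc (2 * m + 1) c := mem_chart_source _ _
  have hz := ch_mem hc
  have hg := HasDerivWithinAt.clm_along₂ (A := S.metricCoord c)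
    ((S.contDiffAt_metricCoord hz).differentiableAt (by simp)) (hU.2 c hc) (hV c hc) (hW c hc)
  refine (hg.congr_of_eventuallyEq (f₁ := fun r => S.metric (γ r) (V r) (W r)) ?_
    (S.metricCoord_tc hc _ _).symm).congr_deriv ?_
  · filter_upwards [hU.1.eventually_chSrc hc] with r hr
    exact (S.metricCoord_tc hr _ _).symm
  · rw [hTW.fderiv_metricCoord hz, ← S.metricCoord_tc hc (D t), ← S.metricCoord_tc hc (V t),
      map_sub, map_sub, sub_apply]
    ring

theorem hasCovDerivAt_reeb (hTW : S.IsTanakaWebster cov) (hU : HasVelocityAt γ U s t) :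
    HasCovDerivAt cov γ U (fun r => S.reeb (γ r)) (fun _ => 0) s t := by
  have h := hU.hasCovDerivAt_section (cov := cov) (S.smoothFieldAt_reeb (γ t)).fieldDiffAt
  intro c hc
  have := h c hc
  simp only [hTW.cov_reeb] at this
  exact this

end Curves
end IsTanakaWebster
end PseudoHermitian

/-! ### Orthonormal families and expansion of vectors -/

section Linear

variable {V : Type*} [AddCommGroup V] [Module ℝ V] [FiniteDimensional ℝ V]

theorem exists_orthonormal_family {n : ℕ} (hn : Module.finrank ℝ V = n) (B : LinearMap.BilinForm ℝ V)
    (hsymm : ∀ v w, B v w = B w v) (hpos : ∀ v, v ≠ 0 → 0 < B v v) :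
    ∃ e : Fin n → V, ∀ i j, B (e i) (e j) = if i = j then 1 else 0 := by
  subst hn
  obtain ⟨v, hv⟩ := LinearMap.BilinForm.exists_orthogonal_basis (B := B) ⟨fun v w => by simpa using hsymm v w⟩
  refine ⟨fun i => (√(B (v i) (v i)))⁻¹ • v i, fun i j => ?_⟩
  rw [map_smul, map_smul, LinearMap.smul_apply, smul_eq_mul, smul_eq_mul]
  by_cases h : i = j
  · subst h
    have h0 := hpos (v i) (v.ne_zero i)
    have h1 := Real.mul_self_sqrt h0.le
    have h2 := (Real.sqrt_pos.2 h0).ne'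
    rw [if_pos rfl]
    generalize √(B (v i) (v i)) = r at h1 h2
    rw [← h1]
    field_simp
  · rw [show B (v i) (v j) = 0 from hv h, if_neg h]
    simp

theorem sum_smul_of_orthonormal_family {n : ℕ} (hn : Module.finrank ℝ V = n)
    (B : LinearMap.BilinForm ℝ V) {e : Fin n → V}
    (he : ∀ i j, B (e i) (e j) = if i = j then 1 else 0) (v : V) :
    ∑ i, B v (e i) • e i = v := by
  have hli : LinearIndependent ℝ e := by
    rw [Fintype.linearIndependent_iff]
    intro g hg j
    have := congrArg (fun v => B v (e j)) hg
    simpa [map_sum, LinearMap.sum_apply, he] using this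
  rcases isEmpty_or_nonempty (Fin n) with h | h
  · have : Subsingleton V := Module.finrank_zero_iff.1 (by
      rw [hn]; exact Nat.eq_zero_of_not_pos fun h' => h.elim ⟨0, h'⟩)
    exact Subsingleton.elim _ _
  · set b := basisOfLinearIndependentOfCardEqFinrank hli (by rw [Fintype.card_fin, hn]) with hb
    have hbe : ∀ i, b i = e i := fun i => by rw [hb, coe_basisOfLinearIndependentOfCardEqFinrank]
    conv_rhs => rw [← b.sum_repr v]
    refine Finset.sum_congr rfl fun i _ => ?_
    rw [hbe]
    congr 1
    conv_lhs => rw [← b.sum_repr v]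
    simp [map_sum, LinearMap.sum_apply, hbe, he]

end Linear

theorem ContDiffAt.continuousWithinAt_fderiv_apply {E F : Type*} [NormedAddCommGroup E]
    [NormedSpace ℝ E] [NormedAddCommGroup F] [NormedSpace ℝ F] {f : E → F} {x u : ℝ → E} {s : Set ℝ}
    {t : ℝ} (hf : ContDiffAt ℝ ∞ f (x t)) (hx : ContinuousWithinAt x s t)
    (hu : ContinuousWithinAt u s t) : ContinuousWithinAt (fun r => fderiv ℝ f (x r) (u r)) s t :=
  ((hf.fderiv_right (m := 0) (by simp)).continuousAt.comp_continuousWithinAt hx).clm_apply hu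

theorem ContinuousWithinAt.clm_apply₂ {E F G : Type*} [NormedAddCommGroup E] [NormedSpace ℝ E]
    [NormedAddCommGroup F] [NormedSpace ℝ F] [NormedAddCommGroup G] [NormedSpace ℝ G]
    {A : ℝ → E →L[ℝ] F →L[ℝ] G} {u : ℝ → E} {v : ℝ → F} {s : Set ℝ} {t : ℝ}
    (hA : ContinuousWithinAt A s t) (hu : ContinuousWithinAt u s t)
    (hv : ContinuousWithinAt v s t) : ContinuousWithinAt (fun r => A r (u r) (v r)) s t :=
  (ContinuousWithinAt.clm_apply (F := F →L[ℝ] G) hA hu).clm_apply hv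

theorem continuousWithinAt_coordCurvature {E : Type*} [NormedAddCommGroup E] [NormedSpace ℝ E]
    {Γ : E → E →L[ℝ] E →L[ℝ] E} {x u v w : ℝ → E} {s : Set ℝ} {t : ℝ}
    (hΓ : ContDiffAt ℝ ∞ Γ (x t)) (hx : ContinuousWithinAt x s t) (hu : ContinuousWithinAt u s t)
    (hv : ContinuousWithinAt v s t) (hw : ContinuousWithinAt w s t) :
    ContinuousWithinAt (fun r => coordCurvature Γ (x r) (u r) (v r) (w r)) s t := by
  have hc : ContinuousWithinAt (fun r => Γ (x r)) s t :=
    hΓ.continuousAt.comp_continuousWithinAt hx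
  have h1 := ContDiffAt.continuousWithinAt_fderiv_apply (F := E →L[ℝ] E →L[ℝ] E) hΓ hx hu
  have h2 := ContDiffAt.continuousWithinAt_fderiv_apply (F := E →L[ℝ] E →L[ℝ] E) hΓ hx hv
  exact (((h1.clm_apply₂ hv hw).sub (h2.clm_apply₂ hu hw)).add
    (hc.clm_apply₂ hu (hc.clm_apply₂ hv hw))).sub (hc.clm_apply₂ hv (hc.clm_apply₂ hu hw))

section

variable {n : ℕ} {M : Type*} [TopologicalSpace M] [ChartedSpace (EuclideanSpace ℝ (Fin n)) M]
  [IsManifold (𝓡 n) ∞ M] {γ : ℝ → M} {U V D D' : ∀ t, TangentSpace (𝓡 n) (γ t)} {s : Set ℝ} {t : ℝ}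
  {cov : LinearConnection n M}

/-- `HasCovDerivAt` involves the field D only through its value at t. -/
theorem HasCovDerivAt.congr_cov (h : HasCovDerivAt cov γ U V D s t) (hD : D t = D' t) :
    HasCovDerivAt cov γ U V D' s t := by
  intro c hc
  have := h c hc
  rwa [hD] at this

theorem HasCovDerivAt.continuousWithinAt (h : HasCovDerivAt cov γ U V D s t) {c : M}
    (hc : γ t ∈ chSrc n c) : ContinuousWithinAt (fun r => tc c (γ r) (V r)) s t :=
  (h c hc).continuousWithinAt

end

/-! ### Orthonormal bases and the curvature bound in the direction Ju -/

namespace PseudoHermitian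

variable {m : ℕ} {M : Type*} [TopologicalSpace M]
  [ChartedSpace (EuclideanSpace ℝ (Fin (2 * m + 1))) M] [IsManifold (𝓡 (2 * m + 1)) ∞ M]
  (S : PseudoHermitian m M) {cov : LinearConnection (2 * m + 1) M} {x : M}

theorem metric_J_left (x : M) (v w : TangentSpace (𝓡 (2 * m + 1)) x) :
    S.metric x (S.J x v) w = S.dθ x v w := by
  rw [metric_eq, θ_J_apply, zero_mul, zero_add, dθ_J_J]

theorem metric_projH_self (x : M) (v : TangentSpace (𝓡 (2 * m + 1)) x) :
    S.metric x (S.projH x v) (S.projH x v) = S.metric x v v - S.θ x v ^ 2 := by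
  rw [metric_eq, metric_eq, θ_projH, J_projH, dθ_projH_left]
  ring

theorem metric_J_projH (x : M) (v : TangentSpace (𝓡 (2 * m + 1)) x) :
    S.metric x (S.J x v) (S.projH x v) = 0 := by
  rw [metric_J_left, dθ_projH_right]
  have := S.dθ_swap x v v
  linarith

/-- The Webster metric as a bilinear form on a tangent space. -/
def metricForm (x : M) : LinearMap.BilinForm ℝ (TangentSpace (𝓡 (2 * m + 1)) x) :=
  LinearMap.mk₂ ℝ (S.metric x) (S.metric_add_left x) (S.metric_smul_left x) (S.metric_add_right x)
    (S.metric_smul_right x)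

theorem metric_sum_left {ι : Type*} (I : Finset ι) (x : M)
    (v : ι → TangentSpace (𝓡 (2 * m + 1)) x) (w : TangentSpace (𝓡 (2 * m + 1)) x) :
    S.metric x (∑ i ∈ I, v i) w = ∑ i ∈ I, S.metric x (v i) w := by
  change S.metricForm x _ w = _
  rw [map_sum, LinearMap.sum_apply]
  rfl

theorem exists_orthonormal (x : M) : ∃ e : Fin (2 * m + 1) → TangentSpace (𝓡 (2 * m + 1)) x,
    ∀ i j, S.metric x (e i) (e j) = if i = j then 1 else 0 := by
  have : FiniteDimensional ℝ (TangentSpace (𝓡 (2 * m + 1)) x) :=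
    inferInstanceAs (FiniteDimensional ℝ (EuclideanSpace ℝ (Fin (2 * m + 1))))
  exact exists_orthonormal_family finrank_euclideanSpace_fin (S.metricForm x) (S.metric_comm x)
    fun v hv => lt_of_le_of_ne (S.metric_self_nonneg x v)
      fun h => hv (S.eq_zero_of_metric_self x h.symm)

theorem sum_metric_smul {e : Fin (2 * m + 1) → TangentSpace (𝓡 (2 * m + 1)) x}
    (he : ∀ i j, S.metric x (e i) (e j) = if i = j then 1 else 0)
    (v : TangentSpace (𝓡 (2 * m + 1)) x) : ∑ i, S.metric x v (e i) • e i = v := by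
  have : FiniteDimensional ℝ (TangentSpace (𝓡 (2 * m + 1)) x) :=
    inferInstanceAs (FiniteDimensional ℝ (EuclideanSpace ℝ (Fin (2 * m + 1))))
  exact sum_smul_of_orthonormal_family finrank_euclideanSpace_fin (S.metricForm x) he v

theorem curvature_sum_left [T2Space M] (hcov : cov.ContMDiffCovariantDerivative ∞) {ι : Type*}
    (I : Finset ι) (f : ι → ℝ) (u : ι → TangentSpace (𝓡 (2 * m + 1)) x)
    (v w : TangentSpace (𝓡 (2 * m + 1)) x) :
    curvature cov x (∑ i ∈ I, f i • u i) v w = ∑ i ∈ I, f i • curvature cov x (u i) v w := by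
  let L : TangentSpace (𝓡 (2 * m + 1)) x →ₗ[ℝ] TangentSpace (𝓡 (2 * m + 1)) x :=
    { toFun := fun u => curvature cov x u v w
      map_add' := fun u u' => IsTanakaWebster.curvature_add_left hcov u u' v w
      map_smul' := fun r u => IsTanakaWebster.curvature_smul_left hcov r u v w }
  change L _ = ∑ i ∈ I, f i • L (u i)
  rw [map_sum]
  simp only [map_smul]

/-- Lower bound of the Jacobi operator `R(·, u)u` in the direction `J u`. -/
theorem IsTanakaWebster.le_metric_curvature_J [T2Space M] (hTW : S.IsTanakaWebster cov)
    (hS : S.IsSasakian cov) {k₀ : ℝ}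
    (hK : ∀ v ∈ S.H x, ∀ w ∈ S.H x, LinearIndependent ℝ ![v, w] →
      k₀ ≤ S.horizontalSectionalCurvature cov x v w)
    {u : TangentSpace (𝓡 (2 * m + 1)) x} (hu : S.metric x u u = 1) (hθ : S.θ x u ^ 2 < 1) :
    k₀ * (1 - S.θ x u ^ 2) ^ 2 ≤ S.metric x (curvature cov x (S.J x u) u u) (S.J x u) := by
  set q := 1 - S.θ x u ^ 2 with hq
  have hq0 : 0 < q := sub_pos.2 hθ
  have h1 : S.metric x (S.J x u) (S.J x u) = q := by rw [metric_J_J, hu]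
  -- Ju and π_H u are orthogonal of equal squared length q, so the denominator of the sectional
  -- curvature of their plane is q².
  have h2 : S.metric x (S.projH x u) (S.projH x u) = q := by rw [metric_projH_self, hu]
  have h3 := S.metric_J_projH x u
  have hli : LinearIndependent ℝ ![S.J x u, S.projH x u] := by
    rw [LinearIndependent.pair_iff]
    intro r r' h
    have e1 := congrArg (fun v => S.metric x v (S.J x u)) h
    have e2 := congrArg (fun v => S.metric x v (S.projH x u)) h
    simp only [metric_add_left, metric_smul_left, metric_zero_left, h1, h2, h3,
      S.metric_comm x (S.projH x u) (S.J x u)] at e1 e2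
    constructor
    · simpa [hq0.ne'] using e1
    · simpa [hq0.ne'] using e2
  have h := hK _ (S.θ_J_apply x u) _ (S.θ_projH x u) hli
  rw [horizontalSectionalCurvature, h1, h2, h3, ← hTW.curvature_projH hS,
    le_div_iff₀ (by nlinarith)] at h
  nlinarith

end PseudoHermitian

/-! ### Parallel frames and the Jacobi equation in a frame -/

section Frame

variable {n : ℕ} {M : Type*} [TopologicalSpace M] [ChartedSpace (EuclideanSpace ℝ (Fin n)) M]
  {γ : ℝ → M}

/-- The vector along a curve with given components in a frame. -/
def frameVec (E : Fin n → ∀ t, TangentSpace (𝓡 n) (γ t)) (t : ℝ) (y : Eu n) :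
    TangentSpace (𝓡 n) (γ t) := ∑ i, y i • E i t

theorem frameVec_zero (E : Fin n → ∀ t, TangentSpace (𝓡 n) (γ t)) (t : ℝ) :
    frameVec E t 0 = 0 := by simp [frameVec]

theorem frameVec_neg (E : Fin n → ∀ t, TangentSpace (𝓡 n) (γ t)) (t : ℝ) (y : Eu n) :
    frameVec E t (-y) = -frameVec E t y := by
  simp [frameVec]

end Frame

namespace PseudoHermitian

variable {m : ℕ} {M : Type*} [TopologicalSpace M]
  [ChartedSpace (EuclideanSpace ℝ (Fin (2 * m + 1))) M] [IsManifold (𝓡 (2 * m + 1)) ∞ M]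
  {S : PseudoHermitian m M} {cov : LinearConnection (2 * m + 1) M} {γ : ℝ → M}
  {U V W : ∀ t, TangentSpace (𝓡 (2 * m + 1)) (γ t)} {a b : ℝ}
  {E : Fin (2 * m + 1) → ∀ t, TangentSpace (𝓡 (2 * m + 1)) (γ t)}

theorem IsTanakaWebster.metric_eq_of_parallel (hTW : S.IsTanakaWebster cov)
    (hU : ∀ t ∈ Icc a b, HasVelocityAt γ U (Icc a b) t)
    (hV : ∀ t ∈ Icc a b, HasCovDerivAt cov γ U V (fun _ => 0) (Icc a b) t)
    (hW : ∀ t ∈ Icc a b, HasCovDerivAt cov γ U W (fun _ => 0) (Icc a b) t) :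
    ∀ t ∈ Icc a b, S.metric (γ t) (V t) (W t) = S.metric (γ a) (V a) (W a) :=
  eq_of_hasDerivWithinAt_zero fun t ht => by
    refine (hTW.hasDerivWithinAt_metric (hU t ht) (hV t ht) (hW t ht)).congr_deriv ?_
    rw [metric_zero_left, metric_comm, metric_zero_left, add_zero]

/-- A parallel orthonormal frame along a curve with velocity `U`. -/
structure IsParallelFrame (S : PseudoHermitian m M) (cov : LinearConnection (2 * m + 1) M)
    (γ : ℝ → M) (U : ∀ t, TangentSpace (𝓡 (2 * m + 1)) (γ t))
    (E : Fin (2 * m + 1) → ∀ t, TangentSpace (𝓡 (2 * m + 1)) (γ t)) (a b : ℝ) : Prop where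
  parallel : ∀ i, ∀ t ∈ Icc a b, HasCovDerivAt cov γ U (E i) (fun _ => 0) (Icc a b) t
  orthonormal : ∀ t ∈ Icc a b, ∀ i j, S.metric (γ t) (E i t) (E j t) = if i = j then 1 else 0

theorem IsTanakaWebster.exists_parallelFrame [T2Space M] (hTW : S.IsTanakaWebster cov)
    (hab : a ≤ b) (hU : ∀ t ∈ Icc a b, HasVelocityAt γ U (Icc a b) t)
    (hUU : ∀ t ∈ Icc a b, HasCovDerivAt cov γ U U (fun _ => 0) (Icc a b) t) :
    ∃ E : Fin (2 * m + 1) → ∀ t, TangentSpace (𝓡 (2 * m + 1)) (γ t),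
      IsParallelFrame S cov γ U E a b := by
  obtain ⟨e, he⟩ := S.exists_orthonormal (γ a)
  have h := fun i => exists_parallel hTW.smooth hab hU (fun c t ht =>
    ((hUU t ht.1).continuousWithinAt ht.2).mono inter_subset_left) (e i)
  choose E hE0 hE using h
  refine ⟨E, hE, fun t ht i j => ?_⟩
  rw [hTW.metric_eq_of_parallel hU (hE i) (hE j) t ht, hE0, hE0, he]

/-- The components of the Jacobi operator `R(·, γ')γ'` in a frame. -/
def jacobiCoeff (S : PseudoHermitian m M) (cov : LinearConnection (2 * m + 1) M)
    (γ : ℝ → M) (U : ∀ t, TangentSpace (𝓡 (2 * m + 1)) (γ t))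
    (E : Fin (2 * m + 1) → ∀ t, TangentSpace (𝓡 (2 * m + 1)) (γ t)) (i j : Fin (2 * m + 1))
    (t : ℝ) : ℝ :=
  S.metric (γ t) (curvature cov (γ t) (E j t) (U t) (U t)) (E i t)

/-- Pair symmetry followed by the two antisymmetries of R. -/
theorem IsTanakaWebster.jacobiCoeff_symm [T2Space M] (hTW : S.IsTanakaWebster cov)
    (hS : S.IsSasakian cov) (i j : Fin (2 * m + 1)) (t : ℝ) :
    jacobiCoeff S cov γ U E i j t = jacobiCoeff S cov γ U E j i t := by
  rw [jacobiCoeff, hTW.metric_curvature_pair hS, curvature_swap hTW.smooth, metric_neg_left,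
    ← hTW.metric_curvature_swap_right, jacobiCoeff]

theorem IsTanakaWebster.continuousOn_jacobiCoeff [T2Space M] (hTW : S.IsTanakaWebster cov)
    (hU : ∀ t ∈ Icc a b, HasVelocityAt γ U (Icc a b) t)
    (hUU : ∀ t ∈ Icc a b, HasCovDerivAt cov γ U U (fun _ => 0) (Icc a b) t)
    (hE : IsParallelFrame S cov γ U E a b) (i j : Fin (2 * m + 1)) :
    ContinuousOn (jacobiCoeff S cov γ U E i j) (Icc a b) := by
  intro t ht
  set c := γ t
  have hc : γ t ∈ chSrc (2 * m + 1) c := mem_chart_source _ _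
  have hz := ch_mem hc
  have hx := ((hU t ht).2 c hc).continuousWithinAt
  have hu := (hUU t ht).continuousWithinAt hc
  have he := fun i => (hE.parallel i t ht).continuousWithinAt hc
  have hR := continuousWithinAt_coordCurvature
    ((contDiffOn_christoffel hTW.smooth c).contDiffAt ((isOpen_chTgt c).mem_nhds hz)) hx (he j) hu hu
  have hg := ((S.contDiffAt_metricCoord hz).continuousAt.comp_continuousWithinAt
    (f := fun r => extChartAt (𝓡 (2 * m + 1)) c (γ r)) hx).clm_apply₂ hR (he i)
  have key : ∀ r, γ r ∈ chSrc (2 * m + 1) c → jacobiCoeff S cov γ U E i j r =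
      S.metricCoord c (extChartAt (𝓡 (2 * m + 1)) c (γ r))
        (coordCurvature (christoffel cov c) (extChartAt (𝓡 (2 * m + 1)) c (γ r))
          (tc c (γ r) (E j r)) (tc c (γ r) (U r)) (tc c (γ r) (U r))) (tc c (γ r) (E i r)) :=
    fun r hr => by rw [jacobiCoeff, ← tc_curvature hTW.smooth hr, S.metricCoord_tc hr]
  refine hg.congr_of_eventuallyEq ?_ (key t hc)
  filter_upwards [(hU t ht).1.eventually_chSrc hc] with r hr
  exact key r hr

/-- The Jacobi operator `R(·, γ')γ'` in a frame. -/
def jacobiOp (S : PseudoHermitian m M) (cov : LinearConnection (2 * m + 1) M)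
    (γ : ℝ → M) (U : ∀ t, TangentSpace (𝓡 (2 * m + 1)) (γ t))
    (E : Fin (2 * m + 1) → ∀ t, TangentSpace (𝓡 (2 * m + 1)) (γ t)) (t : ℝ) :
    Eu (2 * m + 1) →L[ℝ] Eu (2 * m + 1) :=
  ∑ i, ∑ j, jacobiCoeff S cov γ U E i j t •
    (EuclideanSpace.proj (𝕜 := ℝ) j).smulRight (EuclideanSpace.single i (1 : ℝ))

theorem jacobiOp_apply (t : ℝ) (y : Eu (2 * m + 1)) (i : Fin (2 * m + 1)) :
    jacobiOp S cov γ U E t y i = ∑ j, jacobiCoeff S cov γ U E i j t * y j := by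
  simp [jacobiOp, Finset.sum_apply, Pi.single_apply]

theorem metric_frameVec_left (t : ℝ) (y : Eu (2 * m + 1))
    (w : TangentSpace (𝓡 (2 * m + 1)) (γ t)) :
    S.metric (γ t) (frameVec E t y) w = ∑ i, y i * S.metric (γ t) (E i t) w := by
  rw [frameVec, metric_sum_left]
  simp only [metric_smul_left]

/-- Together with `hasCovDerivAt_frameVec` this translates ∇∇Y = -R(Y,U)U into the matrix equation
to which `exists_jacobi_zero` applies. -/
theorem curvature_frameVec [T2Space M] (hcov : cov.ContMDiffCovariantDerivative ∞)
    (hE : IsParallelFrame S cov γ U E a b) {t : ℝ} (ht : t ∈ Icc a b) (y : Eu (2 * m + 1)) :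
    curvature cov (γ t) (frameVec E t y) (U t) (U t) =
      frameVec E t (jacobiOp S cov γ U E t y) := by
  rw [← S.sum_metric_smul (hE.orthonormal t ht) (curvature cov (γ t) (frameVec E t y) (U t) (U t))]
  refine Finset.sum_congr rfl fun i _ => congrArg (· • E i t) ?_
  rw [frameVec, curvature_sum_left hcov, metric_sum_left, jacobiOp_apply]
  refine Finset.sum_congr rfl fun j _ => ?_
  rw [metric_smul_left, mul_comm, jacobiCoeff]

theorem IsParallelFrame.hasCovDerivAt_frameVec (hE : IsParallelFrame S cov γ U E a b) {t : ℝ}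
    (ht : t ∈ Icc a b) {y : ℝ → Eu (2 * m + 1)} {z : ℝ → Eu (2 * m + 1)}
    (hy : HasDerivWithinAt y (z t) (Icc a b) t) :
    HasCovDerivAt cov γ U (fun r => frameVec E r (y r)) (fun r => frameVec E r (z r))
      (Icc a b) t := by
  have h := HasCovDerivAt.sum Finset.univ fun i => (hE.parallel i t ht).fsmul
    ((EuclideanSpace.proj (𝕜 := ℝ) i).hasFDerivAt.along hy)
  refine h.congr_cov ?_
  simp only [smul_zero, add_zero]
  rfl

/-- The Euclidean inner product in components. -/
def dotForm (n : ℕ) : Eu n →L[ℝ] Eu n →L[ℝ] ℝ :=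
  ∑ i, (EuclideanSpace.proj (𝕜 := ℝ) i).smulRight (EuclideanSpace.proj (𝕜 := ℝ) i)

theorem dotForm_apply {n : ℕ} (u v : Eu n) : dotForm n u v = ∑ i, u i * v i := by
  simp [dotForm]

theorem metric_frameVec (hE : IsParallelFrame S cov γ U E a b) {t : ℝ} (ht : t ∈ Icc a b)
    (y z : Eu (2 * m + 1)) :
    S.metric (γ t) (frameVec E t y) (frameVec E t z) = dotForm _ y z := by
  rw [metric_frameVec_left, dotForm_apply]
  refine Finset.sum_congr rfl fun i _ => ?_
  rw [S.metric_comm, metric_frameVec_left]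
  simp [hE.orthonormal t ht]

theorem IsTanakaWebster.dotForm_jacobiOp [T2Space M] (hTW : S.IsTanakaWebster cov)
    (hS : S.IsSasakian cov) (t : ℝ) (y z : Eu (2 * m + 1)) :
    dotForm _ (jacobiOp S cov γ U E t y) z = dotForm _ y (jacobiOp S cov γ U E t z) := by
  simp only [dotForm_apply, jacobiOp_apply, Finset.sum_mul, Finset.mul_sum]
  rw [Finset.sum_comm]
  refine Finset.sum_congr rfl fun i _ => Finset.sum_congr rfl fun j _ => ?_
  rw [hTW.jacobiCoeff_symm hS]
  ring

/-- Along a nonvertical geodesic, the Jacobi equation in a parallel frame has a nontrivial solution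
that vanishes at `a` and at a later point. -/
theorem IsTanakaWebster.exists_frame_jacobi_zero [T2Space M] (hTW : S.IsTanakaWebster cov)
    (hS : S.IsSasakian cov) {k₀ : ℝ} (hk₀ : 0 < k₀)
    (hK : ∀ (x : M), ∀ v ∈ S.H x, ∀ w ∈ S.H x, LinearIndependent ℝ ![v, w] →
      k₀ ≤ S.horizontalSectionalCurvature cov x v w) (hle : a ≤ b)
    (hU : ∀ t ∈ Icc a b, HasVelocityAt γ U (Icc a b) t)
    (hUU : ∀ t ∈ Icc a b, HasCovDerivAt cov γ U U (fun _ => 0) (Icc a b) t)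
    (harc : ∀ t ∈ Icc a b, S.metric (γ t) (U t) (U t) = 1)
    (hvert : S.metric (γ a) (U a) (S.reeb (γ a)) ^ 2 < 1)
    (hab : Real.pi / √(k₀ * (1 - S.metric (γ a) (U a) (S.reeb (γ a)) ^ 2)) ≤ b - a)
    (hE : IsParallelFrame S cov γ U E a b) :
    ∃ t ∈ Ioc a b, ∃ y z : ℝ → Eu (2 * m + 1), (∀ s ∈ Icc a b,
      HasDerivWithinAt y (z s) (Icc a b) s ∧
        HasDerivWithinAt z (-(jacobiOp S cov γ U E s (y s))) (Icc a b) s) ∧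
      y a = 0 ∧ z a ≠ 0 ∧ y t = 0 := by
  set c := S.metric (γ a) (U a) (S.reeb (γ a)) with hc
  have hq : 0 < 1 - c ^ 2 := sub_pos.2 hvert
  set q := √(1 - c ^ 2) with hqdef
  have hq0 : 0 < q := Real.sqrt_pos.2 hq
  have hqq : q * q = 1 - c ^ 2 := Real.mul_self_sqrt hq.le
  have hθ : ∀ t ∈ Icc a b, S.θ (γ t) (U t) = c := fun t ht => by
    rw [← metric_reeb_right]
    exact hTW.metric_eq_of_parallel hU hUU (fun t ht => hTW.hasCovDerivAt_reeb (hU t ht)) t ht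
  have hJ : ∀ t ∈ Icc a b, HasCovDerivAt cov γ U (fun r => S.J (γ r) (U r)) (fun _ => 0)
      (Icc a b) t := fun t ht => (hTW.hasCovDerivAt_J (hU t ht) (hUU t ht)).congr_cov (map_zero _)
  -- The components of JU/q at time a. Both JU and the frame are parallel, so the same constant
  -- vector represents JU/q at all times; this supplies the fixed e of the Sturm comparison.
  set e : Eu (2 * m + 1) := WithLp.toLp 2 fun i =>
    q⁻¹ * S.metric (γ a) (S.J (γ a) (U a)) (E i a) with he
  have hFe : ∀ t ∈ Icc a b, frameVec E t e = q⁻¹ • S.J (γ t) (U t) := fun t ht => by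
    rw [← S.sum_metric_smul (hE.orthonormal t ht) (S.J (γ t) (U t)), Finset.smul_sum]
    refine Finset.sum_congr rfl fun i _ => ?_
    rw [smul_smul, hTW.metric_eq_of_parallel hU hJ (hE.parallel i) t ht]
  have ha : a ∈ Icc a b := left_mem_Icc.2 hle
  refine exists_jacobi_zero (B := dotForm (2 * m + 1)) (e := e) (R := jacobiOp S cov γ U E)
    (k := k₀ * (1 - c ^ 2)) ?_ ?_ ?_ (fun t _ => hTW.dotForm_jacobiOp hS t) ?_
    (mul_pos hk₀ hq) (fun t ht => ?_) hab
  · intro u v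
    simp only [dotForm_apply, mul_comm]
  · intro u
    rw [dotForm_apply]
    exact Finset.sum_nonneg fun i _ => mul_self_nonneg _
  · refine continuousOn_finsetSum _ fun i _ => continuousOn_finsetSum _ fun j _ => ?_
    exact (hTW.continuousOn_jacobiCoeff hU hUU hE i j).smul continuousOn_const
  · rw [← metric_frameVec hE ha, hFe a ha, metric_smul_left, metric_smul_right, metric_J_J,
      harc a ha, hθ a ha, ← hqq]
    field_simp
  -- The bound k₀q⁴ for JU is divided by q², as e represents JU/q, and gives k₀q² = k₀(1 - c²).
  · rw [← metric_frameVec hE ht, ← curvature_frameVec hTW.smooth hE ht, hFe t ht,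
      curvature_smul_left hTW.smooth, metric_smul_left, metric_smul_right]
    have h := hTW.le_metric_curvature_J S hS (hK (γ t)) (harc t ht) (by rwa [hθ t ht])
    rw [hθ t ht, ← hqq] at h
    rw [← hqq]
    calc k₀ * (q * q) = q⁻¹ * (q⁻¹ * (k₀ * (q * q) ^ 2)) := by field_simp
      _ ≤ _ := by gcongr

theorem IsParallelFrame.frameVec_injective (hE : IsParallelFrame S cov γ U E a b) {t : ℝ}
    (ht : t ∈ Icc a b) {y : Eu (2 * m + 1)} (h : frameVec E t y = 0) : y = 0 := by
  ext i
  have := metric_frameVec_left (S := S) (E := E) t y (E i t)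
  rw [h, metric_zero_left] at this
  simpa [hE.orthonormal t ht] using this.symm

/-- The horizontal part of the initial derivative: the component along the Reeb field of a
solution of the Jacobi equation in a frame vanishes if the solution has two zeros. -/
theorem IsTanakaWebster.θ_frameVec_eq_zero [T2Space M] (hTW : S.IsTanakaWebster cov)
    (hE : IsParallelFrame S cov γ U E a b)
    (hU : ∀ t ∈ Icc a b, HasVelocityAt γ U (Icc a b) t) {y z : ℝ → Eu (2 * m + 1)}
    (hyz : ∀ s ∈ Icc a b, HasDerivWithinAt y (z s) (Icc a b) s ∧
        HasDerivWithinAt z (-(jacobiOp S cov γ U E s (y s))) (Icc a b) s)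
    {t : ℝ} (ht : t ∈ Ioc a b) (hya : y a = 0) (hyt : y t = 0) :
    S.θ (γ a) (frameVec E a (z a)) = 0 := by
  have hξ := fun t ht => hTW.hasCovDerivAt_reeb (hU t ht)
  -- The Reeb component of z is constant, because ⟨R(Y,U)U, ξ⟩ = -⟨R(Y,U)ξ, U⟩ = 0. That of y is
  -- therefore affine with slope κ, and its zeros at a and t give κ = 0.
  have hz : ∀ s ∈ Icc a b, S.metric (γ s) (frameVec E s (z s)) (S.reeb (γ s)) =
      S.metric (γ a) (frameVec E a (z a)) (S.reeb (γ a)) := by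
    refine eq_of_hasDerivWithinAt_zero fun s hs => ?_
    have h := hTW.hasDerivWithinAt_metric (hU s hs) (hE.hasCovDerivAt_frameVec hs
      (z := fun s => -(jacobiOp S cov γ U E s (y s))) (hyz s hs).2) (hξ s hs)
    refine h.congr_deriv ?_
    rw [frameVec_neg, ← curvature_frameVec hTW.smooth hE hs, metric_neg_left,
      hTW.metric_curvature_swap_right, hTW.curvature_reeb_right, metric_zero_left, metric_comm,
      metric_zero_left]
    simp
  set κ := S.metric (γ a) (frameVec E a (z a)) (S.reeb (γ a)) with hκ
  have hy := eq_of_hasDerivWithinAt_zero (a := a) (b := b)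
    (f := fun s => S.metric (γ s) (frameVec E s (y s)) (S.reeb (γ s)) - κ * s) fun s hs => by
      have h := (hTW.hasDerivWithinAt_metric (hU s hs)
        (hE.hasCovDerivAt_frameVec hs (z := z) (hyz s hs).1) (hξ s hs)).sub
        ((hasDerivWithinAt_id s _).const_mul κ)
      refine h.congr_deriv ?_
      rw [hz s hs, metric_comm, metric_zero_left]
      ring
  have h := hy t (Ioc_subset_Icc_self ht)
  simp only [hya, hyt, frameVec_zero, metric_zero_left] at h
  rw [metric_reeb_right] at hκ
  rw [← hκ]
  have h2 : κ * (t - a) = 0 := by linarith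
  exact (mul_eq_zero.1 h2).resolve_right (sub_pos.2 ht.1).ne'

/-- A Jacobi field of the Tanaka–Webster connection from a solution in a parallel frame with two
zeros: its Reeb component is determined by integration. -/
theorem IsTanakaWebster.exists_isJacobiOn [T2Space M] (hTW : S.IsTanakaWebster cov)
    (hS : S.IsSasakian cov) (hE : IsParallelFrame S cov γ U E a b)
    (hU : ∀ t ∈ Icc a b, HasVelocityAt γ U (Icc a b) t)
    (hUU : ∀ t ∈ Icc a b, HasCovDerivAt cov γ U U (fun _ => 0) (Icc a b) t)
    {y z : ℝ → Eu (2 * m + 1)}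
    (hyz : ∀ s ∈ Icc a b, HasDerivWithinAt y (z s) (Icc a b) s ∧
        HasDerivWithinAt z (-(jacobiOp S cov γ U E s (y s))) (Icc a b) s)
    {t : ℝ} (ht : t ∈ Ioc a b) (hya : y a = 0) (hza : z a ≠ 0) (hyt : y t = 0) :
    ∃ V W : ∀ t, TangentSpace (𝓡 (2 * m + 1)) (γ t), IsJacobiOn cov γ U V W (Icc a b) ∧
      V a = 0 ∧ V t = 0 ∧ W a ≠ 0 := by
  have hle : a ≤ b := ht.1.le.trans ht.2
  have ha : a ∈ Icc a b := left_mem_Icc.2 hle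
  have hY := fun s hs => hE.hasCovDerivAt_frameVec hs (z := z) (hyz s hs).1
  have hcont : ContinuousOn (fun s => -(2 * S.dθ (γ s) (frameVec E s (y s)) (U s))) (Icc a b) := by
    intro s hs
    -- Continuity of dθ(Y,U) is read off from dθ(Y,U) = ⟨JY,U⟩, which is even differentiable along
    -- γ.
    have h := (hTW.hasDerivWithinAt_metric (hU s hs) (hTW.hasCovDerivAt_J (hU s hs) (hY s hs))
      (hUU s hs)).continuousWithinAt
    simp only [metric_J_left] at h
    exact (continuousWithinAt_const.mul h).neg
  -- A primitive of -2dθ(Y,U), obtained as the solution of an equation whose right-hand side does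
  -- not depend on the state.
  obtain ⟨g, hg0, hg⟩ := exists_ode_solution (K := 0) hle
    (f := fun s _ => -(2 * S.dθ (γ s) (frameVec E s (y s)) (U s)))
    (fun s _ => LipschitzWith.const _) (fun _ => hcont) 0
  have hta : t - a ≠ 0 := (sub_pos.2 ht.1).ne'
  -- The slope for which C(s - a) + g(s), already zero at a, also vanishes at t.
  set C := -g t / (t - a) with hC
  have hf : ∀ s ∈ Icc a b, HasDerivWithinAt (fun s => C * (s - a) + g s)
      (C - 2 * S.dθ (γ s) (frameVec E s (y s)) (U s)) (Icc a b) s := fun s hs => by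
    refine ((((hasDerivWithinAt_id s _).sub_const a).const_mul C).add (hg s hs)).congr_deriv ?_
    ring
  refine ⟨fun s => frameVec E s (y s) + (C * (s - a) + g s) • S.reeb (γ s),
    fun s => frameVec E s (z s) + C • S.reeb (γ s), ⟨fun s hs => ?_, fun s hs => ?_⟩, ?_, ?_, ?_⟩
  · refine ((hY s hs).add ((hTW.hasCovDerivAt_reeb (hU s hs)).fsmul (hf s hs))).congr_cov ?_
    rw [hTW.torsion_eq hS, map_add, add_apply, map_smul, smul_apply, dθ_reeb_left, smul_zero,
      add_zero, smul_zero, add_zero, sub_smul, add_sub_assoc]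
  · refine ((hE.hasCovDerivAt_frameVec hs (z := fun s => -(jacobiOp S cov γ U E s (y s)))
      (hyz s hs).2).add ((hTW.hasCovDerivAt_reeb (hU s hs)).fsmul
        (hasDerivWithinAt_const s _ C))).congr_cov ?_
    rw [smul_zero, zero_smul, add_zero, add_zero, curvature_add_left hTW.smooth,
      curvature_smul_left hTW.smooth, hTW.curvature_reeb_left hS, smul_zero, add_zero,
      curvature_frameVec hTW.smooth hE hs, frameVec_neg]
  · simp only [hya, hg0, frameVec_zero, sub_self, mul_zero, zero_add, zero_smul]
  · have : C * (t - a) + g t = 0 := by rw [hC]; field_simp; ring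
    simp only [hyt, frameVec_zero, this, zero_add, zero_smul]
  -- The frame part of W(a) has no Reeb component, so W(a) = 0 would give C = 0 by applying θ, and
  -- then z(a) = 0.
  · intro h
    have h1 := hTW.θ_frameVec_eq_zero hE hU hyz ht hya hyt
    have h2 := congrArg (S.θ (γ a)) h
    simp only [map_add, map_smul, map_zero, h1, θ_reeb, smul_eq_mul, mul_one, zero_add] at h2
    simp only [h2, zero_smul, add_zero] at h
    exact hza (hE.frameVec_injective ha h)

end PseudoHermitian

/-! ### Existence of the conjugate point -/

theorem theorem5p3 {m : ℕ} {M : Type*} [TopologicalSpace M] [T2Space M]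
    [ChartedSpace (EuclideanSpace ℝ (Fin (2 * m + 1))) M] [IsManifold (𝓡 (2 * m + 1)) ∞ M]
    (S : PseudoHermitian m M) (cov : LinearConnection (2 * m + 1) M)
    (hTW : S.IsTanakaWebster cov) (hS : S.IsSasakian cov)
    (k₀ : ℝ) (hk₀ : 0 < k₀)
    (hK : ∀ (x : M), ∀ v ∈ S.H x, ∀ w ∈ S.H x, LinearIndependent ℝ ![v, w] →
      k₀ ≤ S.horizontalSectionalCurvature cov x v w)
    (γ : ℝ → M) (a b : ℝ)
    (hγ : IsGeodesicOn cov γ (Icc a b))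
    (harc : ∀ t ∈ Icc a b, S.metric (γ t)
      (velocity (2 * m + 1) γ (Icc a b) t) (velocity (2 * m + 1) γ (Icc a b) t) = 1)
    (hvert : S.metric (γ a) (velocity (2 * m + 1) γ (Icc a b) a) (S.reeb (γ a)) ^ 2 < 1)
    (hab : Real.pi / √(k₀ * (1 - S.metric (γ a) (velocity (2 * m + 1) γ (Icc a b) a)
      (S.reeb (γ a)) ^ 2)) ≤ b - a) :
    ∃ t ∈ Ioc a b, IsConjugateAlong cov (γ a)
      ((t - a) • velocity (2 * m + 1) γ (Icc a b) a) (γ t) := by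
  have hlt : a < b := sub_pos.1 <|
    (div_pos Real.pi_pos (Real.sqrt_pos.2 (mul_pos hk₀ (sub_pos.2 hvert)))).trans_le hab
  have hU := fun t ht => hγ.hasVelocityAt (t := t) ht
  have hUU := fun t ht => hγ.hasCovDerivAt (uniqueDiffOn_Icc hlt) (t := t) ht
  obtain ⟨E, hE⟩ := hTW.exists_parallelFrame hlt.le hU hUU
  obtain ⟨t, ht, y, z, hyz, hya, hza, hyt⟩ :=
    hTW.exists_frame_jacobi_zero hS hk₀ hK hlt.le hU hUU harc hvert hab hE
  obtain ⟨V, W, hJ, hVa, hVt, hWa⟩ := hTW.exists_isJacobiOn hS hE hU hUU hyz ht hya hza hyt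
  -- The Jacobi field lives on all of [a, b]; it is restricted to [a, t] so that its second zero is
  -- at the endpoint.
  have hsub : Icc a t ⊆ Icc a b := Icc_subset_Icc_right ht.2
  have hn : ∀ s, Icc a b ∈ 𝓝[Icc a t] s := fun s => Icc_mem_nhdsWithin_of_subset hsub
  exact ⟨t, ht, isConjugateAlong_of_isJacobiOn hTW.smooth ht.1
    (fun s hs => (hU s (hsub hs)).mono (hn s)) (fun s hs => (hUU s (hsub hs)).mono (hn s))
    ⟨fun s hs => (hJ.fst s (hsub hs)).mono (hn s), fun s hs => (hJ.snd s (hsub hs)).mono (hn s)⟩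
    hVa hVt hWa⟩

end
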